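/- Let $n\ge 1$ and let $\Gamma$ be the Dynkin diagram of type $A_n$ with vertices $1,\dots,n$, arrows $h:i\to j$ for $|i-j|=1$ (with $\bar h:j\to i$), and $\varepsilon(h)=i-j$ for $h:i\to j$. Let $V=\bigoplus V_i$, $W=\bigoplus W_i$ be graded complex vector spaces of dimension vectors $\mathbf v,\mathbf w\in\mathbb N^n$ with $\mathbf w_i=0$ for $i\ge2$ and $\mathbf w_1\ge \mathbf v_1\ge\dots\ge \mathbf v_n$, and fix nondegenerate bilinear forms on all $V_i$ and $W_i$ (for example symmetric or symplectic ones); $T^*$ denotes the right adjoint, $(Te,e')=(e,T^*e')$. Let $\zeta=(\xi,0)$ with $\xi\in\mathbb Z^n$, $\xi_i>0$ and $\xi_{n+1-i}=\xi_i$ for all $i$. For $\eta\in\mathbb Z^n$ let $\Lambda^{\eta\text{-}ss}(\mathbf v,\mathbf w)$ be the set of triples $\mathbf x=(x_h,p_i,q_i)$, $x_h\in\mathrm{Hom}(V_i,V_j)$ for $h:i\to j$, $p_i\in\mathrm{Hom}(W_i,V_i)$, $q_i\in\mathrm{Hom}(V_i,W_i)$, with $\sum_{h:j\to i}\varepsilon(h)x_hx_{\bar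 h}=p_iq_i$ for all $i$, such that $\eta\cdot\dim S\le 0$ for every $x$-invariant graded subspace $S\subseteq\ker q$ of $V$ and $\eta\cdot\dim T\le\eta\cdot\mathbf v$ for every $x$-invariant graded subspace $T\supseteq\mathrm{im}\,p$. For $\eta$ in the Weyl group orbit of $\xi$ (such $\eta$ are generic), $\mathfrak M_{(\eta,0)}(\mathbf v,\mathbf w)=\Lambda^{\eta\text{-}ss}(\mathbf v,\mathbf w)/\prod_i GL(V_i)$ (geometric quotient) is Nakajima's quiver variety. Let $\mathscr F_{\mathbf v,\mathbf w}$ be the variety of flags $F=(W_1=F_0\supseteq F_1\supseteq\dots\supseteq F_n\supseteq F_{n+1}=0)$ with $\dim F_i=\mathbf v_i$ for $1\le i\le n$, and $T^*\mathscr F_{\mathbf v,\mathbf w}=\{(x,F)\in\mathrm{End}(W_1)\times\mathscr F_{\mathbf v,\mathbf w}: x(F_i)\subseteq F_{i+1},\ 0\le i\le n\}$ its cotangent bundle. Nakajima's isomorphism of varieties $\phi:\mathfrak M_\zeta(\mathbf v,\mathbf w)\to T^*\mathscr F_{\mathbf v,\mathbf w}$ is $$\phi([\mathbf x])=\bigl(q_1p_1,\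 W_1\supseteq\mathrm{im}\,q_1\supseteq\mathrm{im}\,q_1y_1\supseteq\dots\supseteq\mathrm{im}\,q_1y_1\cdots y_{n-1}\supseteq0\bigr),\qquad y_i=x_{i+1\to i}.$$ Let $w_0$ be the longest element of the Weyl group, and $w_0*\mathbf v$ the result of its affine action, where $s_i*\mathbf v$ differs from $\mathbf v$ only in the $i$-th entry $\mathbf v_i-\sum_jc_{ij}\mathbf v_j+\mathbf w_i$, with $(c_{ij})$ the Cartan matrix; thus $(w_0*\mathbf v)_i=\mathbf w_1-\mathbf v_{n+1-i}$. Let $\tau:\mathfrak M_\zeta(\mathbf v,\mathbf w)\to\mathfrak M_{-\zeta}(\mathbf v,\mathbf w)$ be induced by $x_h\mapsto\varepsilon(h)x_{\bar h}^*$, $p_i\mapsto-q_i^*$, $q_i\mapsto p_i^*$, and let $\sigma=S_{w_0}\tau:\mathfrak M_\zeta(\mathbf v,\mathbf w)\to\mathfrak M_\zeta(w_0*\mathbf v,\mathbf w)$, where $S_{w_0}=S_{i_1}\cdots S_{i_l}$ for any expression $w_0=s_{i_1}\cdots s_{i_l}$ and the $S_i$ are the simple reflection functors of Nakajima, Lusztig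 and Maffei. For a flag $F$ put $(F^\perp)_i=(F_{n+1-i})^\perp=\{u\in W_1:(F_{n+1-i},u)=0\}$. Then $(x,F)\mapsto(-x^*,F^\perp)$ is an isomorphism of varieties $\sigma_1:T^*\mathscr F_{\mathbf v,\mathbf w}\to T^*\mathscr F_{w_0*\mathbf v,\mathbf w}$, $\sigma$ is an isomorphism of varieties, and Nakajima's isomorphisms $\phi$ (for $\mathbf v$ and for $w_0*\mathbf v$) identify them: $\phi\circ\sigma=\sigma_1\circ\phi$. In particular, if $w_0*\mathbf v=\mathbf v$, then $\phi$ restricts to an isomorphism of varieties from the $\sigma$-quiver variety $\mathfrak S_\zeta(\mathbf v,\mathbf w)=\mathfrak M_\zeta(\mathbf v,\mathbf w)^\sigma$ onto $$T^*\mathscr F_{\mathbf v,\mathbf w}^{\sigma_1}=\{(x,F)\in\mathfrak g(W)\times\mathscr F_{\mathbf v,\mathbf w}: F^\perp=F,\ x(F_i)\subseteq F_{i+1},\ 0\le i\le n\},\qquad \mathfrak g(W)=\{x\in\mathrm{End}(W_1):x=-x^*\},$$ which, when the form on $W_1$ is symmetric or symplectic, is the cotangent bundle of the isotropic partial flag variety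 $\{F:F^\perp=F\}$ of the orthogonal or symplectic group $G(W)$ with Lie algebra $\mathfrak g(W)$. -/

import Mathlib

open scoped Topology

noncomputable section

namespace SigmaQuiver

/-! ## Complex algebraic varieties as spaces with functions

A variety is encoded by its set of (closed) points, its Zariski topology and its sheaf of
regular functions.  A function on `U` is represented by a function on the whole space,
of which only the values on `U` matter. -/

/-- The polynomial functions on a complex vector space: the algebra of functions generated by
the linear functionals. -/
def polyFun (E : Type*) [AddCommGroup E] [Module ℂ E] : Subalgebra ℂ (E → ℂ) :=
  Algebra.adjoin ℂ (Set.range fun l : Module.Dual ℂ E => (l : E → ℂ))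

/-- A topology together with, for every (open) set `U`, the functions that are regular on `U`. -/
structure SpaceWithFunctions (X : Type*) where
  zariski : TopologicalSpace X
  regular : Set X → (X → ℂ) → Prop

namespace SpaceWithFunctions

/-- The structure of a quasi-affine variety on a locally closed subset `X` of a vector space:
the Zariski topology, and the functions that are locally quotients of polynomials. -/
def ofSubset {E : Type*} [AddCommGroup E] [Module ℂ E] (X : Set E) : SpaceWithFunctions X where
  zariski := TopologicalSpace.generateFrom
    {U : Set X | ∃ P ∈ polyFun E, U = {x : X | P x ≠ 0}}
  regular U f := ∀ x ∈ U, ∃ P ∈ polyFun E, ∃ Q ∈ polyFun E, Q (x : E) ≠ 0 ∧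
    ∀ y ∈ U, Q (y : E) ≠ 0 → f y = P y / Q y

/-- The quotient structure along a (surjective) map `π : X → Y`: the quotient topology, and the
functions whose pull-back is regular.  If `π` is the orbit map of a free action of a general
linear group that is a locally trivial principal bundle, this is the geometric quotient. -/
def quotient {X Y : Type*} (A : SpaceWithFunctions X) (π : X → Y) : SpaceWithFunctions Y where
  zariski := A.zariski.coinduced π
  regular U f := A.regular (π ⁻¹' U) (f ∘ π)

/-- The structure induced on a (locally closed) subset: the subspace topology, and the functions
that are locally restrictions of regular functions. -/
def induced {Y : Type*} (A : SpaceWithFunctions Y) (Z : Set Y) : SpaceWithFunctions Z where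
  zariski := A.zariski.induced Subtype.val
  regular U f := ∀ z ∈ U, ∃ (O : Set Y) (g : Y → ℂ), IsOpen[A.zariski] O ∧ (z : Y) ∈ O ∧
    A.regular O g ∧ ∀ y ∈ U, (y : Y) ∈ O → f y = g y

end SpaceWithFunctions

/-- An isomorphism of varieties: a bijection that identifies the Zariski open sets and the
regular functions on them. -/
structure VarietyIso {X Y : Type*} (A : SpaceWithFunctions X) (B : SpaceWithFunctions Y)
    extends X ≃ Y where
  isOpen_iff : ∀ U : Set Y, IsOpen[B.zariski] U ↔ IsOpen[A.zariski] (toFun ⁻¹' U)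
  regular_iff : ∀ (U : Set Y) (f : Y → ℂ), IsOpen[B.zariski] U →
    (B.regular U f ↔ A.regular (toFun ⁻¹' U) (f ∘ toFun))

/-! ## Adjoints -/

/-- The right adjoint `T^* : E' → E` of `T : E → E'`, that is `(T e, e')_{E'} = (e, T^* e')_E`. -/
def rightAdjoint {E E' : Type*} [AddCommGroup E] [Module ℂ E] [FiniteDimensional ℂ E]
    [AddCommGroup E'] [Module ℂ E'] (B : LinearMap.BilinForm ℂ E) (hB : B.Nondegenerate)
    (B' : LinearMap.BilinForm ℂ E') (T : E →ₗ[ℂ] E') : E' →ₗ[ℂ] E :=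
  (LinearMap.BilinForm.toDual B.flip hB.flip).symm.toLinearMap ∘ₗ
    Module.Dual.transpose (R := ℂ) T ∘ₗ B'.flip

theorem rightAdjoint_spec {E E' : Type*} [AddCommGroup E] [Module ℂ E] [FiniteDimensional ℂ E]
    [AddCommGroup E'] [Module ℂ E'] (B : LinearMap.BilinForm ℂ E) (hB : B.Nondegenerate)
    (B' : LinearMap.BilinForm ℂ E') (T : E →ₗ[ℂ] E') (e : E) (e' : E') :
    B' (T e) e' = B e (rightAdjoint B hB B' T e') := by
  change _ = B.flip _ e
  simp only [rightAdjoint, LinearMap.comp_apply, LinearEquiv.coe_coe]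
  rw [LinearMap.BilinForm.apply_toDual_symm_apply]
  rfl

/-! ## Graphs and Weyl groups

The graphs are simple graphs `G` on a finite vertex set `I`; the arrow set `H` is the set of
darts of `G`, with `h ↦ h.symm` as the involution. -/

section Weyl

variable {I : Type} [Fintype I] [DecidableEq I] (G : SimpleGraph I) [DecidableRel G.Adj]

/-- The Cartan matrix of the graph. -/
def cartan (i j : I) : ℤ := (if i = j then 2 else 0) - (if G.Adj i j then 1 else 0)

/-- The simple reflection `s_i` on `R^I` (used for `R = ℤ` and `R = ℂ`). -/
def simpleRefl {R : Type} [CommRing R] (i : I) (ξ : I → R) : I → R :=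
  fun j => ξ j - (cartan G j i : R) * ξ i

/-- The action of the Weyl group element `s_{i₁} ⋯ s_{iₗ}` on `R^I`, for the word
`[i₁, …, iₗ]`. -/
def wordAct {R : Type} [CommRing R] (l : List I) (ξ : I → R) : I → R :=
  l.foldr (simpleRefl G) ξ

/-- The affine action `s_i *_w v`. -/
def starRefl (w : I → ℕ) (i : I) (v : I → ℤ) : I → ℤ :=
  Function.update v i (v i - ∑ j, cartan G i j * v j + w i)

/-- The affine action `(s_{i₁} ⋯ s_{iₗ}) *_w v`. -/
def wordStar (w : I → ℕ) (l : List I) (v : I → ℤ) : I → ℤ :=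
  l.foldr (starRefl G w) v

/-- The word `l` is an expression (not necessarily reduced) of the longest element of the (finite)
Weyl group: it takes the dominant chamber to the antidominant chamber. -/
def IsLongestWord (l : List I) : Prop :=
  ∀ ξ : I → ℤ, (∀ i, 0 < ξ i) → ∀ i, wordAct G l ξ i < 0

end Weyl

/-! ## The space `M(v, w)` -/

section Quiver

variable {I : Type}

/-- The `i`-th component of the standard graded vector space of dimension vector `v`. -/
abbrev Vec (v : I → ℕ) (i : I) : Type := Fin (v i) → ℂ

/-- The space `M(v, w)` of triples `(x, p, q)`. -/
abbrev Rep (G : SimpleGraph I) (v w : I → ℕ) : Type :=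
  (∀ h : G.Dart, Vec v h.fst →ₗ[ℂ] Vec v h.snd) ×
    (∀ i, Vec w i →ₗ[ℂ] Vec v i) × (∀ i, Vec v i →ₗ[ℂ] Vec w i)

variable {G : SimpleGraph I}

namespace Rep

variable {v v' w : I → ℕ}

/-- The component `x_h : V_i → V_j` for the arrow `h : i → j`. -/
def x (m : Rep G v w) {i j : I} (h : G.Adj i j) : Vec v i →ₗ[ℂ] Vec v j := m.1 ⟨(i, j), h⟩

/-- The component `p_i : W_i → V_i`. -/
def p (m : Rep G v w) (i : I) : Vec w i →ₗ[ℂ] Vec v i := m.2.1 i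

/-- The component `q_i : V_i → W_i`. -/
def q (m : Rep G v w) (i : I) : Vec v i →ₗ[ℂ] Vec w i := m.2.2 i

/-- `g` transforms `m` into `m'`, that is `m' = g.m`: `x'_h g = g x_h`, `p' = g p`, `q' g = q`. -/
def IsIntertwiner (m : Rep G v w) (m' : Rep G v' w) (g : ∀ i, Vec v i ≃ₗ[ℂ] Vec v' i) : Prop :=
  (∀ (i j : I) (h : G.Adj i j), m'.x h ∘ₗ (g i).toLinearMap = (g j).toLinearMap ∘ₗ m.x h) ∧
  (∀ i, m'.p i = (g i).toLinearMap ∘ₗ m.p i) ∧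
  (∀ i, m'.q i ∘ₗ (g i).toLinearMap = m.q i)

/-- `m` and `m'` are isomorphic; for `v = v'` this says that they lie in one `G_v`-orbit. -/
def Equivalent (m : Rep G v w) (m' : Rep G v' w) : Prop :=
  ∃ g : ∀ i, Vec v i ≃ₗ[ℂ] Vec v' i, IsIntertwiner m m' g

theorem Equivalent.refl (m : Rep G v w) : Equivalent m m :=
  ⟨fun _ => LinearEquiv.refl ℂ _, fun _ _ _ => rfl, fun _ => rfl, fun _ => rfl⟩

theorem Equivalent.symm {m : Rep G v w} {m' : Rep G v' w} (h : Equivalent m m') :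
    Equivalent m' m := by
  obtain ⟨g, hx, hp, hq⟩ := h
  refine ⟨fun i => (g i).symm, fun i j h => ?_, fun i => ?_, fun i => ?_⟩
  · refine LinearMap.ext fun u => (g j).injective ?_
    simpa using (LinearMap.congr_fun (hx i j h) ((g i).symm u)).symm
  · refine LinearMap.ext fun u => ?_
    simp [hp i]
  · refine LinearMap.ext fun u => ?_
    simp [← hq i]

theorem Equivalent.trans {v'' : I → ℕ} {m : Rep G v w} {m' : Rep G v' w} {m'' : Rep G v'' w}
    (h : Equivalent m m') (h' : Equivalent m' m'') : Equivalent m m'' := by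
  obtain ⟨g, hx, hp, hq⟩ := h
  obtain ⟨g', hx', hp', hq'⟩ := h'
  refine ⟨fun i => (g i).trans (g' i), fun i j h => ?_, fun i => ?_, fun i => ?_⟩
  · rw [LinearEquiv.coe_trans, LinearEquiv.coe_trans, ← LinearMap.comp_assoc, hx' i j h,
      LinearMap.comp_assoc, hx i j h, LinearMap.comp_assoc]
  · rw [LinearEquiv.coe_trans, hp' i, hp i, LinearMap.comp_assoc]
  · rw [LinearEquiv.coe_trans, ← LinearMap.comp_assoc, hq' i, hq i]

variable [Fintype I]

/-- The `i`-th component of the moment map,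
`∑_{h : j → i} ε(h) x_h x_{h̄} - p_i q_i`; here `ε i j` is the sign of the arrow `i → j`. -/
def moment [DecidableRel G.Adj] (ε : I → I → ℤ) (m : Rep G v w) (i : I) : Vec v i →ₗ[ℂ] Vec v i :=
  ∑ j : G.neighborSet i, (ε j i : ℂ) • (m.x (G.adj_symm j.2) ∘ₗ m.x j.2) - m.p i ∘ₗ m.q i

/-- `ξ`-semistability: conditions (S1) and (S2) on graded subspaces `S`, `T` of `V`. -/
def IsSemistable (ξ : I → ℤ) (m : Rep G v w) : Prop :=
  (∀ S : ∀ i, Submodule ℂ (Vec v i),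
    (∀ (i j : I) (h : G.Adj i j), (S i).map (m.x h) ≤ S j) →
    (∀ i, S i ≤ LinearMap.ker (m.q i)) →
    ∑ i, ξ i * (Module.finrank ℂ (S i) : ℤ) ≤ 0) ∧
  (∀ T : ∀ i, Submodule ℂ (Vec v i),
    (∀ (i j : I) (h : G.Adj i j), (T i).map (m.x h) ≤ T j) →
    (∀ i, LinearMap.range (m.p i) ≤ T i) →
    ∑ i, ξ i * (Module.finrank ℂ (T i) : ℤ) ≤ ∑ i, ξ i * (v i : ℤ))

end Rep

variable [Fintype I]

/-- `Λ_{ζ}^{ξ-ss}(v, w)`: the `ξ`-semistable points of the fibre of the moment map over `ζ`. -/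
def semistableLocus (G : SimpleGraph I) [DecidableRel G.Adj] (ε : I → I → ℤ)
    (ξ : I → ℤ) (ζ : I → ℂ) (v w : I → ℕ) : Set (Rep G v w) :=
  {m | (∀ i, m.moment ε i = ζ i • LinearMap.id) ∧ m.IsSemistable ξ}

/-- The partition of `Λ_{ζ}^{ξ-ss}(v, w)` into `G_v`-orbits. -/
def orbitSetoid (G : SimpleGraph I) [DecidableRel G.Adj] (ε : I → I → ℤ)
    (ξ : I → ℤ) (ζ : I → ℂ) (v w : I → ℕ) : Setoid (semistableLocus G ε ξ ζ v w) where
  r m m' := Rep.Equivalent m.1 m'.1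
  iseqv := ⟨fun _ => .refl _, fun h => h.symm, fun h h' => h.trans h'⟩

/-- The points of the quiver variety `M_{(ξ,ζ)}(v, w)`, for a generic parameter: the `G_v`-orbits
in `Λ_{ζ}^{ξ-ss}(v, w)`. -/
def QuiverPoint (G : SimpleGraph I) [DecidableRel G.Adj] (ε : I → I → ℤ)
    (ξ : I → ℤ) (ζ : I → ℂ) (v w : I → ℕ) : Type :=
  Quotient (orbitSetoid G ε ξ ζ v w)

/-- The orbit `[m]`. -/
def orbit (G : SimpleGraph I) [DecidableRel G.Adj] (ε : I → I → ℤ)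
    (ξ : I → ℤ) (ζ : I → ℂ) (v w : I → ℕ) (m : semistableLocus G ε ξ ζ v w) :
    QuiverPoint G ε ξ ζ v w :=
  Quotient.mk (orbitSetoid G ε ξ ζ v w) m

/-- The variety `M_{(ξ,ζ)}(v, w)`, for a generic parameter: the geometric quotient of
`Λ_{ζ}^{ξ-ss}(v, w)` by `G_v`. -/
def quiverVariety (G : SimpleGraph I) [DecidableRel G.Adj] (ε : I → I → ℤ)
    (ξ : I → ℤ) (ζ : I → ℂ) (v w : I → ℕ) : SpaceWithFunctions (QuiverPoint G ε ξ ζ v w) :=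
  (SpaceWithFunctions.ofSubset (semistableLocus G ε ξ ζ v w)).quotient (orbit G ε ξ ζ v w)

/-! ## Reflection functors -/

variable [DecidableEq I] [DecidableRel G.Adj]

namespace Rep

variable {v v' w : I → ℕ}

/-- `U_i = W_i ⊕ ⨁_{h : i → j} V_j`. -/
abbrev USpace (G : SimpleGraph I) (v w : I → ℕ) (i : I) : Type :=
  Vec w i × (∀ j : G.neighborSet i, Vec v j)

/-- `a_i(m) = (q_i, x_h)_{h : i → j} : V_i → U_i`. -/
def aMap (m : Rep G v w) (i : I) : Vec v i →ₗ[ℂ] USpace G v w i :=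
  (m.q i).prod (LinearMap.pi fun j => m.x j.2)

/-- `b_i(m) = (p_i, ε(h̄) x_h)_{h : j → i} : U_i → V_i`. -/
def bMap (ε : I → I → ℤ) (m : Rep G v w) (i : I) : USpace G v w i →ₗ[ℂ] Vec v i :=
  (m.p i).coprod (∑ j : G.neighborSet i, (ε i j : ℂ) • (m.x (G.adj_symm j.2) ∘ₗ LinearMap.proj j))

/-- The identification of `U_i` for `V` and for `V'` coming from identifications
`V_j ≅ V'_j`, `j ≠ i`. -/
def uEquiv (i : I) (e : ∀ j, j ≠ i → (Vec v j ≃ₗ[ℂ] Vec v' j)) :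
    USpace G v w i ≃ₗ[ℂ] USpace G v' w i :=
  LinearEquiv.prodCongr (LinearEquiv.refl ℂ _)
    (LinearEquiv.piCongrRight fun j : G.neighborSet i => e j (G.ne_of_adj j.2).symm)

/-- The pair `(m, m')` satisfies the conditions (R1)-(R4) that define the reflection functor at
`i`, for some identification of `V_j` with `V'_j` for all `j ≠ i`. -/
def IsReflectionPair (ε : I → I → ℤ) (i : I) (ζ : I → ℂ) (m : Rep G v w) (m' : Rep G v' w) :
    Prop :=
  ∃ e : ∀ j, j ≠ i → (Vec v j ≃ₗ[ℂ] Vec v' j),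
    -- exactness of `0 → V'_i → U_i → V_i → 0`
    (Function.Injective (m'.aMap i) ∧ Function.Surjective (m.bMap ε i) ∧
      ∀ u : USpace G v w i, m.bMap ε i u = 0 ↔ ∃ t, m'.aMap i t = uEquiv i e u) ∧
    -- `a_i(m) b_i(m) - a_i(m') b_i(m') = ζ'_i`, where `ζ' = s_i ζ`
    (∀ u : USpace G v w i,
      uEquiv i e (m.aMap i (m.bMap ε i u)) - m'.aMap i (m'.bMap ε i (uEquiv i e u)) =
        simpleRefl G i ζ i • uEquiv i e u) ∧
    -- `m` and `m'` agree away from `i`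
    ((∀ (j k : I) (hj : j ≠ i) (hk : k ≠ i) (h : G.Adj j k),
        (e k hk).toLinearMap ∘ₗ m.x h = m'.x h ∘ₗ (e j hj).toLinearMap) ∧
      (∀ (j : I) (hj : j ≠ i), (e j hj).toLinearMap ∘ₗ m.p j = m'.p j) ∧
      (∀ (j : I) (hj : j ≠ i), m.q j = m'.q j ∘ₗ (e j hj).toLinearMap)) ∧
    -- the moment map equations away from `i`
    (∀ j, j ≠ i → m.moment ε j = ζ j • LinearMap.id ∧
      m'.moment ε j = simpleRefl G i ζ j • LinearMap.id)

/-- `S_i [m] = [m']` for the simple reflection functor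
`S_i : M_{(ξ,ζ)}(v, w) → M_{(s_i ξ, s_i ζ)}(s_i * v, w)`. -/
def IsSimpleReflection (ε : I → I → ℤ) (ξ : I → ℤ) (ζ : I → ℂ) (i : I)
    (m : Rep G v w) (m' : Rep G v' w) : Prop :=
  (∀ j, (v' j : ℤ) = starRefl G w i (fun k => (v k : ℤ)) j) ∧
  m ∈ semistableLocus G ε ξ ζ v w ∧
  m' ∈ semistableLocus G ε (simpleRefl G i ξ) (simpleRefl G i ζ) v' w ∧
  (((ξ i < 0 ∨ ζ i ≠ 0) ∧ IsReflectionPair ε i ζ m m') ∨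
    (0 < ξ i ∧ IsReflectionPair ε i (simpleRefl G i ζ) m' m))

/-- `S_ω [m] = [m']` for the reflection functor `S_ω = S_{i₁} ∘ ⋯ ∘ S_{iₗ}` defined on
`M_{(ξ,ζ)}(v, w)` by the word `[i₁, …, iₗ]`. -/
def IsReflection (ε : I → I → ℤ) (ξ : I → ℤ) (ζ : I → ℂ) : (l : List I) → {v v' : I → ℕ} →
    (m : Rep G v w) → (m' : Rep G v' w) → Prop
  | [], v, _, m, m' => m ∈ semistableLocus G ε ξ ζ v w ∧ Equivalent m m'
  | i :: l, _, _, m, m' => ∃ (u : I → ℕ) (n : Rep G u w), IsReflection ε ξ ζ l m n ∧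
      IsSimpleReflection ε (wordAct G l ξ) (wordAct G l ζ) i n m'

/-! ## The isomorphism `τ` -/

/-- The map `τ` on `M(v, w)` attached to nondegenerate forms on the `V_i` and the `W_i`:
`x_h ↦ ε(h) x_{h̄}^*`, `p_i ↦ - q_i^*`, `q_i ↦ p_i^*`. -/
def tau (ε : I → I → ℤ)
    (BV : ∀ i, LinearMap.BilinForm ℂ (Vec v i)) (hV : ∀ i, (BV i).Nondegenerate)
    (BW : ∀ i, LinearMap.BilinForm ℂ (Vec w i)) (hW : ∀ i, (BW i).Nondegenerate)
    (m : Rep G v w) : Rep G v w :=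
  (fun h => (ε h.fst h.snd : ℂ) • rightAdjoint (BV h.snd) (hV h.snd) (BV h.fst)
      (m.x (G.adj_symm h.adj)),
    fun i => -rightAdjoint (BV i) (hV i) (BW i) (m.q i),
    fun i => rightAdjoint (BW i) (hW i) (BV i) (m.p i))

end Rep

/-! ## The `σ`-quiver varieties -/

/-- `σ(y) = y'` for the composition `σ = S_ω τ` (with trivial diagram automorphism),
where `ω` is given by the word `l`: if `y = [m]` then `y' = [m']` with
`[m'] = S_ω [τ m]`, the functor `S_ω` being taken on `M_{(-ξ,-ζ)}(v, w)`. -/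
def IsSigma {v v' w : I → ℕ} (ε : I → I → ℤ) (ξ : I → ℤ) (ζ : I → ℂ) (l : List I)
    (BV : ∀ i, LinearMap.BilinForm ℂ (Vec v i)) (hV : ∀ i, (BV i).Nondegenerate)
    (BW : ∀ i, LinearMap.BilinForm ℂ (Vec w i)) (hW : ∀ i, (BW i).Nondegenerate)
    (y : QuiverPoint G ε ξ ζ v w) (y' : QuiverPoint G ε ξ ζ v' w) : Prop :=
  ∃ m m', orbit G ε ξ ζ v w m = y ∧ orbit G ε ξ ζ v' w m' = y' ∧
    Rep.IsReflection ε (-ξ) (-ζ) l (Rep.tau ε BV hV BW hW m.1) m'.1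

/-- The points of the `σ`-quiver variety `S_{(ξ,ζ)}(v, w)`: the fixed points of `σ`. -/
def sigmaFixed {v w : I → ℕ} (ε : I → I → ℤ) (ξ : I → ℤ) (ζ : I → ℂ) (l : List I)
    (BV : ∀ i, LinearMap.BilinForm ℂ (Vec v i)) (hV : ∀ i, (BV i).Nondegenerate)
    (BW : ∀ i, LinearMap.BilinForm ℂ (Vec w i)) (hW : ∀ i, (BW i).Nondegenerate) :
    Set (QuiverPoint G ε ξ ζ v w) :=
  {y | IsSigma ε ξ ζ l BV hV BW hW y y}

end Quiver

/-! ## Type `A_n` -/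

/-- The Dynkin diagram of type `A_n`; the vertex called `i + 1` in the usual labelling by
`1, …, n` is `i : Fin n`. -/
def typeA (n : ℕ) : SimpleGraph (Fin n) where
  Adj i j := (i : ℕ) + 1 = j ∨ (j : ℕ) + 1 = i
  symm := ⟨fun _ _ h => h.symm⟩
  loopless := ⟨fun i h => by omega⟩

instance (n : ℕ) : DecidableRel (typeA n).Adj :=
  fun i j => inferInstanceAs (Decidable ((i : ℕ) + 1 = j ∨ (j : ℕ) + 1 = i))

/-- The orientation function `ε(h) = o(h) - i(h)` on arrows of type `A_n`. -/
def epsA (n : ℕ) (i j : Fin n) : ℤ := (i : ℤ) - (j : ℤ)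

/-! ## Partial flags and their cotangent bundles

`W = ℂ^d`, and `v = (v_1, …, v_n)`. -/

section Flags

variable {n d : ℕ}

/-- The `n`-step partial flags `W = F_0 ⊇ F_1 ⊇ ⋯ ⊇ F_n ⊇ F_{n+1} = 0` with `dim F_i = v_i`. -/
def partialFlags (v : Fin n → ℕ) (d : ℕ) : Set (Fin (n + 2) → Submodule ℂ (Fin d → ℂ)) :=
  {F | F 0 = ⊤ ∧ F (Fin.last (n + 1)) = ⊥ ∧ Antitone F ∧
    ∀ i : Fin n, Module.finrank ℂ (F i.succ.castSucc) = v i}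

/-- The points of the cotangent bundle: pairs `(x, F)` with `x(F_i) ⊆ F_{i+1}`, `0 ≤ i ≤ n`. -/
def cotangentFlags (v : Fin n → ℕ) (d : ℕ) :
    Set (Module.End ℂ (Fin d → ℂ) × (Fin (n + 2) → Submodule ℂ (Fin d → ℂ))) :=
  {z | z.2 ∈ partialFlags v d ∧ ∀ i : Fin (n + 1), (z.2 i.castSucc).map z.1 ≤ z.2 i.succ}

/-- The sequence `W ⊇ im f_1, …, im f_n ⊇ 0` attached to maps `f_i : ℂ^{v_i} → W`. -/
def flagOfFrames {v : Fin n → ℕ} (f : ∀ i : Fin n, (Fin (v i) → ℂ) →ₗ[ℂ] (Fin d → ℂ)) :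
    Fin (n + 2) → Submodule ℂ (Fin d → ℂ) :=
  Fin.cons ⊤ (Fin.snoc (α := fun _ => Submodule ℂ (Fin d → ℂ))
    (fun i : Fin n => LinearMap.range (f i)) ⊥)

/-- The framed version of the cotangent bundle: `x` together with a basis of every `F_i`, given
as an injective map `f_i : ℂ^{v_i} → W` with image `F_i`. -/
def cotangentFrames (v : Fin n → ℕ) (d : ℕ) :
    Set (Module.End ℂ (Fin d → ℂ) × (∀ i : Fin n, (Fin (v i) → ℂ) →ₗ[ℂ] (Fin d → ℂ))) :=
  {z | (∀ i, Function.Injective (z.2 i)) ∧ (z.1, flagOfFrames z.2) ∈ cotangentFlags v d}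

/-- Forgetting the bases. -/
def forgetFrames (v : Fin n → ℕ) (d : ℕ) (z : cotangentFrames v d) : cotangentFlags v d :=
  ⟨(z.1.1, flagOfFrames z.1.2), z.2.2⟩

/-- The cotangent bundle `T^*F_{v,w}` as a variety.  Its structure is the one induced from
`End W × ∏ Gr(v_i, W)`, where a Grassmannian is the quotient of the space of injective maps
`ℂ^{v_i} → W` by `GL(v_i)`. -/
def cotangentVariety (v : Fin n → ℕ) (d : ℕ) : SpaceWithFunctions (cotangentFlags v d) :=
  (SpaceWithFunctions.ofSubset (cotangentFrames v d)).quotient (forgetFrames v d)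

/-- `F^⊥ = (F_{n+1}^⊥ ⊇ F_n^⊥ ⊇ ⋯ ⊇ F_0^⊥)`. -/
def perpFlag (B : LinearMap.BilinForm ℂ (Fin d → ℂ))
    (F : Fin (n + 2) → Submodule ℂ (Fin d → ℂ)) : Fin (n + 2) → Submodule ℂ (Fin d → ℂ) :=
  fun i => B.orthogonal (F i.rev)

/-- The Lie algebra `𝔤(W) = {x | x = - x^*}` of the group `G(W)` of isometries of the form. -/
def lieAlgebraOfForm (B : LinearMap.BilinForm ℂ (Fin d → ℂ)) (hB : B.Nondegenerate) :
    Set (Module.End ℂ (Fin d → ℂ)) :=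
  {x | x = -rightAdjoint B hB B x}

/-- The cotangent bundle of the variety of flags with `F = F^⊥` (the isotropic flags): the pairs
`(x, F)` with `x ∈ 𝔤(W)`, `F = F^⊥` and `x(F_i) ⊆ F_{i+1}`. -/
def isotropicCotangent (v : Fin n → ℕ) (B : LinearMap.BilinForm ℂ (Fin d → ℂ))
    (hB : B.Nondegenerate) : Set (cotangentFlags v d) :=
  {z | z.1.1 ∈ lieAlgebraOfForm B hB ∧ z.1.2 = perpFlag B z.1.2}

end Flags

/-! ## Nakajima's map -/

/-- The map `q_1 y_1 ⋯ y_k : V_{k+1} → W_1`, where `y_i : V_{i+1} → V_i`. -/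
def frameMap {n : ℕ} {v w : Fin n → ℕ} (hn : 0 < n) (m : Rep (typeA n) v w) :
    (k : ℕ) → (hk : k < n) → (Vec v ⟨k, hk⟩ →ₗ[ℂ] Vec w ⟨0, hn⟩)
  | 0, _ => m.q ⟨0, hn⟩
  | k + 1, hk => frameMap hn m k (Nat.lt_of_succ_lt hk) ∘ₗ
      m.x (i := ⟨k + 1, hk⟩) (j := ⟨k, Nat.lt_of_succ_lt hk⟩) (Or.inr rfl)

/-- `m ↦ (q_1 p_1, W_1 ⊇ im q_1 ⊇ im q_1 y_1 ⊇ ⋯ ⊇ im q_1 y_1 ⋯ y_{n-1} ⊇ 0)`. -/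
def nakajimaPair {n : ℕ} {v w : Fin n → ℕ} (hn : 0 < n) (m : Rep (typeA n) v w) :
    Module.End ℂ (Vec w ⟨0, hn⟩) × (Fin (n + 2) → Submodule ℂ (Vec w ⟨0, hn⟩)) :=
  (m.q ⟨0, hn⟩ ∘ₗ m.p ⟨0, hn⟩, flagOfFrames fun i : Fin n => frameMap hn m i i.2)

end SigmaQuiver

end

open SigmaQuiver

/-! Nakajima's map is inverted explicitly. Because `w` lives at the first vertex, the moment map
equations say that the composites f_k = q_1 y_1 ⋯ y_k (`frameMap`) carry the forward maps of the
representation to x = q_1 p_1, and that x kills the image of the last one. The kernels of the f_k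
therefore form an invariant subspace inside ker q, and semistability for positive `ξ` makes every
f_k injective (`frameMap_injective`). So a point is a flag in W_1 whose steps are the V_i, with
inclusions as backward maps and restrictions of x as forward maps; conversely every pair (x, F)
arises in this way (`repOfFrames_mem`). Regularity in both directions follows from
`isMorphism_quotient`, since a frame has locally a left inverse depending rationally on it. The same
criterion handles σ₁, by a rational frame of the orthogonal space (`exists_perpFrame`).

The core is the comparison of σ with σ₁. A representation is a chain W_1 – V_1 – ⋯ – V_n – 0 with
links at positions 0, …, n, each carrying a forward and a backward map. Choosing on every link
either the graph of the forward map or the inverse graph of the backward map, and composing, gives a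
linear relation from W_1 to 0; its domain is `chainSet`. The exact sequence 0 → V'_i → U_i → V_i → 0
and the equation a b = a' b' say that a reflection at i interchanges the choices on the two links
meeting at V_i, unless these are "backward, then forward" on the V_i side (`stepRel_exchange`).
Write η_i = a_i - a_{i+1}, so that the Weyl group permutes the a_j, and go forward at j exactly when
a_j < c. The sign of η_i then rules out the excluded order, so these subspaces of W_1 survive all
reflections, with the positions permuted (`isReflection_invariants`).

For η = -ξ the sequence a increases, so the forward links form an initial segment, and the subspace
is the kernel of a path out of W_1. For τ m that path is up to sign the adjoint of a frame map of m,
and its kernel is the orthogonal of a step of the flag. The longest element reverses the positions;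
forward links now form a final segment, and the subspace is the image of a frame map, a step of the
new flag. Reflections preserve q_1 p_1, and τ turns it into -x^*. This gives
`nakajimaPair_of_isReflection_tau`.

Finally σ is constructed as φ'⁻¹ σ₁ φ. Identifying it with S_{w_0} τ also needs the existence of
reflections of semistable points, obtained by replacing V_i with ker b_i or coker a_i
(`exists_isReflection`). -/

open SigmaQuiver

set_option linter.unusedSectionVars false

noncomputable section

namespace SigmaQuiver

/-! ## Rational functions -/

section Regular

variable {E E' E₁ E₂ E₃ : Type*} [AddCommGroup E] [Module ℂ E] [AddCommGroup E'] [Module ℂ E']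
  [AddCommGroup E₁] [Module ℂ E₁] [AddCommGroup E₂] [Module ℂ E₂] [AddCommGroup E₃] [Module ℂ E₃]

/-- The functions on `E` that are quotients of polynomials near the point `x`. -/
def locReg (x : E) : Subalgebra ℂ (E → ℂ) where
  carrier := {f | ∃ P ∈ polyFun E, ∃ Q ∈ polyFun E, Q x ≠ 0 ∧ ∀ y, Q y ≠ 0 → f y = P y / Q y}
  mul_mem' := by
    rintro f g ⟨P, hP, Q, hQ, hx, h⟩ ⟨P', hP', Q', hQ', hx', h'⟩
    refine ⟨P * P', mul_mem hP hP', Q * Q', mul_mem hQ hQ', mul_ne_zero hx hx', fun y hy => ?_⟩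
    have := mul_ne_zero_iff.1 hy
    simp only [Pi.mul_apply, h y this.1, h' y this.2]
    rw [div_mul_div_comm]
  add_mem' := by
    rintro f g ⟨P, hP, Q, hQ, hx, h⟩ ⟨P', hP', Q', hQ', hx', h'⟩
    refine ⟨P * Q' + Q * P', add_mem (mul_mem hP hQ') (mul_mem hQ hP'), Q * Q', mul_mem hQ hQ',
      mul_ne_zero hx hx', fun y hy => ?_⟩
    have := mul_ne_zero_iff.1 hy
    simp only [Pi.mul_apply, Pi.add_apply, h y this.1, h' y this.2]
    rw [div_add_div _ _ this.1 this.2]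
  algebraMap_mem' c := ⟨algebraMap _ _ c, Subalgebra.algebraMap_mem _ c, 1, one_mem _, one_ne_zero,
    fun y _ => by simp⟩

theorem polyFun_le_locReg (x : E) : polyFun E ≤ locReg x := fun P hP =>
  ⟨P, hP, 1, one_mem _, one_ne_zero, fun y _ => by simp⟩

theorem inv_mem_locReg {x : E} {f : E → ℂ} (hf : f ∈ locReg x) (hx : f x ≠ 0) :
    f⁻¹ ∈ locReg x := by
  obtain ⟨P, hP, Q, hQ, hQx, h⟩ := hf
  have hPx : P x ≠ 0 := fun h0 => hx (by rw [h x hQx, h0, zero_div])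
  -- The factor `Q` is not cancelled: the formula `P / Q` for `f` is known only where `Q` does not
  -- vanish.
  refine ⟨Q * Q, mul_mem hQ hQ, P * Q, mul_mem hP hQ, mul_ne_zero hPx hQx, fun y hy => ?_⟩
  have := mul_ne_zero_iff.1 hy
  simp only [Pi.inv_apply, Pi.mul_apply, h y this.2, inv_div]
  rw [mul_div_mul_right _ _ this.2]

/-- The map `s` is given by rational functions near the point `x`. -/
def RegAt (x : E) (s : E → E') : Prop := ∀ l : Module.Dual ℂ E', (fun y => l (s y)) ∈ locReg x

theorem RegAt.linear {x : E} {s : E → E'} (hs : RegAt x s) (L : E' →ₗ[ℂ] E₁) :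
    RegAt x fun y => L (s y) := fun l => hs (l ∘ₗ L)

theorem RegAt.id (x : E) : RegAt x fun y => y := fun l =>
  polyFun_le_locReg x (Algebra.subset_adjoin ⟨l, rfl⟩)

theorem RegAt.const (x : E) (c : E') : RegAt x fun _ => c := fun l =>
  Subalgebra.algebraMap_mem (locReg x) (l c)

theorem regAt_linearMap (x : E) (L : E →ₗ[ℂ] E') : RegAt x L := (RegAt.id x).linear L

theorem RegAt.poly {x : E} {s : E → E'} (hs : RegAt x s) {P : E' → ℂ} (hP : P ∈ polyFun E') :
    (fun y => P (s y)) ∈ locReg x := by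
  induction hP using Algebra.adjoin_induction with
  | mem f hf => obtain ⟨l, rfl⟩ := hf; exact hs l
  | algebraMap c => exact Subalgebra.algebraMap_mem (locReg x) c
  | add f g _ _ hf hg => exact add_mem hf hg
  | mul f g _ _ hf hg => exact mul_mem hf hg

theorem RegAt.add {x : E} {s t : E → E'} (hs : RegAt x s) (ht : RegAt x t) :
    RegAt x fun y => s y + t y := fun l => by
  simp only [map_add]
  exact add_mem (hs l) (ht l)

theorem RegAt.neg {x : E} {s : E → E'} (hs : RegAt x s) : RegAt x fun y => -s y := fun l => by
  simp only [map_neg]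
  exact neg_mem (hs l)

theorem RegAt.sub {x : E} {s t : E → E'} (hs : RegAt x s) (ht : RegAt x t) :
    RegAt x fun y => s y - t y := fun l => by
  simp only [map_sub]
  exact sub_mem (hs l) (ht l)

theorem RegAt.prodMk {x : E} {s : E → E₁} {t : E → E₂} (hs : RegAt x s) (ht : RegAt x t) :
    RegAt x fun y => (s y, t y) := by
  have := (hs.linear (LinearMap.inl ℂ E₁ E₂)).add (ht.linear (LinearMap.inr ℂ E₁ E₂))
  simpa using this

theorem RegAt.pi {ι : Type*} [Finite ι] {F : ι → Type*} [∀ i, AddCommGroup (F i)]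
    [∀ i, Module ℂ (F i)] {x : E} {s : ∀ i, E → F i} (hs : ∀ i, RegAt x (s i)) :
    RegAt x fun y i => s i y := fun l => by
  classical
  cases nonempty_fintype ι
  have : (fun y => l fun i => s i y) = ∑ i, fun y => (l ∘ₗ LinearMap.single ℂ F i) (s i y) := by
    funext y
    rw [Finset.sum_apply]
    simp only [LinearMap.comp_apply]
    rw [← map_sum]
    exact congrArg l (LinearMap.sum_single_apply F _).symm
  rw [this]
  exact sum_mem fun i _ => hs i _

/-- A basis of the first factor turns a bilinear expression into a finite sum of products of regular
functions. -/
theorem RegAt.bilin [FiniteDimensional ℂ E₁] {x : E} {s : E → E₁} {t : E → E₂}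
    (hs : RegAt x s) (ht : RegAt x t) (β : E₁ →ₗ[ℂ] E₂ →ₗ[ℂ] E₃) :
    RegAt x fun y => β (s y) (t y) := fun l => by
  let b := Module.finBasis ℂ E₁
  have : (fun y => l (β (s y) (t y))) =
      ∑ i, (fun y => b.coord i (s y)) * fun y => (l ∘ₗ β (b i)) (t y) := by
    funext y
    rw [Finset.sum_apply]
    have h : l (β (s y) (t y)) = ((β.compr₂ l).flip (t y)) (s y) := rfl
    rw [h]
    conv_lhs => rw [← b.sum_repr (s y), map_sum]
    simp
  rw [this]
  exact sum_mem fun i _ => mul_mem (hs _) (ht _)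

theorem RegAt.comp [FiniteDimensional ℂ E₂] [FiniteDimensional ℂ E₃] {x : E}
    {s : E → E₂ →ₗ[ℂ] E₃} {t : E → E₁ →ₗ[ℂ] E₂}
    (hs : RegAt x s) (ht : RegAt x t) : RegAt x fun y => s y ∘ₗ t y :=
  hs.bilin ht (LinearMap.llcomp ℂ E₁ E₂ E₃)

theorem RegAt.smul {x : E} {c : E → ℂ} {s : E → E'} (hc : c ∈ locReg x) (hs : RegAt x s) :
    RegAt x fun y => c y • s y := fun l => by
  have : (fun y => l (c y • s y)) = c * fun y => l (s y) := by funext y; simp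
  rw [this]
  exact mul_mem hc (hs l)

theorem det_mem_subalgebra {X ι : Type*} [Fintype ι] [DecidableEq ι] (A : Subalgebra ℂ (X → ℂ))
    {M : X → Matrix ι ι ℂ} (hM : ∀ i j, (fun y => M y i j) ∈ A) : (fun y => (M y).det) ∈ A := by
  have : (fun y => (M y).det) =
      ∑ σ : Equiv.Perm ι, ((Equiv.Perm.sign σ : ℤ) : X → ℂ) * ∏ i, fun y => M y (σ i) i := by
    funext y
    simp [Matrix.det_apply', Finset.sum_apply, Finset.prod_apply]
  rw [this]
  exact sum_mem fun σ _ => mul_mem (intCast_mem _ _) (prod_mem fun i _ => hM _ _)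

theorem adjugate_mem_subalgebra {X ι : Type*} [Fintype ι] [DecidableEq ι]
    (A : Subalgebra ℂ (X → ℂ)) {M : X → Matrix ι ι ℂ} (hM : ∀ i j, (fun y => M y i j) ∈ A)
    (i j : ι) : (fun y => (M y).adjugate i j) ∈ A := by
  simp only [Matrix.adjugate_apply]
  refine det_mem_subalgebra A fun k l => ?_
  by_cases hk : k = j
  · subst hk
    simp only [Matrix.updateRow_self]
    exact Subalgebra.algebraMap_mem A _
  · simp only [Matrix.updateRow_ne hk]
    exact hM k l

/-- The inverse of an endomorphism of `ℂ^k`, where it exists. -/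
def endInv {k : ℕ} (A : (Fin k → ℂ) →ₗ[ℂ] (Fin k → ℂ)) : (Fin k → ℂ) →ₗ[ℂ] (Fin k → ℂ) :=
  Matrix.toLin' ((LinearMap.toMatrix' A)⁻¹)

theorem endInv_comp {k : ℕ} {A : (Fin k → ℂ) →ₗ[ℂ] (Fin k → ℂ)} (hA : LinearMap.det A ≠ 0) :
    endInv A ∘ₗ A = LinearMap.id := by
  have h : endInv A ∘ₗ Matrix.toLin' (LinearMap.toMatrix' A) = LinearMap.id := by
    rw [endInv, ← Matrix.toLin'_mul, Matrix.nonsing_inv_mul, Matrix.toLin'_one]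
    rw [LinearMap.det_toMatrix']
    exact hA.isUnit
  rwa [Matrix.toLin'_toMatrix'] at h

theorem comp_endInv {k : ℕ} {A : (Fin k → ℂ) →ₗ[ℂ] (Fin k → ℂ)} (hA : LinearMap.det A ≠ 0) :
    A ∘ₗ endInv A = LinearMap.id := by
  have h : Matrix.toLin' (LinearMap.toMatrix' A) ∘ₗ endInv A = LinearMap.id := by
    rw [endInv, ← Matrix.toLin'_mul, Matrix.mul_nonsing_inv, Matrix.toLin'_one]
    rw [LinearMap.det_toMatrix']
    exact hA.isUnit
  rwa [Matrix.toLin'_toMatrix'] at h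

/-- Cramer's rule: the adjugate is polynomial in the entries, and the determinant by which it is
divided does not vanish at `x`. -/
theorem RegAt.endInv {k : ℕ} {x : E} {A : E → (Fin k → ℂ) →ₗ[ℂ] (Fin k → ℂ)} (hA : RegAt x A)
    (hx : LinearMap.det (A x) ≠ 0) : RegAt x fun y => endInv (A y) := by
  have hM : ∀ i j, (fun y => LinearMap.toMatrix' (A y) i j) ∈ locReg x := fun i j =>
    hA (LinearMap.proj j ∘ₗ LinearMap.proj i ∘ₗ
      (LinearMap.toMatrix' : _ ≃ₗ[ℂ] Matrix (Fin k) (Fin k) ℂ).toLinearMap)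
  have hdet := det_mem_subalgebra _ hM
  have hreg : RegAt x fun y => (LinearMap.toMatrix' (A y)).det⁻¹ •
      (fun i j => (LinearMap.toMatrix' (A y)).adjugate i j : Fin k → Fin k → ℂ) := by
    refine RegAt.smul (inv_mem_locReg hdet ?_) (RegAt.pi fun i => RegAt.pi fun j => ?_)
    · simpa using hx
    · intro l
      have : (fun y => l ((LinearMap.toMatrix' (A y)).adjugate i j)) =
          (fun y => (LinearMap.toMatrix' (A y)).adjugate i j) * algebraMap ℂ _ (l 1) := by
        funext y
        rw [← mul_one ((LinearMap.toMatrix' (A y)).adjugate i j), ← smul_eq_mul, map_smul]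
        simp
      rw [this]
      exact mul_mem (adjugate_mem_subalgebra _ hM i j) (Subalgebra.algebraMap_mem _ _)
  have h2 := hreg.linear (Matrix.toLin' : Matrix (Fin k) (Fin k) ℂ ≃ₗ[ℂ] _).toLinearMap
  refine (iff_of_eq (congrArg (RegAt x) ?_)).1 h2
  funext y
  simp only [SigmaQuiver.endInv, Matrix.inv_def, Ring.inverse_eq_inv']
  rfl

/-- Supplies the polynomials whose nonvanishing cuts out the neighbourhoods on which local lifts are
defined. -/
theorem det_comp_mem_polyFun {k : ℕ} (L : E →ₗ[ℂ] (Fin k → ℂ) →ₗ[ℂ] (Fin k → ℂ)) :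
    (fun y => LinearMap.det (L y)) ∈ polyFun E := by
  have : (fun y => LinearMap.det (L y)) = fun y => (LinearMap.toMatrix' (L y)).det := by
    funext y; rw [LinearMap.det_toMatrix']
  rw [this]
  refine det_mem_subalgebra _ fun i j => Algebra.subset_adjoin ⟨LinearMap.proj j ∘ₗ
    LinearMap.proj i ∘ₗ (LinearMap.toMatrix' : _ ≃ₗ[ℂ] Matrix (Fin k) (Fin k) ℂ).toLinearMap ∘ₗ L,
    rfl⟩

end Regular

/-! ## Morphisms -/

/-- A continuous map that pulls back regular functions to regular functions. -/
structure IsMorphism {X Y : Type*} (A : SpaceWithFunctions X) (B : SpaceWithFunctions Y)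
    (g : X → Y) : Prop where
  isOpen_preimage : ∀ U : Set Y, IsOpen[B.zariski] U → IsOpen[A.zariski] (g ⁻¹' U)
  regular_comp : ∀ (U : Set Y) (f : Y → ℂ), IsOpen[B.zariski] U → B.regular U f →
    A.regular (g ⁻¹' U) (f ∘ g)

section Morphism

variable {X Y Z : Type*} {A : SpaceWithFunctions X} {B : SpaceWithFunctions Y}
  {C : SpaceWithFunctions Z}

/-- A bijection that is a morphism in both directions. -/
def VarietyIso.ofMorphisms (e : X ≃ Y) (h : IsMorphism A B e) (h' : IsMorphism B A e.symm) :
    VarietyIso A B where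
  toEquiv := e
  isOpen_iff U := by
    refine ⟨h.isOpen_preimage U, fun hU => ?_⟩
    have := h'.isOpen_preimage _ hU
    rwa [← Set.preimage_comp, show (e.toFun ∘ e.symm : Y → Y) = id by ext; simp,
      Set.preimage_id] at this
  regular_iff U f hU := by
    refine ⟨h.regular_comp U f hU, fun hf => ?_⟩
    have := h'.regular_comp _ _ (h.isOpen_preimage U hU) hf
    rwa [← Set.preimage_comp, Function.comp_assoc, show (e.toFun ∘ e.symm : Y → Y) = id by ext; simp,
      show (e ∘ e.symm : Y → Y) = id by ext; simp, Set.preimage_id, Function.comp_id] at this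

theorem VarietyIso.isMorphism (φ : VarietyIso A B) : IsMorphism A B φ.toEquiv :=
  ⟨fun U => (φ.isOpen_iff U).1, fun U f hU => (φ.regular_iff U f hU).1⟩

theorem VarietyIso.isMorphism_symm (φ : VarietyIso A B) : IsMorphism B A φ.toEquiv.symm := by
  have h : (φ.toFun ∘ φ.toEquiv.symm : Y → Y) = id := funext φ.toEquiv.apply_symm_apply
  have h' : (φ.toEquiv.symm ∘ φ.toFun : X → X) = id := funext φ.toEquiv.symm_apply_apply
  have ho : ∀ U : Set X, IsOpen[A.zariski] U → IsOpen[B.zariski] (φ.toEquiv.symm ⁻¹' U) := by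
    intro U hU
    rw [φ.isOpen_iff, ← Set.preimage_comp, h']
    exact hU
  refine ⟨ho, fun U f hU hf => ?_⟩
  rw [φ.regular_iff _ _ (ho U hU), ← Set.preimage_comp, Function.comp_assoc, h']
  exact hf

theorem IsMorphism.comp {g : X → Y} {g' : Y → Z} (h' : IsMorphism B C g') (h : IsMorphism A B g) :
    IsMorphism A C (g' ∘ g) :=
  ⟨fun U hU => h.isOpen_preimage _ (h'.isOpen_preimage U hU), fun U f hU hf =>
    h.regular_comp _ _ (h'.isOpen_preimage U hU) (h'.regular_comp U f hU hf)⟩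

theorem IsMorphism.induced {g : X → Y} (h : IsMorphism A B g) {S : Set X} {T : Set Y}
    (hg : ∀ x ∈ S, g x ∈ T) :
    IsMorphism (A.induced S) (B.induced T) fun x : S => ⟨g x, hg x x.2⟩ := by
  constructor
  · intro U hU
    obtain ⟨O, hO, rfl⟩ := hU
    exact ⟨g ⁻¹' O, h.isOpen_preimage O hO, rfl⟩
  · intro U f _ hf z hz
    obtain ⟨O, k, hO, hzO, hk, hfk⟩ := hf _ hz
    exact ⟨g ⁻¹' O, k ∘ g, h.isOpen_preimage O hO, hzO, h.regular_comp O k hO hk,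
      fun y hy hyO => hfk _ hy hyO⟩

/-- The composition of isomorphisms. -/
def VarietyIso.trans (φ : VarietyIso A B) (ψ : VarietyIso B C) : VarietyIso A C :=
  .ofMorphisms (φ.toEquiv.trans ψ.toEquiv) (ψ.isMorphism.comp φ.isMorphism)
    (φ.isMorphism_symm.comp ψ.isMorphism_symm)

/-- The inverse isomorphism. -/
def VarietyIso.symm (φ : VarietyIso A B) : VarietyIso B A :=
  .ofMorphisms φ.toEquiv.symm φ.isMorphism_symm φ.isMorphism

/-- The restriction of an isomorphism to corresponding subsets. -/
def VarietyIso.restrict (φ : VarietyIso A B) (S : Set X) (T : Set Y)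
    (h : ∀ x, x ∈ S ↔ φ.toEquiv x ∈ T) : VarietyIso (A.induced S) (B.induced T) :=
  .ofMorphisms (φ.toEquiv.subtypeEquiv h) (φ.isMorphism.induced fun x => (h x).1)
    (φ.isMorphism_symm.induced fun y hy => by
      rw [h, Equiv.apply_symm_apply]
      exact hy)

end Morphism

/-! ### Morphisms between quotients, via local rational lifts -/

section Quotient

variable {E E' : Type*} [AddCommGroup E] [Module ℂ E] [AddCommGroup E'] [Module ℂ E']

/-- A product of polynomials is nonzero exactly where all factors are, so the generating sets are in
fact a basis. -/
theorem exists_polyFun_of_isOpen {X : Set E} {U : Set X}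
    (hU : IsOpen[(SpaceWithFunctions.ofSubset X).zariski] U) {x : X} (hx : x ∈ U) :
    ∃ P ∈ polyFun E, P x ≠ 0 ∧ ∀ y : X, P y ≠ 0 → y ∈ U := by
  change TopologicalSpace.GenerateOpen _ U at hU
  induction hU with
  | basic s hs =>
    obtain ⟨P, hP, rfl⟩ := hs
    exact ⟨P, hP, hx, fun _ h => h⟩
  | univ => exact ⟨1, one_mem _, one_ne_zero, fun _ _ => trivial⟩
  | inter s t _ _ hs ht =>
    obtain ⟨P, hP, hPx, h⟩ := hs hx.1
    obtain ⟨P', hP', hPx', h'⟩ := ht hx.2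
    exact ⟨P * P', mul_mem hP hP', mul_ne_zero hPx hPx',
      fun y hy => ⟨h y (left_ne_zero_of_mul hy), h' y (right_ne_zero_of_mul hy)⟩⟩
  | sUnion S _ hS =>
    obtain ⟨s, hs, hxs⟩ := hx
    obtain ⟨P, hP, hPx, h⟩ := hS s hs hxs
    exact ⟨P, hP, hPx, fun y hy => ⟨s, hs, h y hy⟩⟩

theorem isOpen_of_exists_polyFun {X : Set E} {U : Set X}
    (h : ∀ x ∈ U, ∃ P ∈ polyFun E, P (x : E) ≠ 0 ∧ ∀ y : X, P y ≠ 0 → y ∈ U) :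
    IsOpen[(SpaceWithFunctions.ofSubset X).zariski] U := by
  let _ := (SpaceWithFunctions.ofSubset X).zariski
  refine isOpen_iff_forall_mem_open.2 fun x hx => ?_
  obtain ⟨P, hP, hPx, h⟩ := h x hx
  exact ⟨{y | P y ≠ 0}, fun y hy => h y hy,
    TopologicalSpace.isOpen_generateFrom_of_mem ⟨P, hP, rfl⟩, hPx⟩

/-- A map between quotients is a morphism if it can be lifted locally by rational maps. -/
theorem isMorphism_quotient {X : Set E} {X' : Set E'} {Y Y' : Type*} {π : X → Y} {π' : X' → Y'}
    {g : Y → Y'}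
    (H : ∀ x : X, ∃ Q ∈ polyFun E, Q x ≠ 0 ∧ ∃ s : E → E', RegAt (x : E) s ∧
      ∀ y : X, Q y ≠ 0 → ∃ hs : s y ∈ X', π' ⟨s y, hs⟩ = g (π y)) :
    IsMorphism ((SpaceWithFunctions.ofSubset X).quotient π)
      ((SpaceWithFunctions.ofSubset X').quotient π') g := by
  constructor
  · intro U hU
    have hU' : IsOpen[(SpaceWithFunctions.ofSubset X').zariski] (π' ⁻¹' U) := hU
    change IsOpen[(SpaceWithFunctions.ofSubset X).zariski] (π ⁻¹' (g ⁻¹' U))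
    refine isOpen_of_exists_polyFun fun x hx => ?_
    obtain ⟨Q, hQ, hQx, s, hs, hsX⟩ := H x
    obtain ⟨hsx, hπ⟩ := hsX x hQx
    obtain ⟨P, hP, hPx, hPU⟩ := exists_polyFun_of_isOpen hU' (x := ⟨s x, hsx⟩)
      (by change π' _ ∈ U; rw [hπ]; exact hx)
    obtain ⟨N, hN, M, hM, hMx, h⟩ := hs.poly hP
    -- `N / M` expresses `P ∘ s`. The three factors ensure in turn that the lift exists, that `P ∘
    -- s` is nonzero, and that this expression is valid.
    refine ⟨Q * (N * M), mul_mem hQ (mul_mem hN hM),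
      mul_ne_zero hQx (mul_ne_zero (fun h0 => hPx ?_) hMx), fun y hy => ?_⟩
    · have := h x hMx
      rwa [h0, zero_div] at this
    · obtain ⟨hy1, hy2⟩ := mul_ne_zero_iff.1 hy
      obtain ⟨hy2, hy3⟩ := mul_ne_zero_iff.1 hy2
      obtain ⟨hsy, hπy⟩ := hsX y hy1
      change g (π y) ∈ U
      rw [← hπy]
      exact hPU ⟨s y, hsy⟩ ((h y hy3).trans_ne (div_ne_zero hy2 hy3))
  · intro U f _ hf x hx
    obtain ⟨Q, hQ, hQx, s, hs, hsX⟩ := H x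
    obtain ⟨hsx, hπ⟩ := hsX x hQx
    obtain ⟨P₁, hP₁, Q₁, hQ₁, hQ₁x, hPQ⟩ := hf ⟨s x, hsx⟩
      (by change π' _ ∈ U; rw [hπ]; exact hx)
    obtain ⟨N, hN, M, hM, hMx, h⟩ := hs.poly hQ₁
    have hNx : N x ≠ 0 := by
      intro h0
      have := h x hMx
      rw [h0, zero_div] at this
      exact hQ₁x this
    obtain ⟨P, hP, R, hR, hRx, hPR⟩ := mul_mem (hs.poly hP₁) (inv_mem_locReg (hs.poly hQ₁) hQ₁x)
    -- The common factor `Q * (N * M)` does not alter the quotient; it shrinks the neighbourhood to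
    -- points where the lift exists and `Q₁ ∘ s` is nonzero.
    refine ⟨P * (Q * (N * M)), mul_mem hP (mul_mem hQ (mul_mem hN hM)),
      R * (Q * (N * M)), mul_mem hR (mul_mem hQ (mul_mem hN hM)),
      mul_ne_zero hRx (mul_ne_zero hQx (mul_ne_zero hNx hMx)), fun y hy hy0 => ?_⟩
    obtain ⟨hy1, hy2⟩ := mul_ne_zero_iff.1 hy0
    obtain ⟨hy3, hy4⟩ := mul_ne_zero_iff.1 hy2
    obtain ⟨hy5, hy6⟩ := mul_ne_zero_iff.1 hy4
    obtain ⟨hsy, hπy⟩ := hsX y hy3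
    have hQ₁y : Q₁ (s y) ≠ 0 := (h y hy6).trans_ne (div_ne_zero hy5 hy6)
    have h1 := hPQ ⟨s y, hsy⟩ (by change π' _ ∈ U; rw [hπy]; exact hy) hQ₁y
    have h2 := hPR y hy1
    simp only [Pi.mul_apply, Pi.inv_apply] at h2
    change f (g (π y)) = P y * (Q * (N * M)) y / (R y * (Q * (N * M)) y)
    rw [mul_div_mul_right _ _ hy2, ← h2, ← div_eq_mul_inv, ← hπy]
    exact h1

end Quotient

/-! ## Type `A_n`: sums over neighbours -/

section Neighbours

variable {n : ℕ} {M : Type*} [AddCommMonoid M]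

theorem adj_succ {k : ℕ} (hk : k + 1 < n) :
    (typeA n).Adj ⟨k, Nat.lt_of_succ_lt hk⟩ ⟨k + 1, hk⟩ := Or.inl rfl

theorem adj_pred {k : ℕ} (hk : k + 1 < n) :
    (typeA n).Adj ⟨k + 1, hk⟩ ⟨k, Nat.lt_of_succ_lt hk⟩ := Or.inr rfl

theorem sum_neighborSet_zero (hn : 0 < n) (f : ∀ j, (typeA n).Adj ⟨0, hn⟩ j → M) :
    ∑ j : (typeA n).neighborSet ⟨0, hn⟩, f j j.2 =
      if h : 0 + 1 < n then f ⟨0 + 1, h⟩ (adj_succ h) else 0 := by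
  by_cases h : 0 + 1 < n
  · rw [dif_pos h]
    refine Fintype.sum_eq_single (⟨⟨0 + 1, h⟩, adj_succ h⟩ : (typeA n).neighborSet ⟨0, hn⟩) ?_
    rintro ⟨j, hj⟩ hne
    refine absurd (Subtype.ext (Fin.ext ?_)) hne
    rcases hj with hj | hj
    · exact hj.symm
    · exact absurd hj (Nat.succ_ne_zero _)
  · rw [dif_neg h]
    refine Finset.sum_eq_zero ?_
    rintro ⟨j, hj⟩ -
    have := j.2
    exfalso
    rcases hj with hj | hj
    · simp only at hj; omega
    · exact Nat.succ_ne_zero _ hj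

theorem sum_neighborSet_succ {k : ℕ} (hk : k + 1 < n)
    (f : ∀ j, (typeA n).Adj ⟨k + 1, hk⟩ j → M) :
    ∑ j : (typeA n).neighborSet ⟨k + 1, hk⟩, f j j.2 = f ⟨k, Nat.lt_of_succ_lt hk⟩ (adj_pred hk) +
      if h : k + 1 + 1 < n then f ⟨k + 1 + 1, h⟩ (adj_succ h) else 0 := by
  by_cases h : k + 1 + 1 < n
  · rw [dif_pos h]
    refine Fintype.sum_eq_add (⟨⟨k, Nat.lt_of_succ_lt hk⟩, adj_pred hk⟩ :
      (typeA n).neighborSet ⟨k + 1, hk⟩) ⟨⟨k + 1 + 1, h⟩, adj_succ h⟩ ?_ ?_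
    · intro h0
      have := congrArg (fun x => (x.1 : ℕ)) h0
      simp only at this
      omega
    · rintro ⟨j, hj⟩ ⟨hne, hne'⟩
      exfalso
      rcases hj with hj | hj
      · exact hne' (Subtype.ext (Fin.ext hj.symm))
      · exact hne (Subtype.ext (Fin.ext (Nat.succ_injective hj)))
  · rw [dif_neg h, add_zero]
    refine Fintype.sum_eq_single (⟨⟨k, Nat.lt_of_succ_lt hk⟩, adj_pred hk⟩ :
      (typeA n).neighborSet ⟨k + 1, hk⟩) ?_
    rintro ⟨j, hj⟩ hne
    have := j.2
    exfalso
    rcases hj with hj | hj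
    · simp only at hj; omega
    · exact hne (Subtype.ext (Fin.ext (Nat.succ_injective hj)))

end Neighbours

/-! ## Flags and frames -/

section FlagLemmas

variable {n d : ℕ} {v : Fin n → ℕ}

theorem flagOfFrames_zero (f : ∀ i : Fin n, (Fin (v i) → ℂ) →ₗ[ℂ] (Fin d → ℂ)) (h) :
    flagOfFrames f ⟨0, h⟩ = ⊤ := rfl

theorem flagOfFrames_succ (f : ∀ i : Fin n, (Fin (v i) → ℂ) →ₗ[ℂ] (Fin d → ℂ)) (k : ℕ)
    (hk : k < n) (h) : flagOfFrames f ⟨k + 1, h⟩ = LinearMap.range (f ⟨k, hk⟩) := by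
  have : (⟨k + 1, h⟩ : Fin (n + 2)) = (Fin.castSucc (⟨k, hk⟩ : Fin n)).succ := rfl
  rw [this, flagOfFrames, Fin.cons_succ, Fin.snoc_castSucc]

theorem flagOfFrames_last (f : ∀ i : Fin n, (Fin (v i) → ℂ) →ₗ[ℂ] (Fin d → ℂ)) (h) :
    flagOfFrames f ⟨n + 1, h⟩ = ⊥ := by
  have : (⟨n + 1, h⟩ : Fin (n + 2)) = (Fin.last n).succ := rfl
  rw [this, flagOfFrames, Fin.cons_succ, Fin.snoc_last]

theorem flagOfFrames_congr {v' : Fin n → ℕ}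
    {f : ∀ i : Fin n, (Fin (v i) → ℂ) →ₗ[ℂ] (Fin d → ℂ)}
    {f' : ∀ i : Fin n, (Fin (v' i) → ℂ) →ₗ[ℂ] (Fin d → ℂ)}
    (h : ∀ i, LinearMap.range (f i) = LinearMap.range (f' i)) :
    flagOfFrames f = flagOfFrames f' := by
  unfold flagOfFrames
  simp only [h]

theorem mem_cotangentFlags_iff (x : Module.End ℂ (Fin d → ℂ))
    (F : Fin (n + 2) → Submodule ℂ (Fin d → ℂ)) :
    (x, F) ∈ cotangentFlags v d ↔ F 0 = ⊤ ∧ F (Fin.last (n + 1)) = ⊥ ∧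
      (∀ i : Fin (n + 1), F i.succ ≤ F i.castSucc) ∧
      (∀ i : Fin n, Module.finrank ℂ (F i.succ.castSucc) = v i) ∧
      ∀ i : Fin (n + 1), (F i.castSucc).map x ≤ F i.succ := by
  simp only [cotangentFlags, partialFlags, Set.mem_ofPred_eq, Fin.antitone_iff_succ_le]
  tauto

theorem forgetFrames_surjective : Function.Surjective (forgetFrames v d) := by
  rintro ⟨⟨x, F⟩, hz⟩
  have hF := (mem_cotangentFlags_iff x F).1 hz
  have e : ∀ i : Fin n, (Fin (v i) → ℂ) ≃ₗ[ℂ] F i.succ.castSucc := fun i =>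
    LinearEquiv.ofFinrankEq _ _ (by rw [hF.2.2.2.1 i]; simp)
  let f : ∀ i : Fin n, (Fin (v i) → ℂ) →ₗ[ℂ] (Fin d → ℂ) := fun i =>
    (F i.succ.castSucc).subtype ∘ₗ (e i).toLinearMap
  have hf : flagOfFrames f = F := by
    funext ⟨i, hi⟩
    rcases i with _ | i
    · exact hF.1.symm
    · rcases Nat.lt_or_ge i n with h | h
      · rw [flagOfFrames_succ f i h, LinearMap.range_comp]
        simp
      · obtain rfl : i = n := by omega
        rw [flagOfFrames_last]
        exact hF.2.1.symm
  refine ⟨⟨(x, f), fun i => ?_, ?_⟩, ?_⟩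
  · exact (F i.succ.castSucc).subtype_injective.comp (e i).injective
  · rw [hf]; exact hz
  · simp only [forgetFrames, hf]

/-- Rewrites the flag conditions as conditions on maps. The ends W and 0 of the flag account for the
separate first and last conditions on `x`; the dimensions are automatic for injective frames. -/
theorem mem_cotangentFrames_iff (hn : 0 < n) (x : Module.End ℂ (Fin d → ℂ))
    (f : ∀ i : Fin n, (Fin (v i) → ℂ) →ₗ[ℂ] (Fin d → ℂ)) :
    (x, f) ∈ cotangentFrames v d ↔ (∀ i, Function.Injective (f i)) ∧
      LinearMap.range x ≤ LinearMap.range (f ⟨0, hn⟩) ∧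
      (∀ k (hk : k + 1 < n),
        LinearMap.range (f ⟨k + 1, hk⟩) ≤ LinearMap.range (f ⟨k, Nat.lt_of_succ_lt hk⟩)) ∧
      (∀ k (hk : k + 1 < n),
        LinearMap.range (x ∘ₗ f ⟨k, Nat.lt_of_succ_lt hk⟩) ≤ LinearMap.range (f ⟨k + 1, hk⟩)) ∧
      (∀ k (hk : k < n), k + 1 = n → x ∘ₗ f ⟨k, hk⟩ = 0) := by
  change (_ ∧ _) ↔ _
  refine and_congr_right fun hinj => ?_
  rw [mem_cotangentFlags_iff]
  constructor
  · rintro ⟨-, -, h3, -, h5⟩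
    refine ⟨?_, fun k hk => ?_, fun k hk => ?_, fun k hk hkn => ?_⟩
    · have := h5 ⟨0, by omega⟩
      rw [LinearMap.range_eq_map, ← flagOfFrames_zero f (by omega),
        ← flagOfFrames_succ f 0 hn (by omega)]
      exact this
    · have := h3 ⟨k + 1, by omega⟩
      rw [← flagOfFrames_succ f (k + 1) hk (by omega), ← flagOfFrames_succ f k _ (by omega)]
      exact this
    · have := h5 ⟨k + 1, by omega⟩
      rw [LinearMap.range_comp, ← flagOfFrames_succ f (k + 1) hk (by omega),
        ← flagOfFrames_succ f k _ (by omega)]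
      exact this
    · subst hkn
      have := h5 ⟨k + 1, by omega⟩
      rw [← LinearMap.range_eq_bot, eq_bot_iff, LinearMap.range_comp,
        ← flagOfFrames_succ f k _ (by omega), ← flagOfFrames_last f (by omega)]
      exact this
  · rintro ⟨h1, h2, h3, h4⟩
    refine ⟨rfl, flagOfFrames_last f _, ?_, fun i => ?_, ?_⟩
    · rintro ⟨i, hi⟩
      change flagOfFrames f ⟨i + 1, _⟩ ≤ flagOfFrames f ⟨i, _⟩
      rcases i with _ | i
      · exact le_top
      · rcases Nat.lt_or_ge (i + 1) n with h | h
        · rw [flagOfFrames_succ f (i + 1) h, flagOfFrames_succ f i (by omega)]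
          exact h2 i h
        · obtain rfl : i + 1 = n := by omega
          rw [flagOfFrames_last]
          exact bot_le
    · change Module.finrank ℂ (flagOfFrames f ⟨i + 1, _⟩) = _
      rw [flagOfFrames_succ f i i.2, LinearMap.finrank_range_of_inj (hinj _)]
      simp
    · rintro ⟨i, hi⟩
      change (flagOfFrames f ⟨i, _⟩).map x ≤ flagOfFrames f ⟨i + 1, _⟩
      rcases i with _ | i
      · rw [flagOfFrames_zero, flagOfFrames_succ f 0 hn, ← LinearMap.range_eq_map]
        exact h1
      · rcases Nat.lt_or_ge (i + 1) n with h | h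
        · rw [flagOfFrames_succ f (i + 1) h, flagOfFrames_succ f i (by omega),
            ← LinearMap.range_comp]
          exact h3 i h
        · obtain rfl : i + 1 = n := by omega
          rw [flagOfFrames_last, flagOfFrames_succ f i (by omega), ← LinearMap.range_comp,
            h4 i _ rfl, LinearMap.range_zero]

theorem exists_equiv_of_range_eq {a a' : ℕ} {W : Type*} [AddCommGroup W] [Module ℂ W]
    {f : (Fin a → ℂ) →ₗ[ℂ] W} {f' : (Fin a' → ℂ) →ₗ[ℂ] W} (hf : Function.Injective f)
    (hf' : Function.Injective f') (h : LinearMap.range f = LinearMap.range f') :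
    ∃ g : (Fin a → ℂ) ≃ₗ[ℂ] (Fin a' → ℂ), f' ∘ₗ g.toLinearMap = f := by
  refine ⟨((LinearEquiv.ofInjective f hf).trans (LinearEquiv.ofEq _ _ h)).trans
    (LinearEquiv.ofInjective f' hf').symm, LinearMap.ext fun t => ?_⟩
  have := (LinearEquiv.ofInjective f' hf').apply_symm_apply
    (LinearEquiv.ofEq _ _ h (LinearEquiv.ofInjective f hf t))
  exact congrArg Subtype.val this

end FlagLemmas

/-! ## The frames of a semistable point -/

section Nakajima

variable {n : ℕ} {v v' w : Fin n → ℕ} (hn : 0 < n)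

/-- The frames `q_1 y_1 ⋯ y_k` together with the endomorphism `q_1 p_1`. -/
def nakajimaFrames (m : Rep (typeA n) v w) : Module.End ℂ (Vec w ⟨0, hn⟩) ×
    (∀ i : Fin n, (Fin (v i) → ℂ) →ₗ[ℂ] (Fin (w ⟨0, hn⟩) → ℂ)) :=
  (m.q ⟨0, hn⟩ ∘ₗ m.p ⟨0, hn⟩, fun i => frameMap hn m i i.2)

theorem subsingleton_vec (hw : ∀ i, i ≠ ⟨0, hn⟩ → w i = 0) {i : Fin n} (hi : i ≠ ⟨0, hn⟩) :
    Subsingleton (Vec w i) := by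
  rw [Vec, hw i hi]
  infer_instance

theorem p_eq_zero (hw : ∀ i, i ≠ ⟨0, hn⟩ → w i = 0) (m : Rep (typeA n) v w) {i : Fin n}
    (hi : i ≠ ⟨0, hn⟩) : m.p i = 0 := by
  have := subsingleton_vec hn hw hi
  exact LinearMap.ext fun u => by rw [Subsingleton.elim u 0, map_zero, map_zero]

theorem q_eq_zero (hw : ∀ i, i ≠ ⟨0, hn⟩ → w i = 0) (m : Rep (typeA n) v w) {i : Fin n}
    (hi : i ≠ ⟨0, hn⟩) : m.q i = 0 := by
  have := subsingleton_vec hn hw hi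
  exact LinearMap.ext fun u => Subsingleton.elim _ _

/-- The component `V_k → V_{k+1}`. -/
def Rep.fwd (m : Rep (typeA n) v w) (k : ℕ) (hk : k + 1 < n) :
    Vec v ⟨k, Nat.lt_of_succ_lt hk⟩ →ₗ[ℂ] Vec v ⟨k + 1, hk⟩ := m.x (adj_succ hk)

/-- The component `V_{k+1} → V_k`. -/
def Rep.bwd (m : Rep (typeA n) v w) (k : ℕ) (hk : k + 1 < n) :
    Vec v ⟨k + 1, hk⟩ →ₗ[ℂ] Vec v ⟨k, Nat.lt_of_succ_lt hk⟩ := m.x (adj_pred hk)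

theorem frameMap_zero (m : Rep (typeA n) v w) : frameMap hn m 0 hn = m.q ⟨0, hn⟩ := rfl

theorem frameMap_succ (m : Rep (typeA n) v w) (k : ℕ) (hk : k + 1 < n) :
    frameMap hn m (k + 1) hk = frameMap hn m k (Nat.lt_of_succ_lt hk) ∘ₗ m.bwd k hk := rfl

theorem moment_zero (m : Rep (typeA n) v w) :
    m.moment (epsA n) ⟨0, hn⟩ =
      (if h : 0 + 1 < n then m.bwd 0 h ∘ₗ m.fwd 0 h else 0) - m.p ⟨0, hn⟩ ∘ₗ m.q ⟨0, hn⟩ := by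
  rw [Rep.moment, sum_neighborSet_zero hn fun j h =>
    (epsA n j ⟨0, hn⟩ : ℂ) • (m.x ((typeA n).adj_symm h) ∘ₗ m.x h)]
  congr 1
  refine dite_congr rfl (fun h => ?_) fun _ => rfl
  have : epsA n ⟨0 + 1, h⟩ ⟨0, hn⟩ = 1 := by simp [epsA]
  rw [this, Int.cast_one, one_smul]
  rfl

theorem moment_succ (m : Rep (typeA n) v w) (k : ℕ) (hk : k + 1 < n) :
    m.moment (epsA n) ⟨k + 1, hk⟩ = -(m.fwd k hk ∘ₗ m.bwd k hk) +
      (if h : k + 1 + 1 < n then m.bwd (k + 1) h ∘ₗ m.fwd (k + 1) h else 0) -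
      m.p ⟨k + 1, hk⟩ ∘ₗ m.q ⟨k + 1, hk⟩ := by
  rw [Rep.moment, sum_neighborSet_succ hk fun j h =>
    (epsA n j ⟨k + 1, hk⟩ : ℂ) • (m.x ((typeA n).adj_symm h) ∘ₗ m.x h)]
  congr 2
  · have : epsA n ⟨k, Nat.lt_of_succ_lt hk⟩ ⟨k + 1, hk⟩ = -1 := by simp [epsA]
    rw [this, Int.cast_neg, Int.cast_one]
    exact neg_one_smul ℂ (m.fwd k hk ∘ₗ m.bwd k hk)
  · refine dite_congr rfl (fun h => ?_) fun _ => rfl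
    have : epsA n ⟨k + 1 + 1, h⟩ ⟨k + 1, hk⟩ = 1 := by simp [epsA]
    rw [this, Int.cast_one, one_smul]
    rfl

variable {hn} in
-- Induction along the chain: at the first vertex the moment map equation identifies the round trip
-- through the second vertex with p_1 q_1; at an inner vertex, where p vanishes, it equates the
-- round trips through the two neighbours.
theorem frameMap_comp_fwd (hw : ∀ i, i ≠ ⟨0, hn⟩ → w i = 0) {m : Rep (typeA n) v w}
    (hm : ∀ i, m.moment (epsA n) i = 0) : ∀ (k : ℕ) (hk : k + 1 < n),
    frameMap hn m (k + 1) hk ∘ₗ m.fwd k hk =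
      (m.q ⟨0, hn⟩ ∘ₗ m.p ⟨0, hn⟩) ∘ₗ frameMap hn m k (Nat.lt_of_succ_lt hk)
  | 0, hk => by
    have h := hm ⟨0, hn⟩
    rw [moment_zero, dif_pos hk, sub_eq_zero] at h
    rw [frameMap_succ, frameMap_zero, LinearMap.comp_assoc, LinearMap.comp_assoc, ← h]
  | k + 1, hk => by
    have ih := frameMap_comp_fwd hw hm k (Nat.lt_of_succ_lt hk)
    have h := hm ⟨k + 1, Nat.lt_of_succ_lt hk⟩
    rw [moment_succ, dif_pos hk, p_eq_zero hn hw m (by simp),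
      LinearMap.zero_comp, sub_zero, neg_add_eq_zero] at h
    rw [frameMap_succ, LinearMap.comp_assoc, ← h, ← LinearMap.comp_assoc, ih,
      frameMap_succ hn m k, LinearMap.comp_assoc]

variable {hn} in
-- The last vertex has no further neighbour, so its moment map equation has one term fewer and
-- expresses a vanishing.
theorem endo_comp_frameMap_last (hw : ∀ i, i ≠ ⟨0, hn⟩ → w i = 0) {m : Rep (typeA n) v w}
    (hm : ∀ i, m.moment (epsA n) i = 0) : ∀ (k : ℕ) (hk : k < n), k + 1 = n →
      (m.q ⟨0, hn⟩ ∘ₗ m.p ⟨0, hn⟩) ∘ₗ frameMap hn m k hk = 0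
  | 0, hk, hkn => by
    have h := hm ⟨0, hn⟩
    rw [moment_zero, dif_neg (by omega), zero_sub, neg_eq_zero] at h
    rw [frameMap_zero, LinearMap.comp_assoc, h, LinearMap.comp_zero]
  | k + 1, hk, hkn => by
    have h := hm ⟨k + 1, hk⟩
    rw [moment_succ, dif_neg (by omega), p_eq_zero hn hw m (by simp),
      LinearMap.zero_comp, sub_zero, add_zero, neg_eq_zero] at h
    rw [frameMap_succ, ← LinearMap.comp_assoc, ← frameMap_comp_fwd hw hm k hk,
      LinearMap.comp_assoc, h, LinearMap.comp_zero]

variable {hn} in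
-- The kernels of the frame maps are destabilising: backward maps preserve them by construction,
-- forward maps by `frameMap_comp_fwd`, and q vanishes on them. A sum of nonnegative terms that is
-- at most 0 has all terms 0, and each `ξ i` is positive.
theorem frameMap_injective (hw : ∀ i, i ≠ ⟨0, hn⟩ → w i = 0) {ξ : Fin n → ℤ} (hξ : ∀ i, 0 < ξ i)
    {m : Rep (typeA n) v w} (hm : ∀ i, m.moment (epsA n) i = 0) (hss : m.IsSemistable ξ)
    (i : Fin n) : Function.Injective (frameMap hn m i i.2) := by
  have hS := hss.1 (fun i => LinearMap.ker (frameMap hn m i i.2)) ?_ ?_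
  · have h0 : ∀ i ∈ Finset.univ, 0 ≤
        ξ i * (Module.finrank ℂ (LinearMap.ker (frameMap hn m i i.2)) : ℤ) := fun i _ =>
      mul_nonneg (hξ i).le (Int.natCast_nonneg _)
    have := (Finset.sum_eq_zero_iff_of_nonneg h0).1 (le_antisymm hS (Finset.sum_nonneg h0)) i
      (Finset.mem_univ i)
    rw [mul_eq_zero, or_iff_right (hξ i).ne', Int.natCast_eq_zero, Submodule.finrank_eq_zero] at this
    exact LinearMap.ker_eq_bot.1 this
  · rintro ⟨i, hi⟩ ⟨j, hj⟩ (h | h)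
    · obtain rfl : i + 1 = j := h
      rintro _ ⟨t, ht, rfl⟩
      have := LinearMap.congr_fun (frameMap_comp_fwd hw hm i hj) t
      have ht' : frameMap hn m i hi t = 0 := ht
      rw [LinearMap.comp_apply, LinearMap.comp_apply, ht', map_zero] at this
      exact this
    · obtain rfl : j + 1 = i := h
      rintro _ ⟨t, ht, rfl⟩
      exact ht
  · intro i
    by_cases hi : i = ⟨0, hn⟩
    · subst hi; exact le_refl _
    · rw [q_eq_zero hn hw m hi, LinearMap.ker_zero]; exact le_top

variable {hn} in
theorem nakajimaFrames_mem (hw : ∀ i, i ≠ ⟨0, hn⟩ → w i = 0) {ξ : Fin n → ℤ} (hξ : ∀ i, 0 < ξ i)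
    {m : Rep (typeA n) v w} (hm : m ∈ semistableLocus (typeA n) (epsA n) ξ 0 v w) :
    nakajimaFrames hn m ∈ cotangentFrames v (w ⟨0, hn⟩) := by
  have hmom : ∀ i, m.moment (epsA n) i = 0 := fun i => by simpa using hm.1 i
  refine (mem_cotangentFrames_iff hn _ _).2 ⟨frameMap_injective hw hξ hmom hm.2,
    LinearMap.range_comp_le_range _ _, fun k hk => LinearMap.range_comp_le_range _ _,
    fun k hk => ?_, fun k hk hkn => endo_comp_frameMap_last hw hmom k hk hkn⟩
  rw [← frameMap_comp_fwd hw hmom k hk]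
  exact LinearMap.range_comp_le_range _ _

theorem frameMap_comp_intertwiner {m : Rep (typeA n) v w} {m' : Rep (typeA n) v' w}
    {g : ∀ i, Vec v i ≃ₗ[ℂ] Vec v' i} (hg : Rep.IsIntertwiner m m' g) : ∀ (k : ℕ) (hk : k < n),
    frameMap hn m' k hk ∘ₗ (g ⟨k, hk⟩).toLinearMap = frameMap hn m k hk
  | 0, _ => hg.2.2 _
  | k + 1, hk => by
    rw [frameMap_succ, LinearMap.comp_assoc]
    have h : m'.bwd k hk ∘ₗ (g ⟨k + 1, hk⟩).toLinearMap = (g ⟨k, _⟩).toLinearMap ∘ₗ m.bwd k hk :=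
      hg.1 _ _ (adj_pred hk)
    rw [h, ← LinearMap.comp_assoc, frameMap_comp_intertwiner hg k, frameMap_succ]

theorem Rep.Equivalent.nakajimaPair_eq {m : Rep (typeA n) v w} {m' : Rep (typeA n) v' w}
    (h : m.Equivalent m') : nakajimaPair hn m = nakajimaPair hn m' := by
  obtain ⟨g, hg⟩ := h
  refine Prod.ext ?_ ?_
  · change m.q _ ∘ₗ m.p _ = m'.q _ ∘ₗ m'.p _
    rw [hg.2.1, ← hg.2.2, LinearMap.comp_assoc]
  · change flagOfFrames _ = flagOfFrames _
    refine flagOfFrames_congr fun i => ?_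
    rw [← frameMap_comp_intertwiner hn hg]
    exact LinearMap.range_comp_of_range_eq_top _ (LinearEquiv.range _)

variable {hn} in
-- Injective frames with the same image differ by an isomorphism. Each intertwining identity may be
-- checked after composing with an injective frame, where it becomes an identity between the same x
-- and the same frames.
theorem equivalent_of_nakajimaPair_eq (hw : ∀ i, i ≠ ⟨0, hn⟩ → w i = 0) {ξ : Fin n → ℤ}
    (hξ : ∀ i, 0 < ξ i) {m : Rep (typeA n) v w} {m' : Rep (typeA n) v' w}
    (hm : m ∈ semistableLocus (typeA n) (epsA n) ξ 0 v w)
    (hm' : m' ∈ semistableLocus (typeA n) (epsA n) ξ 0 v' w)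
    (h : nakajimaPair hn m = nakajimaPair hn m') : m.Equivalent m' := by
  have hmom : ∀ i, m.moment (epsA n) i = 0 := fun i => by simpa using hm.1 i
  have hmom' : ∀ i, m'.moment (epsA n) i = 0 := fun i => by simpa using hm'.1 i
  have hinj := frameMap_injective hw hξ hmom hm.2
  have hinj' := frameMap_injective hw hξ hmom' hm'.2
  have hx : m.q ⟨0, hn⟩ ∘ₗ m.p ⟨0, hn⟩ = m'.q ⟨0, hn⟩ ∘ₗ m'.p ⟨0, hn⟩ := congrArg Prod.fst h
  have hr : ∀ i : Fin n, LinearMap.range (frameMap hn m i i.2) =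
      LinearMap.range (frameMap hn m' i i.2) := fun i => by
    have := congrFun (congrArg Prod.snd h) ⟨i + 1, by omega⟩
    simp only [nakajimaPair] at this
    rwa [flagOfFrames_succ _ i i.2, flagOfFrames_succ _ i i.2] at this
  choose g hg using fun i => exists_equiv_of_range_eq (hinj i) (hinj' i) (hr i)
  have hg0 : m'.q ⟨0, hn⟩ ∘ₗ (g ⟨0, hn⟩).toLinearMap = m.q ⟨0, hn⟩ := hg ⟨0, hn⟩
  have hcancel : ∀ {i : Fin n} {X : Type} [AddCommGroup X] [Module ℂ X] {a b : X →ₗ[ℂ] Vec v' i},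
      frameMap hn m' i i.2 ∘ₗ a = frameMap hn m' i i.2 ∘ₗ b → a = b := fun hab =>
    LinearMap.ext fun t => hinj' _ (LinearMap.congr_fun hab t)
  refine ⟨g, ?_, fun i => ?_, fun i => ?_⟩
  · rintro ⟨i, hi⟩ ⟨j, hj⟩ (h | h)
    · obtain rfl : i + 1 = j := h
      refine hcancel ?_
      have h1 := frameMap_comp_fwd hw hmom i hj
      have h2 := frameMap_comp_fwd hw hmom' i hj
      have h3 := hg ⟨i, hi⟩
      have h4 := hg ⟨i + 1, hj⟩
      change _ ∘ₗ m'.fwd i hj ∘ₗ _ = _ ∘ₗ _ ∘ₗ m.fwd i hj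
      rw [← LinearMap.comp_assoc, ← LinearMap.comp_assoc, h4, h1, h2, LinearMap.comp_assoc, hx, h3]
    · obtain rfl : j + 1 = i := h
      refine hcancel ?_
      change _ ∘ₗ m'.bwd j hi ∘ₗ _ = _ ∘ₗ _ ∘ₗ m.bwd j hi
      rw [← LinearMap.comp_assoc, ← LinearMap.comp_assoc, hg ⟨j, hj⟩]
      exact hg ⟨j + 1, hi⟩
  · by_cases hi : i = ⟨0, hn⟩
    · subst hi
      refine hcancel ?_
      change m'.q _ ∘ₗ m'.p _ = m'.q _ ∘ₗ _
      rw [← hx, ← LinearMap.comp_assoc, hg0]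
    · rw [p_eq_zero hn hw m hi, p_eq_zero hn hw m' hi, LinearMap.comp_zero]
  · by_cases hi : i = ⟨0, hn⟩
    · subst hi
      exact hg0
    · rw [q_eq_zero hn hw m hi, q_eq_zero hn hw m' hi, LinearMap.zero_comp]

end Nakajima

/-- The projection to the `i`-th frame. -/
def frameProj {n : ℕ} (v : Fin n → ℕ) (d : ℕ) (i : Fin n) :
    (Module.End ℂ (Fin d → ℂ) × (∀ i : Fin n, (Fin (v i) → ℂ) →ₗ[ℂ] (Fin d → ℂ))) →ₗ[ℂ]
      (Fin (v i) → ℂ) →ₗ[ℂ] (Fin d → ℂ) where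
  toFun z := z.2 i
  map_add' _ _ := rfl
  map_smul' _ _ := rfl

/-! ## Nakajima's isomorphism -/

section NakajimaIso

variable {n : ℕ} {v w : Fin n → ℕ} (hn : 0 < n)

/-- The representation attached to an endomorphism `x`, frames `f` and left inverses `g` of the
frames. -/
def repOfFrames (x : Module.End ℂ (Vec w ⟨0, hn⟩))
    (f : ∀ i : Fin n, Vec v i →ₗ[ℂ] Vec w ⟨0, hn⟩) (g : ∀ i : Fin n, Vec w ⟨0, hn⟩ →ₗ[ℂ] Vec v i) :
    Rep (typeA n) v w :=
  (fun h => g h.snd ∘ₗ if h.snd < h.fst then f h.fst else x ∘ₗ f h.fst,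
    fun i => if h : i = ⟨0, hn⟩ then by subst h; exact g _ ∘ₗ x else 0,
    fun i => if h : i = ⟨0, hn⟩ then by subst h; exact f _ else 0)

section

variable {hn} {x : Module.End ℂ (Vec w ⟨0, hn⟩)}
  {f : ∀ i : Fin n, Vec v i →ₗ[ℂ] Vec w ⟨0, hn⟩} {g : ∀ i : Fin n, Vec w ⟨0, hn⟩ →ₗ[ℂ] Vec v i}

theorem repOfFrames_bwd (k : ℕ) (hk : k + 1 < n) :
    (repOfFrames hn x f g).bwd k hk = g ⟨k, Nat.lt_of_succ_lt hk⟩ ∘ₗ f ⟨k + 1, hk⟩ := by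
  change _ ∘ₗ (if (_ : Fin n) < _ then _ else _) = _
  rw [if_pos]
  rw [Fin.lt_def]
  exact Nat.lt_succ_self k

theorem repOfFrames_fwd (k : ℕ) (hk : k + 1 < n) :
    (repOfFrames hn x f g).fwd k hk = g ⟨k + 1, hk⟩ ∘ₗ x ∘ₗ f ⟨k, Nat.lt_of_succ_lt hk⟩ := by
  change _ ∘ₗ (if (_ : Fin n) < _ then _ else _) = _
  rw [if_neg]
  rw [Fin.lt_def, not_lt]
  exact Nat.le_succ k

theorem repOfFrames_p : (repOfFrames hn x f g).p ⟨0, hn⟩ = g ⟨0, hn⟩ ∘ₗ x := by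
  simp [repOfFrames, Rep.p]

theorem repOfFrames_q : (repOfFrames hn x f g).q ⟨0, hn⟩ = f ⟨0, hn⟩ := by
  simp [repOfFrames, Rep.q]

/-- On the image of `f i` the map `f i ∘ₗ g i` is the identity; hence the representation does not
depend on the chosen left inverses. -/
theorem comp_leftInverse_comp {i : Fin n} (hg : g i ∘ₗ f i = LinearMap.id) {X : Type*}
    [AddCommGroup X] [Module ℂ X] {h : X →ₗ[ℂ] Vec w ⟨0, hn⟩}
    (hh : LinearMap.range h ≤ LinearMap.range (f i)) : f i ∘ₗ g i ∘ₗ h = h := by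
  ext1 t
  obtain ⟨u, hu⟩ := hh ⟨t, rfl⟩
  rw [LinearMap.comp_apply, LinearMap.comp_apply, ← hu]
  exact congrArg (f i) (LinearMap.congr_fun hg u)

theorem frameMap_repOfFrames (hz : (x, f) ∈ cotangentFrames v (w ⟨0, hn⟩))
    (hg : ∀ i, g i ∘ₗ f i = LinearMap.id) : ∀ (k : ℕ) (hk : k < n),
    frameMap hn (repOfFrames hn x f g) k hk = f ⟨k, hk⟩
  | 0, _ => repOfFrames_q
  | k + 1, hk => by
    rw [frameMap_succ, frameMap_repOfFrames hz hg k, repOfFrames_bwd]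
    exact comp_leftInverse_comp (hg _) (((mem_cotangentFrames_iff hn x f).1 hz).2.2.1 k hk)

theorem q_comp_p_repOfFrames (hz : (x, f) ∈ cotangentFrames v (w ⟨0, hn⟩))
    (hg : ∀ i, g i ∘ₗ f i = LinearMap.id) :
    (repOfFrames hn x f g).q ⟨0, hn⟩ ∘ₗ (repOfFrames hn x f g).p ⟨0, hn⟩ = x := by
  rw [repOfFrames_q, repOfFrames_p]
  exact comp_leftInverse_comp (hg _) ((mem_cotangentFrames_iff hn x f).1 hz).2.1

/-- The moment map equations are tested after composing with the injective frames, where both round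
trips at a vertex become x. An invariant subspace of ker q is killed by all frame maps, hence zero;
the condition on `T` only uses that its dimensions are at most those of V and that `ξ` is positive.
-/
theorem repOfFrames_mem (hz : (x, f) ∈ cotangentFrames v (w ⟨0, hn⟩))
    (hg : ∀ i, g i ∘ₗ f i = LinearMap.id)
    (hw : ∀ i, i ≠ ⟨0, hn⟩ → w i = 0) {ξ : Fin n → ℤ} (hξ : ∀ i, 0 < ξ i) :
    repOfFrames hn x f g ∈ semistableLocus (typeA n) (epsA n) ξ 0 v w := by
  set m := repOfFrames hn x f g with hmdef
  obtain ⟨hinj, h0, h1, h2, h3⟩ := (mem_cotangentFrames_iff hn x f).1 hz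
  have hframe := frameMap_repOfFrames hz hg
  have hcancel : ∀ {i : Fin n} {X : Type} [AddCommGroup X] [Module ℂ X] {a b : X →ₗ[ℂ] Vec v i},
      f i ∘ₗ a = f i ∘ₗ b → a = b := fun hab =>
    LinearMap.ext fun t => hinj _ (LinearMap.congr_fun hab t)
  have hb : ∀ k (hk : k + 1 < n), f ⟨k, Nat.lt_of_succ_lt hk⟩ ∘ₗ m.bwd k hk = f ⟨k + 1, hk⟩ :=
    fun k hk => by
      rw [repOfFrames_bwd]
      exact comp_leftInverse_comp (hg _) (h1 k hk)
  have hf : ∀ k (hk : k + 1 < n), f ⟨k + 1, hk⟩ ∘ₗ m.fwd k hk =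
      x ∘ₗ f ⟨k, Nat.lt_of_succ_lt hk⟩ := fun k hk => by
    rw [repOfFrames_fwd]
    exact comp_leftInverse_comp (hg _) (h2 k hk)
  -- At the last vertex the missing round trip agrees with x on the last step of the flag, which is
  -- zero.
  have hbf : ∀ k (hk : k < n), f ⟨k, hk⟩ ∘ₗ (if h : k + 1 < n then m.bwd k h ∘ₗ m.fwd k h else 0) =
      x ∘ₗ f ⟨k, hk⟩ := by
    intro k hk
    by_cases h : k + 1 < n
    · rw [dif_pos h, ← LinearMap.comp_assoc, hb, hf]
    · rw [dif_neg h, h3 k hk (by omega), LinearMap.comp_zero]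
  refine ⟨fun i => ?_, ?_, ?_⟩
  · rw [Pi.zero_apply, zero_smul]
    obtain ⟨i, hi⟩ := i
    rcases i with _ | k
    · rw [moment_zero]
      refine hcancel ?_
      rw [LinearMap.comp_sub, hbf, LinearMap.comp_zero, repOfFrames_p, repOfFrames_q,
        ← LinearMap.comp_assoc, comp_leftInverse_comp (hg _) h0, sub_self]
    · rw [moment_succ, p_eq_zero hn hw m (by simp), LinearMap.zero_comp, sub_zero]
      refine hcancel ?_
      rw [LinearMap.comp_add, hbf, LinearMap.comp_zero, LinearMap.comp_neg, ← LinearMap.comp_assoc,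
        hf, LinearMap.comp_assoc, hb, neg_add_cancel]
  · intro S hS hker
    refine (Finset.sum_eq_zero fun i _ => ?_).le
    have hi : S i = ⊥ := by
      have key : ∀ k (hk : k < n), ∀ t ∈ S ⟨k, hk⟩, frameMap hn m k hk t = 0 := by
        intro k
        induction k with
        | zero => exact fun hk t ht => hker _ ht
        | succ k ih =>
          intro hk t ht
          exact ih (Nat.lt_of_succ_lt hk) (m.bwd k hk t) (hS _ _ (adj_pred hk) ⟨t, ht, rfl⟩)
      rw [eq_bot_iff]
      intro t ht
      have := key i i.2 t ht
      rw [hframe] at this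
      exact hinj i (this.trans (map_zero _).symm)
    rw [hi, finrank_bot, Nat.cast_zero, mul_zero]
  · intro T _ _
    refine Finset.sum_le_sum fun i _ => mul_le_mul_of_nonneg_left ?_ (hξ i).le
    exact_mod_cast (Submodule.finrank_le (T i)).trans_eq (by simp)

theorem nakajimaFrames_repOfFrames (hz : (x, f) ∈ cotangentFrames v (w ⟨0, hn⟩))
    (hg : ∀ i, g i ∘ₗ f i = LinearMap.id) :
    nakajimaFrames hn (repOfFrames hn x f g) = (x, f) :=
  Prod.ext (q_comp_p_repOfFrames hz hg) (funext fun i => frameMap_repOfFrames hz hg i i.2)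

end

theorem exists_leftInverse {a b : ℕ} {f : (Fin a → ℂ) →ₗ[ℂ] (Fin b → ℂ)}
    (hf : Function.Injective f) :
    ∃ g : (Fin b → ℂ) →ₗ[ℂ] (Fin a → ℂ), g ∘ₗ f = LinearMap.id :=
  f.exists_leftInverse_of_injective (LinearMap.ker_eq_bot.2 hf)

variable (hw : ∀ i, i ≠ ⟨0, hn⟩ → w i = 0) {ξ : Fin n → ℤ} (hξ : ∀ i, 0 < ξ i)

theorem regAt_frameMap (m₀ : Rep (typeA n) v w) : ∀ (k : ℕ) (hk : k < n),
    RegAt m₀ fun m : Rep (typeA n) v w => frameMap hn m k hk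
  | 0, _ => regAt_linearMap m₀ (LinearMap.proj (⟨0, hn⟩ : Fin n) ∘ₗ LinearMap.snd ℂ _ _ ∘ₗ
      LinearMap.snd ℂ _ _)
  | k + 1, hk => (regAt_frameMap m₀ k _).comp (regAt_linearMap m₀
      (LinearMap.proj (⟨(_, _), adj_pred hk⟩ : (typeA n).Dart) ∘ₗ LinearMap.fst ℂ _ _))

theorem regAt_nakajimaFrames (m₀ : Rep (typeA n) v w) :
    RegAt m₀ (nakajimaFrames hn : Rep (typeA n) v w → _) := by
  refine RegAt.prodMk (RegAt.comp ?_ ?_) (RegAt.pi fun i => regAt_frameMap hn m₀ i i.2)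
  · exact regAt_linearMap m₀ (LinearMap.proj (⟨0, hn⟩ : Fin n) ∘ₗ LinearMap.snd ℂ _ _ ∘ₗ
      LinearMap.snd ℂ _ _)
  · exact regAt_linearMap m₀ (LinearMap.proj (⟨0, hn⟩ : Fin n) ∘ₗ LinearMap.fst ℂ _ _ ∘ₗ
      LinearMap.snd ℂ _ _)

theorem regAt_repOfFrames {E : Type*} [AddCommGroup E] [Module ℂ E] {e : E}
    {x : E → Module.End ℂ (Vec w ⟨0, hn⟩)} {f : ∀ i : Fin n, E → Vec v i →ₗ[ℂ] Vec w ⟨0, hn⟩}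
    {g : ∀ i : Fin n, E → Vec w ⟨0, hn⟩ →ₗ[ℂ] Vec v i} (hx : RegAt e x) (hf : ∀ i, RegAt e (f i))
    (hg : ∀ i, RegAt e (g i)) :
    RegAt e fun y => repOfFrames hn (x y) (fun i => f i y) fun i => g i y := by
  refine RegAt.prodMk (RegAt.pi fun h => (hg _).comp ?_)
    (RegAt.prodMk (RegAt.pi fun i => ?_) (RegAt.pi fun i => ?_))
  · split_ifs
    · exact hf _
    · exact hx.comp (hf _)
  · by_cases h : i = ⟨0, hn⟩
    · subst h
      simp only [dite_true]
      exact (hg _).comp hx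
    · simp only [dif_neg h]
      exact RegAt.const _ _
  · by_cases h : i = ⟨0, hn⟩
    · subst h
      simp only [dite_true]
      exact hf _
    · simp only [dif_neg h]
      exact RegAt.const _ _

/-- Nakajima's map on `G_v`-orbits. -/
def nakajimaMap : QuiverPoint (typeA n) (epsA n) ξ 0 v w → cotangentFlags v (w ⟨0, hn⟩) :=
  Quotient.lift (s := orbitSetoid (typeA n) (epsA n) ξ 0 v w)
    (fun m => ⟨nakajimaPair hn m.1, (nakajimaFrames_mem hw hξ m.2).2⟩)
    fun _ _ h => Subtype.ext (Rep.Equivalent.nakajimaPair_eq hn h)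

theorem nakajimaMap_bijective :
    Function.Bijective (nakajimaMap hn hw hξ : QuiverPoint (typeA n) (epsA n) ξ 0 v w → _) := by
  constructor
  · intro y y'
    induction y using Quotient.inductionOn
    induction y' using Quotient.inductionOn
    rename_i m m'
    intro h
    exact Quotient.sound (equivalent_of_nakajimaPair_eq hw hξ m.2 m'.2 (congrArg Subtype.val h))
  · intro z
    obtain ⟨⟨⟨x, f⟩, hz⟩, rfl⟩ := forgetFrames_surjective z
    choose g hg using fun i => exists_leftInverse (hz.1 i)
    refine ⟨orbit _ _ _ _ _ _ ⟨_, repOfFrames_mem hz hg hw hξ⟩, Subtype.ext ?_⟩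
    have h := nakajimaFrames_repOfFrames hz hg
    have h1 := congrArg Prod.fst h
    have h2 := congrArg Prod.snd h
    exact Prod.ext h1 (congrArg flagOfFrames h2)

/-- Nakajima's isomorphism `φ`. -/
def nakajimaIso : VarietyIso (quiverVariety (typeA n) (epsA n) ξ 0 v w)
    (cotangentVariety v (w ⟨0, hn⟩)) :=
  .ofMorphisms (Equiv.ofBijective _ (nakajimaMap_bijective hn hw hξ))
    (isMorphism_quotient fun m => ⟨1, one_mem _, one_ne_zero, nakajimaFrames hn,
      regAt_nakajimaFrames hn _, fun m' _ => ⟨nakajimaFrames_mem hw hξ m'.2, rfl⟩⟩)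
    (isMorphism_quotient fun z => by
      choose ρ hρ using fun i => exists_leftInverse (z.2.1 i)
      -- With `ρ i` a left inverse of the frame at `z`, the map (ρ f)⁻¹ ρ is a left inverse of every
      -- frame f with det (ρ f) nonzero, and is rational in f. At `z` the determinants equal 1.
      refine ⟨∏ i, fun y => LinearMap.det (ρ i ∘ₗ y.2 i), prod_mem fun i _ =>
        det_comp_mem_polyFun (LinearMap.llcomp ℂ _ _ _ (ρ i) ∘ₗ frameProj v _ i),
        ?_, fun y => repOfFrames hn y.1 y.2 fun i =>
            endInv (ρ i ∘ₗ y.2 i) ∘ₗ ρ i, ?_, ?_⟩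
      · rw [Finset.prod_apply]
        refine Finset.prod_ne_zero_iff.2 fun i _ => ?_
        rw [hρ i, LinearMap.det_id]
        exact one_ne_zero
      · have hf : ∀ i, RegAt (z : Module.End ℂ (Vec w ⟨0, hn⟩) × (∀ i : Fin n, Vec v i →ₗ[ℂ] _))
            fun y => y.2 i := fun i =>
          regAt_linearMap _ (frameProj v _ i)
        have hx : RegAt (z : Module.End ℂ (Vec w ⟨0, hn⟩) × (∀ i : Fin n, Vec v i →ₗ[ℂ] _))
            fun y => y.1 := regAt_linearMap _ (LinearMap.fst ℂ (Module.End ℂ (Vec w ⟨0, hn⟩))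
              (∀ i : Fin n, Vec v i →ₗ[ℂ] Vec w ⟨0, hn⟩))
        refine regAt_repOfFrames hn hx hf fun i => ?_
        refine (RegAt.endInv ((RegAt.const _ (ρ i)).comp (hf i)) ?_).comp (RegAt.const _ (ρ i))
        rw [hρ i, LinearMap.det_id]
        exact one_ne_zero
      · intro y hy
        rw [Finset.prod_apply, Finset.prod_ne_zero_iff] at hy
        have hg : ∀ i, (endInv (ρ i ∘ₗ y.1.2 i) ∘ₗ ρ i) ∘ₗ y.1.2 i = LinearMap.id := fun i => by
          rw [LinearMap.comp_assoc, endInv_comp (hy i (Finset.mem_univ i))]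
        refine ⟨repOfFrames_mem y.2 hg hw hξ, ?_⟩
        rw [Equiv.eq_symm_apply]
        refine Subtype.ext ?_
        have h := nakajimaFrames_repOfFrames y.2 hg
        have h1 := congrArg Prod.fst h
        have h2 := congrArg Prod.snd h
        exact Prod.ext h1 (congrArg flagOfFrames h2))

end NakajimaIso

/-! ## Adjoints and orthogonal flags -/

theorem eq_of_forall_bilin_eq {E : Type*} [AddCommGroup E] [Module ℂ E]
    {B : LinearMap.BilinForm ℂ E} (hB : B.Nondegenerate) {u u' : E}
    (h : ∀ e, B e u = B e u') : u = u' := by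
  rw [← sub_eq_zero]
  exact hB.2 _ fun e => by rw [map_sub, h, sub_self]

section Adjoint

variable {E E' : Type*} [AddCommGroup E] [Module ℂ E] [FiniteDimensional ℂ E]
    [AddCommGroup E'] [Module ℂ E'] {B : LinearMap.BilinForm ℂ E} (hB : B.Nondegenerate)
    {B' : LinearMap.BilinForm ℂ E'}

theorem eq_rightAdjoint {T : E →ₗ[ℂ] E'} {S : E' →ₗ[ℂ] E} (h : ∀ e e', B' (T e) e' = B e (S e')) :
    S = rightAdjoint B hB B' T :=
  LinearMap.ext fun e' => eq_of_forall_bilin_eq hB fun e => by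
    rw [← h, rightAdjoint_spec B hB B' T]

variable (B') in
theorem rightAdjoint_add (T T' : E →ₗ[ℂ] E') :
    rightAdjoint B hB B' (T + T') = rightAdjoint B hB B' T + rightAdjoint B hB B' T' :=
  (eq_rightAdjoint hB fun e e' => by
    simp [rightAdjoint_spec B hB B' T, rightAdjoint_spec B hB B' T']).symm

variable (B') in
theorem rightAdjoint_smul (c : ℂ) (T : E →ₗ[ℂ] E') :
    rightAdjoint B hB B' (c • T) = c • rightAdjoint B hB B' T :=
  (eq_rightAdjoint hB fun e e' => by
    simp [rightAdjoint_spec B hB B' T]).symm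

variable (B') in
theorem rightAdjoint_neg (T : E →ₗ[ℂ] E') :
    rightAdjoint B hB B' (-T) = -rightAdjoint B hB B' T :=
  (eq_rightAdjoint hB fun e e' => by
    simp [rightAdjoint_spec B hB B' T]).symm

theorem rightAdjoint_comp [FiniteDimensional ℂ E'] {E'' : Type*} [AddCommGroup E'']
    [Module ℂ E''] (hB' : B'.Nondegenerate) (B'' : LinearMap.BilinForm ℂ E'') (T : E →ₗ[ℂ] E')
    (S : E' →ₗ[ℂ] E'') : rightAdjoint B hB B'' (S ∘ₗ T) =
      rightAdjoint B hB B' T ∘ₗ rightAdjoint B' hB' B'' S :=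
  (eq_rightAdjoint hB fun e e' => by
    rw [LinearMap.comp_apply, LinearMap.comp_apply, rightAdjoint_spec B' hB' B'' S,
      rightAdjoint_spec B hB B' T]).symm

/-- The right adjoint for the flipped form is the left adjoint for the original one. Flipping thus
inverts the construction without any symmetry of the form. -/
theorem rightAdjoint_flip_rightAdjoint (T : E →ₗ[ℂ] E) :
    rightAdjoint B.flip hB.flip B.flip (rightAdjoint B hB B T) = T :=
  (eq_rightAdjoint hB.flip fun e e' => by
    change B e' (rightAdjoint B hB B T e) = B (T e') e
    rw [rightAdjoint_spec B hB B T]).symm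

include hB in
theorem orthogonal_flip_orthogonal (F : Submodule ℂ E) :
    B.flip.orthogonal (B.orthogonal F) = F := by
  have h1 : F ≤ B.flip.orthogonal (B.orthogonal F) := fun u hu t ht => ht u hu
  refine (Submodule.eq_of_le_of_finrank_eq h1 ?_).symm
  rw [LinearMap.BilinForm.finrank_orthogonal hB.flip, LinearMap.BilinForm.finrank_orthogonal hB]
  have := Submodule.finrank_le F
  omega

end Adjoint

/-! ### Orthogonal flags and the isomorphism σ₁ -/

section OrthogonalFlag

variable {n d : ℕ} {v v' : Fin n → ℕ} {B : LinearMap.BilinForm ℂ (Fin d → ℂ)}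
  (hB : B.Nondegenerate)

theorem orthogonal_anti {F F' : Submodule ℂ (Fin d → ℂ)} (h : F ≤ F') :
    B.orthogonal F' ≤ B.orthogonal F := fun _ hu t ht => hu t (h ht)

include hB in
theorem orthogonal_top : B.orthogonal ⊤ = ⊥ := by
  rw [eq_bot_iff]
  exact fun u hu => hB.2 u fun t => hu t trivial

theorem orthogonal_bot : B.orthogonal ⊥ = ⊤ := by
  rw [eq_top_iff]
  rintro u - t ht
  rw [(Submodule.mem_bot ℂ).1 ht]
  simp

/-- Passing to adjoints turns x(F_i) ⊆ F_{i+1} into x^*(F_{i+1}^⊥) ⊆ F_i^⊥, which is the same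
condition after the reversal of indices. -/
theorem perpFlag_mem {x : Module.End ℂ (Fin d → ℂ)} {F : Fin (n + 2) → Submodule ℂ (Fin d → ℂ)}
    (h : (x, F) ∈ cotangentFlags v d) (hd : ∀ i, v' i + v i.rev = d) :
    (-rightAdjoint B hB B x, perpFlag B F) ∈ cotangentFlags v' d := by
  obtain ⟨h0, h1, h2, h3, h4⟩ := (mem_cotangentFlags_iff x F).1 h
  refine (mem_cotangentFlags_iff _ _).2 ⟨?_, ?_, fun i => ?_, fun i => ?_, fun i => ?_⟩
  · rw [perpFlag, Fin.rev_zero, h1, orthogonal_bot]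
  · rw [perpFlag, Fin.rev_last, h0, orthogonal_top hB]
  · rw [perpFlag, perpFlag, Fin.rev_succ, Fin.rev_castSucc]
    exact orthogonal_anti (h2 _)
  · rw [perpFlag, LinearMap.BilinForm.finrank_orthogonal hB, Fin.rev_castSucc, Fin.rev_succ,
      Fin.succ_castSucc, h3]
    have := hd i
    simp only [Module.finrank_fintype_fun_eq_card, Fintype.card_fin]
    omega
  · rw [perpFlag, perpFlag, Fin.rev_succ, Fin.rev_castSucc]
    rintro _ ⟨u, hu, rfl⟩ t ht
    have := hu _ (h4 i.rev ⟨t, ht, rfl⟩)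
    rw [LinearMap.neg_apply, map_neg, ← rightAdjoint_spec B hB B x, this, neg_zero]

include hB in
theorem flagOfFrames_eq_perpFlag {f : ∀ i : Fin n, (Fin (v i) → ℂ) →ₗ[ℂ] (Fin d → ℂ)}
    {f' : ∀ i : Fin n, (Fin (v' i) → ℂ) →ₗ[ℂ] (Fin d → ℂ)}
    (h : ∀ i, LinearMap.range (f' i) = B.orthogonal (LinearMap.range (f i.rev))) :
    flagOfFrames f' = perpFlag B (flagOfFrames f) := by
  funext ⟨i, hi⟩
  rcases i with _ | i
  · change ⊤ = B.orthogonal (flagOfFrames f (Fin.rev 0))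
    rw [Fin.rev_zero]
    erw [flagOfFrames_last]
    rw [orthogonal_bot]
  · rcases Nat.lt_or_ge i n with h' | h'
    · rw [flagOfFrames_succ f' i h', h, perpFlag]
      have : (⟨i + 1, hi⟩ : Fin (n + 2)).rev = ⟨n - (i + 1) + 1, by omega⟩ := by
        ext
        simp only [Fin.val_rev]
        omega
      rw [this, flagOfFrames_succ f _ (by omega)]
      rfl
    · obtain rfl : i = n := by omega
      rw [flagOfFrames_last, perpFlag]
      have : (⟨i + 1, hi⟩ : Fin (i + 2)).rev = ⟨0, by omega⟩ := by
        ext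
        simp only [Fin.val_rev]
        omega
      rw [this, flagOfFrames_zero, orthogonal_top hB]

/-- The bijection `(x, F) ↦ (-x^*, F^⊥)`. -/
def perpEquiv (hd : ∀ i, v' i + v i.rev = d) : cotangentFlags v d ≃ cotangentFlags v' d where
  toFun z := ⟨(-rightAdjoint B hB B z.1.1, perpFlag B z.1.2), perpFlag_mem hB z.2 hd⟩
  invFun z := ⟨(-rightAdjoint B.flip hB.flip B.flip z.1.1, perpFlag B.flip z.1.2),
    perpFlag_mem hB.flip z.2 fun i => by rw [add_comm, ← hd i.rev, Fin.rev_rev]⟩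
  left_inv z := by
    refine Subtype.ext (Prod.ext ?_ (funext fun i => ?_))
    · simp only [rightAdjoint_neg, neg_neg, rightAdjoint_flip_rightAdjoint]
    · simp only [perpFlag, Fin.rev_rev]
      exact orthogonal_flip_orthogonal hB _
  right_inv z := by
    refine Subtype.ext (Prod.ext ?_ (funext fun i => ?_))
    · simp only [rightAdjoint_neg, neg_neg]
      exact rightAdjoint_flip_rightAdjoint hB.flip _
    · simp only [perpFlag, Fin.rev_rev]
      exact orthogonal_flip_orthogonal hB.flip _

variable (B) in
/-- The equations of the orthogonal space of the image of a frame. -/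
def perpEqn (k : ℕ) : ((Fin k → ℂ) →ₗ[ℂ] (Fin d → ℂ)) →ₗ[ℂ] (Fin d → ℂ) →ₗ[ℂ] (Fin k → ℂ) where
  toFun f := LinearMap.pi fun a => B (f (Pi.single a 1))
  map_add' f f' := by ext; simp
  map_smul' c f := by ext; simp

theorem ker_perpEqn {k : ℕ} (f : (Fin k → ℂ) →ₗ[ℂ] (Fin d → ℂ)) :
    LinearMap.ker (perpEqn B k f) = B.orthogonal (LinearMap.range f) := by
  ext u
  rw [LinearMap.mem_ker, LinearMap.BilinForm.mem_orthogonal_iff]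
  constructor
  · rintro h _ ⟨t, rfl⟩
    have h2 : B.flip u ∘ₗ f = 0 := LinearMap.pi_ext' fun a => LinearMap.ext_ring (congrFun h a)
    exact LinearMap.congr_fun h2 t
  · exact fun h => funext fun a => h _ ⟨_, rfl⟩

include hB in
theorem perpEqn_surjective {k : ℕ} {f : (Fin k → ℂ) →ₗ[ℂ] (Fin d → ℂ)}
    (hf : Function.Injective f) : Function.Surjective (perpEqn B k f) := by
  rw [← LinearMap.range_eq_top]
  refine Submodule.eq_top_of_finrank_eq ?_
  have h1 := LinearMap.finrank_range_add_finrank_ker (perpEqn B k f)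
  rw [ker_perpEqn, LinearMap.BilinForm.finrank_orthogonal hB, LinearMap.finrank_range_of_inj hf] at h1
  have h2 := LinearMap.finrank_le_finrank_of_injective hf
  omega

variable (B) in
/-- A frame of the orthogonal space of the image of the frame `f`, for `f` near a given frame. -/
def perpFrame {k k' : ℕ} (ρ : (Fin k → ℂ) →ₗ[ℂ] (Fin d → ℂ)) (κ : (Fin k' → ℂ) →ₗ[ℂ] (Fin d → ℂ))
    (f : (Fin k → ℂ) →ₗ[ℂ] (Fin d → ℂ)) : (Fin k' → ℂ) →ₗ[ℂ] (Fin d → ℂ) :=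
  κ - ρ ∘ₗ endInv (perpEqn B k f ∘ₗ ρ) ∘ₗ perpEqn B k f ∘ₗ κ

theorem RegAt.perpFrame {E : Type*} [AddCommGroup E] [Module ℂ E] {e : E} {k k' : ℕ}
    (ρ : (Fin k → ℂ) →ₗ[ℂ] (Fin d → ℂ)) (κ : (Fin k' → ℂ) →ₗ[ℂ] (Fin d → ℂ))
    {f : E → (Fin k → ℂ) →ₗ[ℂ] (Fin d → ℂ)} (hf : RegAt e f)
    (hdet : LinearMap.det (perpEqn B k (f e) ∘ₗ ρ) ≠ 0) :
    RegAt e fun y => perpFrame B ρ κ (f y) := by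
  have h1 : RegAt e fun y => perpEqn B k (f y) := hf.linear (perpEqn B k)
  exact (RegAt.const e κ).sub ((RegAt.const e ρ).comp
    (((h1.comp (RegAt.const e ρ)).endInv hdet).comp (h1.comp (RegAt.const e κ))))

include hB in
-- Let E_f be the equations of the orthogonal space. Here `ρ` is a section of E_{f₀} and `κ` a frame
-- of its kernel; `perpFrame` projects `κ` to ker E_f along im `ρ`. It stays injective because im
-- `ρ` meets ker E_{f₀} only in 0, and a dimension count identifies its image.
theorem exists_perpFrame {k k' : ℕ} (hk : k' + k = d) {f₀ : (Fin k → ℂ) →ₗ[ℂ] (Fin d → ℂ)}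
    (hf₀ : Function.Injective f₀) :
    ∃ (ρ : (Fin k → ℂ) →ₗ[ℂ] (Fin d → ℂ)) (κ : (Fin k' → ℂ) →ₗ[ℂ] (Fin d → ℂ)),
      LinearMap.det (perpEqn B k f₀ ∘ₗ ρ) ≠ 0 ∧
      ∀ f : (Fin k → ℂ) →ₗ[ℂ] (Fin d → ℂ), Function.Injective f →
        LinearMap.det (perpEqn B k f ∘ₗ ρ) ≠ 0 →
        Function.Injective (perpFrame B ρ κ f) ∧
        LinearMap.range (perpFrame B ρ κ f) = B.orthogonal (LinearMap.range f) := by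
  obtain ⟨ρ, hρ⟩ := (perpEqn B k f₀).exists_rightInverse_of_surjective
    (LinearMap.range_eq_top.2 (perpEqn_surjective hB hf₀))
  have hrank : ∀ f : (Fin k → ℂ) →ₗ[ℂ] (Fin d → ℂ), Function.Injective f →
      Module.finrank ℂ (B.orthogonal (LinearMap.range f)) = k' := fun f hf => by
    rw [LinearMap.BilinForm.finrank_orthogonal hB, LinearMap.finrank_range_of_inj hf]
    simp only [Module.finrank_fintype_fun_eq_card, Fintype.card_fin]
    omega
  let e : (Fin k' → ℂ) ≃ₗ[ℂ] B.orthogonal (LinearMap.range f₀) :=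
    LinearEquiv.ofFinrankEq _ _ (by rw [hrank f₀ hf₀]; simp)
  have he : ∀ t, perpEqn B k f₀ (e t) = 0 := fun t => by
    rw [← LinearMap.mem_ker, ker_perpEqn]
    exact (e t).2
  refine ⟨ρ, (B.orthogonal (LinearMap.range f₀)).subtype ∘ₗ e.toLinearMap, ?_, fun f hf hdet => ?_⟩
  · rw [hρ, LinearMap.det_id]
    exact one_ne_zero
  set κ := (B.orthogonal (LinearMap.range f₀)).subtype ∘ₗ e.toLinearMap
  have hinj : Function.Injective (perpFrame B ρ κ f) := by
    rw [injective_iff_map_eq_zero]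
    intro t ht
    have h1 : κ t = ρ (endInv (perpEqn B k f ∘ₗ ρ) (perpEqn B k f (κ t))) := sub_eq_zero.1 ht
    have h2 : endInv (perpEqn B k f ∘ₗ ρ) (perpEqn B k f (κ t)) = 0 := by
      have h3 := congrArg (perpEqn B k f₀) h1
      rw [show perpEqn B k f₀ (κ t) = 0 from he t] at h3
      exact (h3.trans (LinearMap.congr_fun hρ _)).symm
    rw [h2, map_zero] at h1
    have h4 : e t = 0 := Subtype.ext h1
    simpa using h4
  refine ⟨hinj, Submodule.eq_of_le_of_finrank_eq ?_ ?_⟩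
  · rw [← ker_perpEqn]
    rintro _ ⟨t, rfl⟩
    change perpEqn B k f (κ t - ρ (endInv (perpEqn B k f ∘ₗ ρ) (perpEqn B k f (κ t)))) = 0
    rw [map_sub, sub_eq_zero]
    exact (LinearMap.congr_fun (comp_endInv hdet) _).symm
  · rw [LinearMap.finrank_range_of_inj hinj, hrank f hf]
    simp

theorem isMorphism_perp (hd : ∀ i, v' i + v i.rev = d) :
    IsMorphism (cotangentVariety v d) (cotangentVariety v' d) (perpEquiv hB hd) := by
  refine isMorphism_quotient fun z => ?_
  choose ρ κ hdet hρκ using fun i => exists_perpFrame hB (hd i) (z.2.1 i.rev)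
  let adj : Module.End ℂ (Fin d → ℂ) →ₗ[ℂ] Module.End ℂ (Fin d → ℂ) :=
    ⟨⟨rightAdjoint B hB B, rightAdjoint_add hB B⟩, rightAdjoint_smul hB B⟩
  refine ⟨∏ i, fun y => LinearMap.det (perpEqn B _ (frameProj v d i.rev y) ∘ₗ ρ i),
    prod_mem fun i _ => det_comp_mem_polyFun
      (((LinearMap.llcomp ℂ _ _ _).flip (ρ i) ∘ₗ perpEqn B _) ∘ₗ frameProj v d i.rev), ?_,
    fun y => (-adj y.1, fun i => perpFrame B (ρ i) (κ i) (frameProj v d i.rev y)), ?_, ?_⟩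
  · rw [Finset.prod_apply]
    exact Finset.prod_ne_zero_iff.2 fun i _ => hdet i
  · refine RegAt.prodMk (RegAt.neg ?_) (RegAt.pi fun i =>
      RegAt.perpFrame _ _ (regAt_linearMap _ (frameProj v d i.rev)) (hdet i))
    exact RegAt.linear (regAt_linearMap _ (LinearMap.fst ℂ (Module.End ℂ (Fin d → ℂ))
      (∀ i : Fin n, (Fin (v i) → ℂ) →ₗ[ℂ] (Fin d → ℂ)))) adj
  · intro y hy
    rw [Finset.prod_apply, Finset.prod_ne_zero_iff] at hy
    have hf := fun i => hρκ i (y.1.2 i.rev) (y.2.1 _) (hy i (Finset.mem_univ i))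
    have hflag := flagOfFrames_eq_perpFlag hB fun i => (hf i).2
    have hpt : (-adj y.1.1, flagOfFrames fun i => perpFrame B (ρ i) (κ i) (y.1.2 i.rev)) =
        (perpEquiv hB hd (forgetFrames v d y)).1 := Prod.ext rfl hflag
    refine ⟨⟨fun i => (hf i).1, ?_⟩, Subtype.ext hpt⟩
    change (-adj y.1.1, flagOfFrames fun i => perpFrame B (ρ i) (κ i) (y.1.2 i.rev)) ∈ _
    rw [hpt]
    exact (perpEquiv hB hd (forgetFrames v d y)).2

/-- The isomorphism `σ₁ : (x, F) ↦ (-x^*, F^⊥)`. -/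
def perpIso (hd : ∀ i, v' i + v i.rev = d) :
    VarietyIso (cotangentVariety v d) (cotangentVariety v' d) :=
  .ofMorphisms (perpEquiv hB hd) (isMorphism_perp hB hd)
    (isMorphism_perp hB.flip fun i => by rw [add_comm, ← hd i.rev, Fin.rev_rev])

end OrthogonalFlag

/-! ## Existence of reflections -/

section LinearAlgebra

variable {U V V' : Type*} [AddCommGroup U] [Module ℂ U] [FiniteDimensional ℂ U] [AddCommGroup V]
  [Module ℂ V] [FiniteDimensional ℂ V] [AddCommGroup V'] [Module ℂ V'] [FiniteDimensional ℂ V']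
  {a : V →ₗ[ℂ] U} {b : U →ₗ[ℂ] V} {a' : V' →ₗ[ℂ] U} {b' : U →ₗ[ℂ] V'}

theorem finrank_map_add_finrank_inf_ker (b : U →ₗ[ℂ] V) (N : Submodule ℂ U) :
    Module.finrank ℂ (N.map b) + Module.finrank ℂ (N ⊓ LinearMap.ker b : Submodule ℂ U) =
      Module.finrank ℂ N := by
  have h := LinearMap.finrank_range_add_finrank_ker (b.domRestrict N)
  rw [LinearMap.range_domRestrict, LinearMap.ker_domRestrict] at h
  rw [← h, ← Submodule.finrank_map_subtype_eq N ((LinearMap.ker b).comap _), Submodule.map_comap_subtype]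

theorem finrank_map_of_injective (ha : Function.Injective a) (S : Submodule ℂ V) :
    Module.finrank ℂ (S.map a) = Module.finrank ℂ S :=
  (LinearEquiv.finrank_eq (Submodule.equivMapOfInjective a ha S)).symm

/-- Takes S = b(N), the smallest choice allowed. The bound holds because a'(S') lies in N ∩ ker b.
-/
theorem exists_subspace_of_ker_eq_range (hab : ∀ u, a (b u) = a' (b' u))
    (ha' : Function.Injective a') (hker : ∀ u, b u = 0 ↔ ∃ t, a' t = u) {N : Submodule ℂ U}
    {S' : Submodule ℂ V'} (hS' : S'.map a' ≤ N) (hN : N.map b' ≤ S') :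
    ∃ S : Submodule ℂ V, S.map a ≤ N ∧ N.map b ≤ S ∧
      Module.finrank ℂ S + Module.finrank ℂ S' ≤ Module.finrank ℂ N := by
  refine ⟨N.map b, ?_, le_rfl, ?_⟩
  · rintro _ ⟨_, ⟨u, hu, rfl⟩, rfl⟩
    rw [hab]
    exact hS' ⟨_, hN ⟨u, hu, rfl⟩, rfl⟩
  · rw [← finrank_map_add_finrank_inf_ker b N, ← finrank_map_of_injective ha' S']
    refine Nat.add_le_add_left (Submodule.finrank_mono (le_inf hS' ?_)) _
    rintro _ ⟨t, -, rfl⟩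
    exact (hker _).2 ⟨t, rfl⟩

/-- Takes S = a⁻¹(N), the largest choice allowed. The opposite bound holds because N ∩ ker b'
consists of elements of a(S), while b'(N) lies in S'. -/
theorem exists_subspace_of_range_eq_ker (hab : ∀ u, a (b u) = a' (b' u))
    (ha : Function.Injective a) (hker : ∀ u, b' u = 0 ↔ ∃ t, a t = u) {N : Submodule ℂ U}
    {S' : Submodule ℂ V'} (hS' : S'.map a' ≤ N) (hN : N.map b' ≤ S') :
    ∃ S : Submodule ℂ V, S.map a ≤ N ∧ N.map b ≤ S ∧
      Module.finrank ℂ N ≤ Module.finrank ℂ S + Module.finrank ℂ S' := by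
  refine ⟨N.comap a, Submodule.map_comap_le _ _, ?_, ?_⟩
  · rintro _ ⟨u, hu, rfl⟩
    rw [Submodule.mem_comap, hab]
    exact hS' ⟨_, hN ⟨u, hu, rfl⟩, rfl⟩
  · rw [← finrank_map_add_finrank_inf_ker b' N, add_comm]
    refine Nat.add_le_add ?_ (Submodule.finrank_mono hN)
    rw [← finrank_map_of_injective ha]
    refine Submodule.finrank_mono ?_
    rintro u ⟨hu, hu0⟩
    obtain ⟨t, rfl⟩ := (hker u).1 hu0
    exact ⟨t, hu, rfl⟩

end LinearAlgebra

/-- Hides the dependent case distinction: families modified at one vertex are used only through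
these two equations. -/
theorem exists_eq_of_ne {I : Type*} {α : I → Type*} (i : I) (x : α i) (g : ∀ j, j ≠ i → α j) :
    ∃ f : ∀ j, α j, f i = x ∧ ∀ j h, f j = g j h := by
  classical
  refine ⟨fun j => if h : j = i then by subst h; exact x else g j h, ?_, fun j h => ?_⟩
  · simp
  · simp [h]

theorem finrank_prod_pi {I : Type*} [Fintype I] {w : ℕ} {v : I → ℕ} (W₀ : Submodule ℂ (Fin w → ℂ))
    (S : ∀ j : I, Submodule ℂ (Fin (v j) → ℂ)) :
    Module.finrank ℂ (W₀.prod (Submodule.pi Set.univ S)) =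
      Module.finrank ℂ W₀ + ∑ j, Module.finrank ℂ (S j) := by
  have h : W₀.prod (Submodule.pi Set.univ S) =
      LinearMap.range (W₀.subtype.prodMap (LinearMap.piMap fun j => (S j).subtype)) := by
    ext ⟨u, t⟩
    simp only [Submodule.mem_prod, Submodule.mem_pi, Set.mem_univ, true_implies,
      LinearMap.mem_range]
    constructor
    · rintro ⟨hu, ht⟩
      exact ⟨(⟨u, hu⟩, fun j => ⟨t j, ht j⟩), rfl⟩
    · rintro ⟨⟨u', t'⟩, h⟩
      obtain ⟨rfl, rfl⟩ := Prod.mk.inj h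
      exact ⟨u'.2, fun j => (t' j).2⟩
  rw [h, LinearMap.finrank_range_of_inj, Module.finrank_prod, Module.finrank_pi_fintype]
  rintro ⟨u, t⟩ ⟨u', t'⟩ h
  obtain ⟨h1, h2⟩ := Prod.mk.inj h
  exact Prod.ext (Subtype.ext h1) (funext fun j => Subtype.ext (congrFun h2 j))

/-! ### Pairings with the Cartan matrix -/

section Cartan

variable {I : Type} [Fintype I] [DecidableEq I] (G : SimpleGraph I) [DecidableRel G.Adj]

theorem sum_neighborSet (i : I) (d : I → ℤ) :
    ∑ j : G.neighborSet i, d j = ∑ j, if G.Adj i j then d j else 0 := by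
  rw [← Finset.sum_filter]
  exact (Finset.sum_subtype _ (by simp) d).symm

theorem sum_cartan_mul (i : I) (d : I → ℤ) :
    ∑ j, cartan G i j * d j = 2 * d i - ∑ j : G.neighborSet i, d j := by
  simp only [cartan, sub_mul, Finset.sum_sub_distrib, ite_mul, zero_mul, one_mul,
    Finset.sum_ite_eq, Finset.mem_univ, if_true, sum_neighborSet]

theorem sum_simpleRefl_mul (i : I) (η d : I → ℤ) :
    ∑ j, simpleRefl G i η j * d j =
      ∑ j, η j * d j + η i * (∑ j : G.neighborSet i, d j - 2 * d i) := by
  have h : ∑ j, cartan G j i * d j = ∑ j, cartan G i j * d j :=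
    Finset.sum_congr rfl fun j _ => by simp only [cartan, eq_comm, G.adj_comm]
  have h2 : ∑ j, simpleRefl G i η j * d j = ∑ j, η j * d j - η i * ∑ j, cartan G j i * d j := by
    rw [Finset.mul_sum, ← Finset.sum_sub_distrib]
    refine Finset.sum_congr rfl fun j _ => ?_
    simp only [simpleRefl, Int.cast_id]
    ring
  rw [h2, h, sum_cartan_mul]
  ring

theorem simpleRefl_zero {R : Type} [CommRing R] (i : I) : simpleRefl G i (0 : I → R) = 0 := by
  funext j
  simp [simpleRefl]

theorem wordAct_zero {R : Type} [CommRing R] (l : List I) : wordAct G l (0 : I → R) = 0 := by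
  induction l with
  | nil => rfl
  | cons i l ih => rw [wordAct, List.foldr_cons, ← wordAct, ih, simpleRefl_zero]

theorem sum_mul_eq_of_eq_off (i : I) (η : I → ℤ) {d d' : I → ℤ} (h : ∀ j, j ≠ i → d j = d' j) :
    ∑ j, η j * d j = ∑ j, η j * d' j + η i * (d i - d' i) := by
  rw [← sub_eq_iff_eq_add', ← Finset.sum_sub_distrib, Finset.sum_eq_single i]
  · ring
  · intro j _ hj
    rw [h j hj, sub_self]
  · simp

end Cartan

/-! ### Changing a representation at one vertex -/

section Reflection

variable {I : Type} [Fintype I] [DecidableEq I] {G : SimpleGraph I} [DecidableRel G.Adj]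
  {v v' w : I → ℕ} {ε : I → I → ℤ}

namespace Rep

theorem bMap_apply (m : Rep G v w) (i : I) (u : USpace G v w i) :
    m.bMap ε i u = m.p i u.1 +
      ∑ j : G.neighborSet i, (ε i j : ℂ) • m.x (G.adj_symm j.2) (u.2 j) := by
  simp [bMap, LinearMap.sum_apply]

theorem bMap_inl (m : Rep G v w) (i : I) (u : Vec w i) : m.bMap ε i (u, 0) = m.p i u := by
  simp [bMap_apply]

theorem bMap_single (m : Rep G v w) (i : I) (j : G.neighborSet i) (t : Vec v j) :
    m.bMap ε i (0, Pi.single j t) = (ε i j : ℂ) • m.x (G.adj_symm j.2) t := by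
  rw [bMap_apply, map_zero, zero_add, Finset.sum_eq_single j]
  · change (ε i j : ℂ) • m.x _ ((Pi.single j t : ∀ k : G.neighborSet i, Vec v k) j) = _
    rw [Pi.single_eq_same]
  · intro k _ hk
    change (ε i k : ℂ) • m.x _ ((Pi.single j t : ∀ k : G.neighborSet i, Vec v k) k) = _
    rw [Pi.single_eq_of_ne hk, map_zero, smul_zero]
  · simp

/-- At parameter 0 this makes V_i → U_i → V_i a complex, which is why ker b_i and coker a_i can
carry the reflected structure. -/
theorem bMap_aMap (hε : ∀ i j, ε j i = -ε i j) (m : Rep G v w) (i : I) (t : Vec v i) :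
    m.bMap ε i (m.aMap i t) = -m.moment ε i t := by
  rw [bMap_apply]
  simp only [moment, LinearMap.sub_apply, LinearMap.sum_apply, LinearMap.smul_apply,
    LinearMap.comp_apply, neg_sub]
  rw [sub_eq_add_neg, ← Finset.sum_neg_distrib]
  congr 1
  refine Finset.sum_congr rfl fun j _ => ?_
  rw [hε i j, Int.cast_neg, neg_smul, neg_neg]
  rfl

theorem uEquiv_symm {i : I} (e : ∀ j, j ≠ i → (Vec v j ≃ₗ[ℂ] Vec v' j)) :
    (uEquiv (G := G) (w := w) i fun j h => (e j h).symm) = (uEquiv i e).symm := rfl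

theorem uEquiv_inl {i : I} (e : ∀ j, j ≠ i → (Vec v j ≃ₗ[ℂ] Vec v' j)) (u : Vec w i) :
    uEquiv (G := G) i e (u, 0) = (u, 0) := by
  refine Prod.ext rfl (funext fun j => ?_)
  exact map_zero (e j _)

theorem uEquiv_single {i : I} (e : ∀ j, j ≠ i → (Vec v j ≃ₗ[ℂ] Vec v' j)) (j : G.neighborSet i)
    (t : Vec v j) : uEquiv (G := G) (w := w) i e (0, Pi.single j t) =
      (0, Pi.single j (e j (G.ne_of_adj j.2).symm t)) := by
  refine Prod.ext rfl (funext fun k => ?_)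
  change e k _ ((Pi.single j t : ∀ k : G.neighborSet i, Vec v k) k) =
    (Pi.single j (e j (G.ne_of_adj j.2).symm t) : ∀ k : G.neighborSet i, Vec v' k) k
  by_cases h : k = j
  · subst h
    simp
  · rw [Pi.single_eq_of_ne h, Pi.single_eq_of_ne h, map_zero]

/-- The representations `m` and `m'` agree away from `i`. -/
def AgreeOff (i : I) (m : Rep G v w) (m' : Rep G v' w)
    (e : ∀ j, j ≠ i → (Vec v j ≃ₗ[ℂ] Vec v' j)) : Prop :=
  (∀ (j k : I) (hj : j ≠ i) (hk : k ≠ i) (h : G.Adj j k),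
    (e k hk).toLinearMap ∘ₗ m.x h = m'.x h ∘ₗ (e j hj).toLinearMap) ∧
  (∀ (j : I) (hj : j ≠ i), (e j hj).toLinearMap ∘ₗ m.p j = m'.p j) ∧
  (∀ (j : I) (hj : j ≠ i), m.q j = m'.q j ∘ₗ (e j hj).toLinearMap)

theorem AgreeOff.symm {i : I} {m : Rep G v w} {m' : Rep G v' w}
    {e : ∀ j, j ≠ i → (Vec v j ≃ₗ[ℂ] Vec v' j)} (h : AgreeOff i m m' e) :
    AgreeOff i m' m fun j hj => (e j hj).symm := by
  refine ⟨fun j k hj hk hjk => ?_, fun j hj => ?_, fun j hj => ?_⟩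
  · refine LinearMap.ext fun t => (e k hk).injective ?_
    simpa using (LinearMap.congr_fun (h.1 j k hj hk hjk) ((e j hj).symm t)).symm
  · rw [← h.2.1 j hj]
    exact LinearMap.ext fun t => by simp
  · rw [h.2.2 j hj]
    exact LinearMap.ext fun t => by simp

/-- All maps touching V_i are encoded by one map into U_i and one map out of it, so an arbitrary
pair may be prescribed. The sign put on the new arrows into `i` cancels the sign in `bMap`. The
equivalences `e` and `c` only absorb equalities of dimensions. -/
theorem exists_modification (hε : ∀ i j, G.Adj i j → ε i j * ε i j = 1) (m : Rep G v w) (i : I)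
    {N : ℕ} (a : (Fin N → ℂ) →ₗ[ℂ] USpace G v w i) (b : USpace G v w i →ₗ[ℂ] (Fin N → ℂ)) :
    ∃ (v' : I → ℕ) (m' : Rep G v' w) (e : ∀ j, j ≠ i → (Vec v j ≃ₗ[ℂ] Vec v' j))
      (c : (Fin N → ℂ) ≃ₗ[ℂ] Vec v' i), v' i = N ∧ (∀ j, j ≠ i → v' j = v j) ∧
      AgreeOff i m m' e ∧ (∀ t, m'.aMap i (c t) = uEquiv i e (a t)) ∧
      ∀ u, m'.bMap ε i (uEquiv i e u) = c (b u) := by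
  obtain ⟨v', hi, hj⟩ := exists_eq_of_ne (α := fun _ => ℕ) i N fun j _ => v j
  let e : ∀ j, j ≠ i → (Vec v j ≃ₗ[ℂ] Vec v' j) := fun j h =>
    LinearEquiv.funCongrLeft ℂ ℂ (finCongr (hj j h))
  let c : (Fin N → ℂ) ≃ₗ[ℂ] Vec v' i := LinearEquiv.funCongrLeft ℂ ℂ (finCongr hi)
  obtain ⟨p', hpi, hpj⟩ := exists_eq_of_ne (α := fun j => Vec w j →ₗ[ℂ] Vec v' j) i
    (c.toLinearMap ∘ₗ b ∘ₗ LinearMap.inl ℂ _ _) fun j h => (e j h).toLinearMap ∘ₗ m.p j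
  obtain ⟨q', hqi, hqj⟩ := exists_eq_of_ne (α := fun j => Vec v' j →ₗ[ℂ] Vec w j) i
    (LinearMap.fst ℂ _ _ ∘ₗ a ∘ₗ c.symm.toLinearMap) fun j h => m.q j ∘ₗ (e j h).symm.toLinearMap
  choose y hyi hyj using fun j (hj : j ≠ i) => exists_eq_of_ne
    (α := fun k => G.Adj j k → (Vec v' j →ₗ[ℂ] Vec v' k)) i
    (fun h => (ε i j : ℂ) • (c.toLinearMap ∘ₗ b ∘ₗ LinearMap.inr ℂ _ _ ∘ₗ
      LinearMap.single ℂ _ (⟨j, h.symm⟩ : G.neighborSet i) ∘ₗ (e j hj).symm.toLinearMap))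
    fun k hk h => (e k hk).toLinearMap ∘ₗ m.x h ∘ₗ (e j hj).symm.toLinearMap
  obtain ⟨x', hxi, hxj⟩ := exists_eq_of_ne
    (α := fun j => ∀ k, G.Adj j k → (Vec v' j →ₗ[ℂ] Vec v' k)) i
    (fun k h => (e k (G.ne_of_adj h).symm).toLinearMap ∘ₗ LinearMap.proj (⟨k, h⟩ : G.neighborSet i)
      ∘ₗ LinearMap.snd ℂ _ _ ∘ₗ a ∘ₗ c.symm.toLinearMap) y
  let m' : Rep G v' w := (fun h => x' h.fst h.snd h.adj, p', q')
  refine ⟨v', m', e, c, hi, hj, ⟨fun j k hj hk h => ?_, fun j hj => (hpj j hj).symm,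
    fun j hj => ?_⟩, fun t => Prod.ext ?_ (funext fun k => ?_), fun u => ?_⟩
  · change _ = x' j k h ∘ₗ _
    rw [hxj j hj, hyj j hj k hk]
    exact LinearMap.ext fun t => by simp
  · change _ = q' j ∘ₗ _
    rw [hqj j hj]
    exact LinearMap.ext fun t => by simp
  · change q' i (c t) = (a t).1
    rw [hqi]
    simp
  · change x' i k k.2 (c t) = e k (G.ne_of_adj k.2).symm ((a t).2 k)
    rw [hxi]
    simp
  · rw [bMap_apply]
    change p' i u.1 + ∑ j : G.neighborSet i, (ε i j : ℂ) • x' j i _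
      (e j (G.ne_of_adj j.2).symm (u.2 j)) = _
    have h1 : ∀ j : G.neighborSet i, (ε i j : ℂ) • x' j i (G.adj_symm j.2)
        (e j (G.ne_of_adj j.2).symm (u.2 j)) = c (b (0, Pi.single j (u.2 j))) := by
      intro j
      rw [hxj j (G.ne_of_adj j.2).symm, hyi, LinearMap.smul_apply, smul_smul, ← Int.cast_mul,
        hε i j j.2, Int.cast_one, one_smul]
      simp
    rw [Finset.sum_congr rfl fun j _ => h1 j, hpi, ← map_sum, ← map_sum]
    change c (b (u.1, 0)) + _ = _
    rw [← map_add, ← map_add]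
    congr 2
    refine Prod.ext ?_ ?_
    · simp [Prod.fst_sum]
    · rw [Prod.snd_add, Prod.snd_sum, zero_add]
      exact LinearMap.sum_single_apply _ u.2

variable {i : I} {m : Rep G v w} {m' : Rep G v' w} {e : ∀ j, j ≠ i → (Vec v j ≃ₗ[ℂ] Vec v' j)}

/-- One matrix entry of a b = a' b'; the sign of the incoming arrow squares to 1 and drops out. -/
theorem forward_eq_of_sub_eq_zero (hε : ∀ i j, G.Adj i j → ε i j * ε i j = 1)
    (hab : ∀ u, uEquiv i e (m.aMap i (m.bMap ε i u)) = m'.aMap i (m'.bMap ε i (uEquiv i e u)))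
    {j k : I} (hj : G.Adj i j) (hk : G.Adj i k) (t : Vec v j) :
    e k (G.ne_of_adj hk).symm (m.x hk (m.x (G.adj_symm hj) t)) =
      m'.x hk (m'.x (G.adj_symm hj) (e j (G.ne_of_adj hj).symm t)) := by
  have h := congrFun (congrArg Prod.snd (hab (0, Pi.single ⟨j, hj⟩ t))) ⟨k, hk⟩
  rw [uEquiv_single, bMap_single, bMap_single, map_smul, map_smul, map_smul] at h
  change (ε i j : ℂ) • e k (G.ne_of_adj hk).symm (m.x hk (m.x (G.adj_symm hj) t)) =
      (ε i j : ℂ) • m'.x hk (m'.x (G.adj_symm hj) (e j (G.ne_of_adj hj).symm t)) at h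
  have h2 := congrArg (fun z => (ε i j : ℂ) • z) h
  simp only [smul_smul, ← Int.cast_mul, hε i j hj, Int.cast_one, one_smul] at h2
  exact h2

/-- The only terms of the moment map at `j` that involve V_i are the round trips j → i → j, and
these are entries of a b. -/
theorem AgreeOff.moment (hε : ∀ i j, G.Adj i j → ε i j * ε i j = 1) (h : AgreeOff i m m' e)
    (hab : ∀ u, uEquiv i e (m.aMap i (m.bMap ε i u)) = m'.aMap i (m'.bMap ε i (uEquiv i e u)))
    {j : I} (hj : j ≠ i) (t : Vec v j) :
    m'.moment ε j (e j hj t) = e j hj (m.moment ε j t) := by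
  simp only [Rep.moment, LinearMap.sub_apply, LinearMap.sum_apply, LinearMap.smul_apply,
    LinearMap.comp_apply, map_sub, map_sum, map_smul]
  congr 1
  · refine Finset.sum_congr rfl fun k _ => ?_
    congr 1
    obtain ⟨k, hk⟩ := k
    by_cases hki : k = i
    · subst hki
      exact (forward_eq_of_sub_eq_zero hε hab (G.adj_symm hk) (G.adj_symm hk) t).symm
    · have h1 := LinearMap.congr_fun (h.1 j k hj hki hk) t
      have h2 := LinearMap.congr_fun (h.1 k j hki hj (G.adj_symm hk)) (m.x hk t)
      simp only [LinearMap.comp_apply, LinearEquiv.coe_coe] at h1 h2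
      rw [h2, h1]
  · rw [← h.2.1 j hj, h.2.2 j hj]
    rfl

/-- The two hypotheses on `S` are exactly invariance under the arrows leaving and entering `i`. -/
theorem AgreeOff.exists_invariant (hε : ∀ i j, G.Adj i j → ε i j * ε i j = 1)
    (h : AgreeOff i m m' e) {T' : ∀ j, Submodule ℂ (Vec v' j)}
    (hT' : ∀ (j k : I) (h : G.Adj j k), (T' j).map (m'.x h) ≤ T' k) {W₀ : Submodule ℂ (Vec w i)}
    {S : Submodule ℂ (Vec v i)}
    (ha : S.map ((uEquiv i e).toLinearMap ∘ₗ m.aMap i) ≤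
      W₀.prod (Submodule.pi Set.univ fun j : G.neighborSet i => T' j))
    (hb : (W₀.prod (Submodule.pi Set.univ fun j : G.neighborSet i => T' j)).map
      (m.bMap ε i ∘ₗ (uEquiv i e).symm.toLinearMap) ≤ S) :
    ∃ T : ∀ j, Submodule ℂ (Vec v j), T i = S ∧ (∀ j hj, T j = (T' j).comap (e j hj).toLinearMap) ∧
      ∀ (j k : I) (h : G.Adj j k), (T j).map (m.x h) ≤ T k := by
  obtain ⟨T, hTi, hTj⟩ := exists_eq_of_ne (α := fun j => Submodule ℂ (Vec v j)) i S
    fun j hj => (T' j).comap (e j hj).toLinearMap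
  refine ⟨T, hTi, hTj, fun j k hjk => ?_⟩
  rintro _ ⟨t, ht, rfl⟩
  by_cases hj : j = i
  · subst hj
    rw [hTi] at ht
    rw [hTj k (G.ne_of_adj hjk).symm]
    exact (ha ⟨t, ht, rfl⟩).2 ⟨k, hjk⟩ trivial
  · rw [hTj j hj] at ht
    by_cases hk : k = i
    · subst hk
      rw [hTi]
      have h1 : m.bMap ε k (0, Pi.single ⟨j, G.adj_symm hjk⟩ t) ∈ S := by
        refine hb ⟨uEquiv k e (0, Pi.single ⟨j, G.adj_symm hjk⟩ t), ?_, by simp⟩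
        rw [uEquiv_single]
        refine ⟨W₀.zero_mem, fun l _ => ?_⟩
        by_cases hl : l = ⟨j, G.adj_symm hjk⟩
        · subst hl
          exact Set.mem_of_eq_of_mem
            (Pi.single_eq_same (M := fun k : G.neighborSet _ => Vec v' k) _ _) ht
        · exact Set.mem_of_eq_of_mem
            (Pi.single_eq_of_ne (M := fun k : G.neighborSet _ => Vec v' k) hl _) (zero_mem _)
      rw [bMap_single] at h1
      have h2 := S.smul_mem (ε k j : ℂ) h1
      rwa [smul_smul, ← Int.cast_mul, hε k j (G.adj_symm hjk), Int.cast_one, one_smul] at h2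
    · rw [hTj k hk]
      have := LinearMap.congr_fun (h.1 j k hj hk hjk) t
      rw [Submodule.mem_comap]
      exact Set.mem_of_eq_of_mem this (hT' j k hjk ⟨_, ht, rfl⟩)

/-- A test subspace for `m'` is turned into one for `m` by changing it only at `i`. With N the part
of U_i cut out by `W₀` and the neighbours, the difference of the two sides of the inequality in
`key` is η_i (dim S + dim S' - dim N), which `hdim` makes nonnegative. -/
theorem AgreeOff.isSemistable (hε : ∀ i j, G.Adj i j → ε i j * ε i j = 1)
    (h : AgreeOff i m m' e) {η : I → ℤ} (hm : m.IsSemistable η)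
    (hv : ∀ j, j ≠ i → v' j = v j)
    (hvi : (v' i : ℤ) = w i + ∑ j : G.neighborSet i, (v j : ℤ) - v i)
    (hdim : ∀ (N : Submodule ℂ (USpace G v' w i)) (S' : Submodule ℂ (Vec v' i)),
      S'.map (m'.aMap i) ≤ N → N.map (m'.bMap ε i) ≤ S' → ∃ S : Submodule ℂ (Vec v i),
        S.map ((uEquiv i e).toLinearMap ∘ₗ m.aMap i) ≤ N ∧
        N.map (m.bMap ε i ∘ₗ (uEquiv i e).symm.toLinearMap) ≤ S ∧
        0 ≤ η i * ((Module.finrank ℂ S : ℤ) + Module.finrank ℂ S' - Module.finrank ℂ N)) :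
    m'.IsSemistable (simpleRefl G i η) := by
  -- Both semistability conditions are treated at once: `W₀` is 0 for the first and all of W_i for
  -- the second.
  have key : ∀ (T' : ∀ j, Submodule ℂ (Vec v' j)) (W₀ : Submodule ℂ (Vec w i)),
      (∀ (j k : I) (h : G.Adj j k), (T' j).map (m'.x h) ≤ T' k) →
      (T' i).map (m'.q i) ≤ W₀ → W₀.map (m'.p i) ≤ T' i →
      ∃ T : ∀ j, Submodule ℂ (Vec v j), (∀ j hj, T j = (T' j).comap (e j hj).toLinearMap) ∧
      (∀ (j k : I) (h : G.Adj j k), (T j).map (m.x h) ≤ T k) ∧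
      (T i).map (m.q i) ≤ W₀ ∧ W₀.map (m.p i) ≤ T i ∧
      ∑ j, simpleRefl G i η j * (Module.finrank ℂ (T' j) : ℤ) + η i * Module.finrank ℂ W₀ ≤
        ∑ j, η j * (Module.finrank ℂ (T j) : ℤ) := by
    intro T' W₀ hT' hq hp
    obtain ⟨S, hSa, hSb, hS⟩ := hdim
      (W₀.prod (Submodule.pi Set.univ fun j : G.neighborSet i => T' j)) (T' i) (by
        rintro _ ⟨t, ht, rfl⟩
        exact ⟨hq ⟨t, ht, rfl⟩, fun j _ => hT' i j j.2 ⟨t, ht, rfl⟩⟩) (by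
        rintro _ ⟨u, hu, rfl⟩
        rw [bMap_apply]
        exact add_mem (hp ⟨_, hu.1, rfl⟩) (sum_mem fun j _ => Submodule.smul_mem _ _
          (hT' j i (G.adj_symm j.2) ⟨_, hu.2 j trivial, rfl⟩)))
    obtain ⟨T, hTi, hTj, hT⟩ := h.exists_invariant hε hT' hSa hSb
    refine ⟨T, hTj, hT, ?_, ?_, ?_⟩
    · rintro _ ⟨t, ht, rfl⟩
      rw [hTi] at ht
      exact (hSa ⟨t, ht, rfl⟩).1
    · rintro _ ⟨u, hu, rfl⟩
      rw [hTi]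
      refine hSb ⟨uEquiv i e (u, 0), ?_, ?_⟩
      · rw [uEquiv_inl]
        exact ⟨hu, fun j _ => Submodule.zero_mem _⟩
      · simp [bMap_inl]
    · have hfin := finrank_prod_pi W₀ fun j : G.neighborSet i => T' j
      rw [sum_simpleRefl_mul, sum_mul_eq_of_eq_off i η (d := fun j => (Module.finrank ℂ (T j) : ℤ))
        (d' := fun j => (Module.finrank ℂ (T' j) : ℤ)) (fun j hj => by
          rw [hTj j hj, ← finrank_map_of_injective (a := (e j hj).toLinearMap) (e j hj).injective,
            Submodule.map_comap_eq_of_surjective (e j hj).surjective]), hTi]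
      have hfin' : (Module.finrank ℂ (W₀.prod (Submodule.pi Set.univ
          fun j : G.neighborSet i => T' j)) : ℤ) =
          Module.finrank ℂ W₀ + ∑ j : G.neighborSet i, (Module.finrank ℂ (T' j) : ℤ) := by
        rw [hfin]
        push_cast
        rfl
      rw [hfin'] at hS
      linarith
  constructor
  · intro S' hS' hker
    obtain ⟨T, hTj, hT, hq, -, hsum⟩ := key S' ⊥ hS' (by
      rintro _ ⟨t, ht, rfl⟩
      exact (Submodule.mem_bot ℂ).2 (hker i ht)) (by simp)
    rw [finrank_bot, Nat.cast_zero, mul_zero, add_zero] at hsum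
    refine hsum.trans (hm.1 T hT fun j => ?_)
    by_cases hj : j = i
    · subst hj
      exact fun t ht => (Submodule.mem_bot ℂ).1 (hq ⟨t, ht, rfl⟩)
    · rw [hTj j hj]
      intro t ht
      rw [LinearMap.mem_ker, h.2.2 j hj]
      exact hker j ht
  · intro T' hT' hrange
    obtain ⟨T, hTj, hT, -, hp, hsum⟩ := key T' ⊤ hT' le_top (by
      rw [← LinearMap.range_eq_map]
      exact hrange i)
    have h1 := hm.2 T hT fun j => by
      by_cases hj : j = i
      · subst hj
        rwa [LinearMap.range_eq_map]
      · rw [hTj j hj]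
        rintro _ ⟨u, rfl⟩
        have := LinearMap.congr_fun (h.2.1 j hj) u
        rw [Submodule.mem_comap]
        exact Set.mem_of_eq_of_mem this (hrange j ⟨u, rfl⟩)
    have h2 := sum_mul_eq_of_eq_off i η (d := fun j => (v' j : ℤ)) (d' := fun j => (v j : ℤ))
      fun j hj => by rw [hv j hj]
    have h3 : ∑ j : G.neighborSet i, (v' j : ℤ) = ∑ j : G.neighborSet i, (v j : ℤ) :=
      Finset.sum_congr rfl fun j _ => by rw [hv j (G.ne_of_adj j.2).symm]
    rw [sum_simpleRefl_mul G i η fun j => (v' j : ℤ), h2, h3, hvi]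
    rw [finrank_top, Module.finrank_fintype_fun_eq_card, Fintype.card_fin] at hsum
    linarith

end Rep

end Reflection

/-! ### Construction of reflections of semistable points -/

section ReflectionExistence

variable {I : Type} [Fintype I] [DecidableEq I] {G : SimpleGraph I} [DecidableRel G.Adj]
  {v v' w : I → ℕ} {ε : I → I → ℤ}

namespace Rep

variable {m : Rep G v w} {i : I} {η : I → ℤ}

/-- The test subspace is im b_i at `i` and everything elsewhere; as η_i is negative, the inequality
bounds the dimension of im b_i from below. -/
theorem range_bMap_of_semistable (hε : ∀ i j, G.Adj i j → ε i j * ε i j = 1)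
    (hm : m.IsSemistable η) (hη : η i < 0) : LinearMap.range (m.bMap ε i) = ⊤ := by
  obtain ⟨T, hTi, hTj⟩ := exists_eq_of_ne (α := fun j => Submodule ℂ (Vec v j)) i
    (LinearMap.range (m.bMap ε i)) fun _ _ => ⊤
  have h := hm.2 T (fun j k hjk => by
    by_cases hk : k = i
    · subst hk
      rw [hTi]
      rintro _ ⟨t, -, rfl⟩
      refine ⟨(ε k j : ℂ) • (0, Pi.single ⟨j, G.adj_symm hjk⟩ t), ?_⟩
      rw [map_smul, bMap_single, smul_smul, ← Int.cast_mul, hε k j (G.adj_symm hjk), Int.cast_one,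
        one_smul]
    · rw [hTj k hk]
      exact le_top) fun j => by
    by_cases hj : j = i
    · subst hj
      rw [hTi]
      rintro _ ⟨u, rfl⟩
      exact ⟨(u, 0), bMap_inl _ _ _⟩
    · rw [hTj j hj]
      exact le_top
  rw [sum_mul_eq_of_eq_off i η (d := fun j => (Module.finrank ℂ (T j) : ℤ))
    (d' := fun j => (v j : ℤ)) (fun j hj => by rw [hTj j hj]; simp), hTi] at h
  have h1 : (v i : ℤ) ≤ Module.finrank ℂ (LinearMap.range (m.bMap ε i)) := by nlinarith
  refine Submodule.eq_top_of_finrank_eq (le_antisymm (Submodule.finrank_le _) ?_)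
  rw [Module.finrank_fintype_fun_eq_card, Fintype.card_fin]
  exact_mod_cast h1

/-- The test subspace is ker a_i, concentrated at `i`. -/
theorem ker_aMap_of_semistable (hm : m.IsSemistable η) (hη : 0 < η i) :
    LinearMap.ker (m.aMap i) = ⊥ := by
  obtain ⟨S, hSi, hSj⟩ := exists_eq_of_ne (α := fun j => Submodule ℂ (Vec v j)) i
    (LinearMap.ker (m.aMap i)) fun _ _ => ⊥
  have h := hm.1 S (fun j k hjk => by
    by_cases hj : j = i
    · subst hj
      rw [hSi]
      rintro _ ⟨t, ht, rfl⟩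
      have h0 : m.x hjk t = 0 := congrFun (congrArg Prod.snd ht) ⟨k, hjk⟩
      rw [h0]
      exact zero_mem _
    · rw [hSj j hj, Submodule.map_bot]
      exact bot_le) fun j => by
    by_cases hj : j = i
    · subst hj
      rw [hSi]
      exact fun t ht => congrArg Prod.fst ht
    · rw [hSj j hj]
      exact bot_le
  rw [sum_mul_eq_of_eq_off i η (d := fun j => (Module.finrank ℂ (S j) : ℤ))
    (d' := fun _ => 0) (fun j hj => by rw [hSj j hj]; simp), hSi] at h
  simp only [mul_zero, Finset.sum_const_zero, zero_add, sub_zero] at h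
  rw [← Submodule.finrank_eq_zero]
  have h1 : (Module.finrank ℂ (LinearMap.ker (m.aMap i)) : ℤ) ≤ 0 := by nlinarith
  omega

theorem finrank_uSpace (i : I) : (Module.finrank ℂ (USpace G v w i) : ℤ) =
    w i + ∑ j : G.neighborSet i, (v j : ℤ) := by
  rw [Module.finrank_prod, Module.finrank_pi_fintype (R := ℂ)
    (M := fun j : G.neighborSet i => Vec v j)]
  simp only [Module.finrank_fintype_fun_eq_card, Fintype.card_fin]
  push_cast
  rfl

theorem starRefl_eq {i : I} (hv : ∀ j, j ≠ i → v' j = v j)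
    (hvi : (v' i : ℤ) = w i + ∑ j : G.neighborSet i, (v j : ℤ) - v i) (j : I) :
    (v' j : ℤ) = starRefl G w i (fun k => (v k : ℤ)) j := by
  by_cases hj : j = i
  · subst hj
    rw [starRefl, Function.update_self, sum_cartan_mul G j fun k => (v k : ℤ), hvi]
    ring
  · rw [starRefl, Function.update_of_ne hj, hv j hj]

/-- The new space at `i` is ker b_i, with a' the inclusion and b' the map a b, which lands in ker
b_i because b a = 0. Surjectivity of b_i gives exactness and the dimension. -/
theorem exists_isSimpleReflection_of_neg (hε : ∀ i j, ε j i = -ε i j)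
    (hε1 : ∀ i j, G.Adj i j → ε i j * ε i j = 1) (hm : m ∈ semistableLocus G ε η 0 v w)
    (hη : η i < 0) : ∃ (v' : I → ℕ) (m' : Rep G v' w), IsSimpleReflection ε η 0 i m m' := by
  have hmom : ∀ j t, m.moment ε j t = 0 := fun j t => by rw [hm.1 j]; simp
  let ψ : (Fin (Module.finrank ℂ (LinearMap.ker (m.bMap ε i))) → ℂ) ≃ₗ[ℂ]
    LinearMap.ker (m.bMap ε i) := LinearEquiv.ofFinrankEq _ _ (by simp)
  let b₀ : USpace G v w i →ₗ[ℂ] LinearMap.ker (m.bMap ε i) :=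
    (m.aMap i ∘ₗ m.bMap ε i).codRestrict _ fun u => by
      rw [LinearMap.mem_ker, LinearMap.comp_apply, bMap_aMap hε, hmom, neg_zero]
  obtain ⟨v', m', e, c, hi, hj, hoff, ha', hb'⟩ := exists_modification hε1 m i
    ((LinearMap.ker (m.bMap ε i)).subtype ∘ₗ ψ.toLinearMap) (ψ.symm.toLinearMap ∘ₗ b₀)
  have hab : ∀ u, uEquiv i e (m.aMap i (m.bMap ε i u)) =
      m'.aMap i (m'.bMap ε i (uEquiv i e u)) := fun u => by
    rw [hb', ha']
    simp [b₀]
  have hinj : Function.Injective (m'.aMap i) := by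
    rw [injective_iff_map_eq_zero]
    intro t ht
    obtain ⟨t, rfl⟩ := c.surjective t
    rw [ha', LinearEquiv.map_eq_zero_iff] at ht
    have h0 : ψ t = 0 := Subtype.ext ht
    rw [LinearEquiv.map_eq_zero_iff] at h0
    rw [h0, map_zero]
  have hker : ∀ u, m.bMap ε i u = 0 ↔ ∃ t, m'.aMap i t = uEquiv i e u := by
    intro u
    constructor
    · intro hu
      refine ⟨c (ψ.symm ⟨u, hu⟩), ?_⟩
      rw [ha']
      simp
    · rintro ⟨t, ht⟩
      obtain ⟨t, rfl⟩ := c.surjective t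
      rw [ha', EmbeddingLike.apply_eq_iff_eq] at ht
      rw [← ht]
      exact (ψ t).2
  have hrange := range_bMap_of_semistable hε1 hm.2 hη
  have hvi : (v' i : ℤ) = w i + ∑ j : G.neighborSet i, (v j : ℤ) - v i := by
    have h := LinearMap.finrank_range_add_finrank_ker (m.bMap ε i)
    rw [hrange, finrank_top, Module.finrank_fintype_fun_eq_card, Fintype.card_fin] at h
    rw [hi, ← finrank_uSpace, ← h]
    push_cast
    ring
  have hmom' : ∀ j, m'.moment ε j = 0 := by
    intro j
    refine LinearMap.ext fun t => ?_
    by_cases hji : j = i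
    · subst hji
      rw [LinearMap.zero_apply, ← neg_eq_zero, ← bMap_aMap hε]
      obtain ⟨t, rfl⟩ := c.surjective t
      rw [ha', hb', LinearEquiv.map_eq_zero_iff]
      simp only [LinearMap.comp_apply, LinearEquiv.coe_coe, LinearEquiv.map_eq_zero_iff]
      refine Subtype.ext ?_
      change m.aMap j (m.bMap ε j (ψ t)) = 0
      rw [LinearMap.mem_ker.1 (ψ t).2, map_zero]
    · obtain ⟨t, rfl⟩ := (e j hji).surjective t
      rw [hoff.moment hε1 hab hji, hmom, map_zero, LinearMap.zero_apply]
  refine ⟨v', m', starRefl_eq hj hvi, hm, ⟨fun j => ?_, ?_⟩, Or.inl ⟨Or.inl hη, e, ?_, ?_, hoff, ?_⟩⟩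
  · rw [hmom', simpleRefl_zero, Pi.zero_apply, zero_smul]
  · refine hoff.isSemistable hε1 hm.2 hj hvi fun N S' h1 h2 => ?_
    obtain ⟨S, hS1, hS2, hS3⟩ := exists_subspace_of_ker_eq_range
      (a := (uEquiv i e).toLinearMap ∘ₗ m.aMap i)
      (b := m.bMap ε i ∘ₗ (uEquiv i e).symm.toLinearMap)
      (fun u => by simpa using hab ((uEquiv i e).symm u)) hinj
      (fun u => by simpa using hker ((uEquiv i e).symm u)) h1 h2
    refine ⟨S, hS1, hS2, mul_nonneg_of_nonpos_of_nonpos hη.le ?_⟩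
    omega
  · exact ⟨hinj, LinearMap.range_eq_top.1 hrange, hker⟩
  · intro u
    rw [simpleRefl_zero, Pi.zero_apply, zero_smul, hab, sub_self]
  · intro j _
    rw [hmom', simpleRefl_zero, Pi.zero_apply, zero_smul, zero_smul]
    exact ⟨LinearMap.ext fun t => hmom j t, rfl⟩

/-- Dual construction: the new space is coker a_i, with b' the projection and a' induced by a b,
which vanishes on im a_i. The old and new points form a reflection pair in the opposite order. -/
theorem exists_isSimpleReflection_of_pos (hε : ∀ i j, ε j i = -ε i j)
    (hε1 : ∀ i j, G.Adj i j → ε i j * ε i j = 1) (hm : m ∈ semistableLocus G ε η 0 v w)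
    (hη : 0 < η i) : ∃ (v' : I → ℕ) (m' : Rep G v' w), IsSimpleReflection ε η 0 i m m' := by
  have hmom : ∀ j t, m.moment ε j t = 0 := fun j t => by rw [hm.1 j]; simp
  have hba : ∀ t, m.bMap ε i (m.aMap i t) = 0 := fun t => by rw [bMap_aMap hε, hmom, neg_zero]
  let A := LinearMap.range (m.aMap i)
  let ψ : (Fin (Module.finrank ℂ (USpace G v w i ⧸ A)) → ℂ) ≃ₗ[ℂ] (USpace G v w i ⧸ A) :=
    LinearEquiv.ofFinrankEq _ _ (by simp)
  let a₀ : (USpace G v w i ⧸ A) →ₗ[ℂ] USpace G v w i :=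
    A.liftQ (m.aMap i ∘ₗ m.bMap ε i) (by
      rintro _ ⟨t, rfl⟩
      rw [LinearMap.mem_ker, LinearMap.comp_apply, hba, map_zero])
  obtain ⟨v', m', e, c, hi, hj, hoff, ha', hb'⟩ := exists_modification hε1 m i
    (a₀ ∘ₗ ψ.toLinearMap) (ψ.symm.toLinearMap ∘ₗ A.mkQ)
  have hab : ∀ u, uEquiv i e (m.aMap i (m.bMap ε i u)) =
      m'.aMap i (m'.bMap ε i (uEquiv i e u)) := fun u => by
    rw [hb', ha']
    simp [a₀]
  have hinj : Function.Injective (m.aMap i) :=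
    LinearMap.ker_eq_bot.1 (ker_aMap_of_semistable hm.2 hη)
  have hb0 : ∀ u, m'.bMap ε i (uEquiv i e u) = 0 ↔ ∃ t, m.aMap i t = u := by
    intro u
    rw [hb', LinearEquiv.map_eq_zero_iff, LinearMap.comp_apply, LinearEquiv.coe_coe,
      LinearEquiv.map_eq_zero_iff, Submodule.mkQ_apply, Submodule.Quotient.mk_eq_zero]
    rfl
  have hker : ∀ u, m'.bMap ε i u = 0 ↔ ∃ t, m.aMap i t = (uEquiv i e).symm u := by
    intro u
    rw [← hb0, LinearEquiv.apply_symm_apply]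
  have hsurj : Function.Surjective (m'.bMap ε i) := by
    intro t
    obtain ⟨t, rfl⟩ := c.surjective t
    obtain ⟨u, hu⟩ := A.mkQ_surjective (ψ t)
    refine ⟨uEquiv i e u, ?_⟩
    rw [hb', LinearMap.comp_apply, hu]
    simp
  have hvi : (v' i : ℤ) = w i + ∑ j : G.neighborSet i, (v j : ℤ) - v i := by
    have h := Submodule.finrank_quotient_add_finrank A
    rw [LinearMap.finrank_range_of_inj hinj, Module.finrank_fintype_fun_eq_card,
      Fintype.card_fin] at h
    rw [hi, ← finrank_uSpace, ← h]
    push_cast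
    ring
  have hmom' : ∀ j, m'.moment ε j = 0 := by
    intro j
    refine LinearMap.ext fun t => ?_
    by_cases hji : j = i
    · subst hji
      rw [LinearMap.zero_apply, ← neg_eq_zero, ← bMap_aMap hε]
      obtain ⟨u, rfl⟩ := hsurj t
      rw [hker]
      refine ⟨m.bMap ε j ((uEquiv j e).symm u), ?_⟩
      have := hab ((uEquiv j e).symm u)
      rw [LinearEquiv.apply_symm_apply] at this
      rw [← this, LinearEquiv.symm_apply_apply]
    · obtain ⟨t, rfl⟩ := (e j hji).surjective t
      rw [hoff.moment hε1 hab hji, hmom, map_zero, LinearMap.zero_apply]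
  refine ⟨v', m', starRefl_eq hj hvi, hm, ⟨fun j => ?_, ?_⟩,
    Or.inr ⟨hη, fun j hj => (e j hj).symm, ?_, ?_, hoff.symm, ?_⟩⟩
  · rw [hmom', simpleRefl_zero, Pi.zero_apply, zero_smul]
  · refine hoff.isSemistable hε1 hm.2 hj hvi fun N S' h1 h2 => ?_
    obtain ⟨S, hS1, hS2, hS3⟩ := exists_subspace_of_range_eq_ker
      (a := (uEquiv i e).toLinearMap ∘ₗ m.aMap i)
      (b := m.bMap ε i ∘ₗ (uEquiv i e).symm.toLinearMap)
      (fun u => by simpa using hab ((uEquiv i e).symm u))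
      ((uEquiv i e).injective.comp hinj)
      (fun u => by rw [hker]; simp [LinearEquiv.eq_symm_apply]) h1 h2
    refine ⟨S, hS1, hS2, mul_nonneg hη.le ?_⟩
    omega
  · exact ⟨hinj, hsurj, hker⟩
  · intro u
    have := hab ((uEquiv i e).symm u)
    rw [LinearEquiv.apply_symm_apply] at this
    rw [uEquiv_symm, ← this, LinearEquiv.symm_apply_apply, simpleRefl_zero, simpleRefl_zero,
      Pi.zero_apply, zero_smul, sub_self]
  · intro j _
    rw [hmom', simpleRefl_zero, simpleRefl_zero, Pi.zero_apply, zero_smul, zero_smul]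
    exact ⟨rfl, LinearMap.ext fun t => hmom j t⟩

/-- No coordinate of an intermediate parameter vanishes, so each step falls under one of the two
signs. -/
theorem exists_isReflection (hε : ∀ i j, ε j i = -ε i j)
    (hε1 : ∀ i j, G.Adj i j → ε i j * ε i j = 1) (hm : m ∈ semistableLocus G ε η 0 v w) :
    ∀ l : List I, (∀ l', l' <:+ l → ∀ i, wordAct G l' η i ≠ 0) →
    ∃ (v' : I → ℕ) (m' : Rep G v' w), IsReflection ε η 0 l m m' ∧
      m' ∈ semistableLocus G ε (wordAct G l η) 0 v' w ∧
      ∀ j, (v' j : ℤ) = wordStar G w l (fun k => (v k : ℤ)) j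
  | [], _ => ⟨v, m, ⟨hm, .refl m⟩, hm, fun _ => rfl⟩
  | i :: l, hl => by
    obtain ⟨u, m₁, h1, h2, h3⟩ := exists_isReflection hε hε1 hm l fun l' hl' =>
      hl l' (hl'.trans (List.suffix_cons i l))
    obtain ⟨v', m', h⟩ : ∃ (v' : I → ℕ) (m' : Rep G v' w),
        IsSimpleReflection ε (wordAct G l η) 0 i m₁ m' := by
      rcases (hl l (List.suffix_cons i l) i).lt_or_gt with h | h
      · exact exists_isSimpleReflection_of_neg hε hε1 h2 h
      · exact exists_isSimpleReflection_of_pos hε hε1 h2 h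
    refine ⟨v', m', ⟨u, m₁, h1, ?_⟩, ?_, fun j => ?_⟩
    · rw [wordAct_zero]
      exact h
    · have h4 := h.2.2.1
      rwa [simpleRefl_zero] at h4
    · rw [h.1 j, funext h3]
      rfl

end Rep

end ReflectionExistence

/-! ## The map `τ` -/

section Tau

variable {I : Type} [Fintype I] [DecidableEq I] {G : SimpleGraph I} [DecidableRel G.Adj]
  {v w : I → ℕ} {ε : I → I → ℤ}
  {BV : ∀ i, LinearMap.BilinForm ℂ (Vec v i)} (hV : ∀ i, (BV i).Nondegenerate)
  {BW : ∀ i, LinearMap.BilinForm ℂ (Vec w i)} (hW : ∀ i, (BW i).Nondegenerate)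

namespace Rep

theorem tau_x (m : Rep G v w) {i j : I} (h : G.Adj i j) :
    (tau ε BV hV BW hW m).x h =
      (ε i j : ℂ) • rightAdjoint (BV j) (hV j) (BV i) (m.x (G.adj_symm h)) := rfl

theorem tau_p (m : Rep G v w) (i : I) :
    (tau ε BV hV BW hW m).p i = -rightAdjoint (BV i) (hV i) (BW i) (m.q i) := rfl

theorem tau_q (m : Rep G v w) (i : I) :
    (tau ε BV hV BW hW m).q i = rightAdjoint (BW i) (hW i) (BV i) (m.p i) := rfl

/-- Adjunction reverses products, ε(h) ε(h̄) = -1, and the sign in the definition of p accounts for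
the remaining term. -/
theorem moment_tau (hε : ∀ i j, ε j i = -ε i j) (hε1 : ∀ i j, G.Adj i j → ε i j * ε i j = 1)
    (m : Rep G v w) (i : I) : (tau ε BV hV BW hW m).moment ε i =
      -rightAdjoint (BV i) (hV i) (BV i) (m.moment ε i) := by
  rw [← rightAdjoint_neg]
  refine eq_rightAdjoint (hV i) fun t t' => ?_
  simp only [moment, LinearMap.sub_apply, LinearMap.neg_apply, map_neg, map_sub, map_sum,
    LinearMap.sum_apply, LinearMap.smul_apply, LinearMap.comp_apply, map_smul, tau_x, tau_p, tau_q]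
  rw [neg_sub, sub_eq_add_neg, sub_eq_add_neg, neg_neg, add_comm, ← Finset.sum_neg_distrib]
  congr 1
  · refine Finset.sum_congr rfl fun j _ => ?_
    rw [show (tau ε BV hV BW hW m).x j.2 = _ from tau_x hV hW m j.2, LinearMap.smul_apply, map_smul,
      map_smul, rightAdjoint_spec (BV j) (hV j) (BV i), rightAdjoint_spec (BV i) (hV i) (BV j),
      hε i j]
    simp only [smul_eq_mul]
    have h := hε1 i j j.2
    have h' : (ε i j : ℂ) * (ε i j : ℂ) = 1 := by exact_mod_cast h
    push_cast
    linear_combination (-(ε i j : ℂ)) * h' * BV i t (rightAdjoint (BV i) (hV i) (BV j)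
      (m.x j.2) (rightAdjoint (BV j) (hV j) (BV i) (m.x (G.adj_symm j.2)) t'))
  · rw [rightAdjoint_spec (BW i) (hW i) (BV i), rightAdjoint_spec (BV i) (hV i) (BW i)]

theorem finrank_orthogonal_add {k : ℕ} {B : LinearMap.BilinForm ℂ (Fin k → ℂ)}
    (hB : B.Nondegenerate) (S : Submodule ℂ (Fin k → ℂ)) :
    (Module.finrank ℂ (B.orthogonal S) : ℤ) = k - Module.finrank ℂ S := by
  have h := LinearMap.BilinForm.finrank_orthogonal hB S
  have h' := Submodule.finrank_le S
  rw [Module.finrank_fintype_fun_eq_card, Fintype.card_fin] at h h'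
  omega

/-- Left orthogonals of invariant subspaces for τ m are invariant for `m`. Subspaces of ker q
correspond to subspaces containing im p and conversely, so the two conditions change places; passing
to codimensions changes the sign of the parameter. -/
theorem isSemistable_tau {η : I → ℤ} (hε1 : ∀ i j, G.Adj i j → ε i j * ε i j = 1)
    {m : Rep G v w} (hm : m.IsSemistable η) : (tau ε BV hV BW hW m).IsSemistable (-η) := by
  have hinv : ∀ S : ∀ i, Submodule ℂ (Vec v i),
      (∀ (i j : I) (h : G.Adj i j), (S i).map ((tau ε BV hV BW hW m).x h) ≤ S j) →
      ∀ (i j : I) (h : G.Adj i j),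
        ((BV i).flip.orthogonal (S i)).map (m.x h) ≤ (BV j).flip.orthogonal (S j) := by
    intro S hS i j h
    rintro _ ⟨t, ht, rfl⟩ s hs
    change BV j (m.x h t) s = 0
    rw [rightAdjoint_spec (BV i) (hV i) (BV j)]
    have h1 := (S i).smul_mem (ε j i : ℂ) (hS j i (G.adj_symm h) ⟨s, hs, rfl⟩)
    rw [tau_x, LinearMap.smul_apply, smul_smul, ← Int.cast_mul, hε1 j i (G.adj_symm h),
      Int.cast_one, one_smul] at h1
    exact ht _ h1
  constructor
  · intro S hS hker
    have h := hm.2 _ (hinv S hS) fun i => by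
      rintro _ ⟨u, rfl⟩ s hs
      change BV i (m.p i u) s = 0
      have h0 : rightAdjoint (BW i) (hW i) (BV i) (m.p i) s = 0 := hker i hs
      rw [rightAdjoint_spec (BW i) (hW i) (BV i), h0, map_zero]
    simp only [finrank_orthogonal_add (hV _).flip, mul_sub, Finset.sum_sub_distrib] at h
    simp only [Pi.neg_apply, neg_mul, Finset.sum_neg_distrib]
    linarith
  · intro T hT hrange
    have h := hm.1 _ (hinv T hT) fun i => by
      intro t ht
      refine (hW i).1 _ fun u => ?_
      rw [rightAdjoint_spec (BV i) (hV i) (BW i)]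
      refine ht _ ?_
      have h1 := (T i).neg_mem (hrange i ⟨u, rfl⟩)
      rwa [tau_p, LinearMap.neg_apply, neg_neg] at h1
    simp only [finrank_orthogonal_add (hV _).flip, mul_sub, Finset.sum_sub_distrib] at h
    simp only [Pi.neg_apply, neg_mul, Finset.sum_neg_distrib]
    linarith

theorem tau_mem {η : I → ℤ} (hε : ∀ i j, ε j i = -ε i j)
    (hε1 : ∀ i j, G.Adj i j → ε i j * ε i j = 1) {m : Rep G v w}
    (hm : m ∈ semistableLocus G ε η 0 v w) :
    tau ε BV hV BW hW m ∈ semistableLocus G ε (-η) 0 v w := by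
  refine ⟨fun i => ?_, isSemistable_tau hV hW hε1 hm.2⟩
  have h0 := rightAdjoint_smul (hV i) (BV i) 0 0
  rw [zero_smul, zero_smul] at h0
  rw [moment_tau hV hW hε hε1, hm.1 i, Pi.zero_apply, zero_smul, h0, neg_zero]

end Rep

end Tau

/-! ## Subspaces of `W_1` that are invariant under reflections -/

section Step

/-- The relation given by the graph of `f : X → Y` or by the graph of `g : Y → X`, depending
on `s`. -/
def StepRel {X Y : Type*} (s : Prop) (f : X → Y) (g : Y → X) (x : X) (y : Y) : Prop :=
  (s → y = f x) ∧ (¬s → x = g y)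

theorem stepRel_iff {X Y X' Y' : Type*} (s : Prop) {f : X → Y} {g : Y → X} {f' : X' → Y'}
    {g' : Y' → X'} (e₁ : X ≃ X') (e₂ : Y ≃ Y') (hf : ∀ x, f' (e₁ x) = e₂ (f x))
    (hg : ∀ y, g' (e₂ y) = e₁ (g y)) (x : X) (y : Y) :
    StepRel s f g x y ↔ StepRel s f' g' (e₁ x) (e₂ y) := by
  simp only [StepRel, hf, hg, EmbeddingLike.apply_eq_iff_eq]

/-- With equal choices the claim is that the round trips through V and V' agree. For "forward, then
backward" the left side says A l = B r, and exactness at U_i rewrites this as a common origin in V'.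
The order "backward, then forward" is excluded by `hs`. -/
theorem stepRel_exchange {L L' V V' R R' : Type*} {A : L → V} {C : V → L} {B : R → V} {D : V → R}
    {A' : L' → V'} {C' : V' → L'} {B' : R' → V'} {D' : V' → R'} (e₁ : L ≃ L') (e₂ : R ≃ R')
    (hker : ∀ l r, A l = B r ↔ ∃ t, C' t = e₁ l ∧ D' t = e₂ r)
    (hDA : ∀ l, e₂ (D (A l)) = D' (A' (e₁ l))) (hCB : ∀ r, e₁ (C (B r)) = C' (B' (e₂ r)))
    {s₁ s₂ : Prop} (hs : s₂ → s₁) (l : L) (r : R) :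
    (∃ t, StepRel s₁ A C l t ∧ StepRel s₂ D B t r) ↔
      ∃ t, StepRel s₂ A' C' (e₁ l) t ∧ StepRel s₁ D' B' t (e₂ r) := by
  by_cases h1 : s₁ <;> by_cases h2 : s₂
  · simp only [StepRel, h1, h2, true_implies, not_true_eq_false, false_implies, and_true,
      exists_eq_left, ← hDA, EmbeddingLike.apply_eq_iff_eq]
  · simp only [StepRel, h1, h2, true_implies, not_true_eq_false, false_implies, and_true,
      not_false_eq_true, true_and, exists_eq_left, hker]
    exact exists_congr fun t => and_congr eq_comm eq_comm
  · exact absurd (hs h2) h1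
  · simp only [StepRel, h1, h2, true_implies, false_implies, not_false_eq_true, true_and]
    constructor
    · rintro ⟨_, rfl, rfl⟩
      exact ⟨_, hCB r, rfl⟩
    · rintro ⟨_, h, rfl⟩
      rw [← hCB, EmbeddingLike.apply_eq_iff_eq] at h
      exact ⟨_, h, rfl⟩

end Step

/-! ### The relations and subspaces attached to a chain of choices -/

section Chain

variable {n : ℕ} {v v' w : Fin n → ℕ} (hn : 0 < n)

/-- The relation between `W_1` and `V_{k+1}` obtained by composing, for `j ≤ k`, the map from
position `j` to position `j + 1` if `s j`, and the inverse of the opposite map otherwise. -/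
def chainRel (m : Rep (typeA n) v w) (s : ℕ → Prop) : (k : ℕ) → (hk : k < n) →
    Vec w ⟨0, hn⟩ → Vec v ⟨k, hk⟩ → Prop
  | 0, _, u, t => StepRel (s 0) (m.p ⟨0, hn⟩) (m.q ⟨0, hn⟩) u t
  | k + 1, hk, u, t => ∃ t', chainRel m s k (Nat.lt_of_succ_lt hk) u t' ∧
      StepRel (s (k + 1)) (m.fwd k hk) (m.bwd k hk) t' t

/-- The vectors of `W_1` that are related to `0` at the end of the chain. -/
def chainSet (m : Rep (typeA n) v w) (s : ℕ → Prop) : Set (Vec w ⟨0, hn⟩) :=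
  {u | ∃ (k : ℕ) (hk : k < n) (t : Vec v ⟨k, hk⟩), k + 1 = n ∧ chainRel hn m s k hk u t ∧
    (¬s n → t = 0)}

variable {hn} {m : Rep (typeA n) v w} {m' : Rep (typeA n) v' w} {s s' : ℕ → Prop}

theorem chainRel_congr (h : ∀ j ≤ n, s j ↔ s' j) : ∀ (k : ℕ) (hk : k < n) (u : Vec w ⟨0, hn⟩)
    (t : Vec v ⟨k, hk⟩), chainRel hn m s k hk u t ↔ chainRel hn m s' k hk u t
  | 0, _, u, t => by
    rw [chainRel, chainRel, StepRel, StepRel, h 0 (Nat.zero_le n)]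
  | k + 1, hk, u, t => by
    simp only [chainRel, StepRel, h (k + 1) hk.le, chainRel_congr h k]

theorem chainSet_congr (h : ∀ j ≤ n, s j ↔ s' j) : chainSet hn m s = chainSet hn m s' := by
  ext u
  simp only [chainSet, Set.mem_ofPred_eq, chainRel_congr h, h n le_rfl]

theorem chainRel_intertwiner {g : ∀ i, Vec v i ≃ₗ[ℂ] Vec v' i} (hg : Rep.IsIntertwiner m m' g) :
    ∀ (k : ℕ) (hk : k < n) (u : Vec w ⟨0, hn⟩) (t : Vec v ⟨k, hk⟩),
      chainRel hn m s k hk u t ↔ chainRel hn m' s k hk u (g ⟨k, hk⟩ t)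
  | 0, h0, u, t => stepRel_iff (s 0) (Equiv.refl (Vec w ⟨0, hn⟩)) (g ⟨0, h0⟩).toEquiv
      (fun u => LinearMap.congr_fun (hg.2.1 ⟨0, hn⟩) u)
      (fun t => LinearMap.congr_fun (hg.2.2 ⟨0, hn⟩) t) u t
  | k + 1, hk, u, t => by
    refine (g ⟨k, Nat.lt_of_succ_lt hk⟩).toEquiv.exists_congr fun t' =>
      and_congr (chainRel_intertwiner hg k _ u t') ?_
    exact stepRel_iff _ (g ⟨k, Nat.lt_of_succ_lt hk⟩).toEquiv (g ⟨k + 1, hk⟩).toEquiv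
      (fun x => LinearMap.congr_fun (hg.1 _ _ (adj_succ hk)) x)
      (fun x => LinearMap.congr_fun (hg.1 _ _ (adj_pred hk)) x) _ _

theorem chainSet_equivalent (h : m.Equivalent m') : chainSet hn m s = chainSet hn m' s := by
  obtain ⟨g, hg⟩ := h
  ext u
  refine exists_congr fun k => exists_congr fun hk => ?_
  refine (g ⟨k, hk⟩).toEquiv.exists_congr fun t => and_congr Iff.rfl ?_
  rw [chainRel_intertwiner hg, LinearEquiv.coe_toEquiv, LinearEquiv.map_eq_zero_iff]

/-- The map `W_1 → V_{k+1}`. -/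
def pathMap (m : Rep (typeA n) v w) : (k : ℕ) → (hk : k < n) → Vec w ⟨0, hn⟩ →ₗ[ℂ] Vec v ⟨k, hk⟩
  | 0, _ => m.p ⟨0, hn⟩
  | k + 1, hk => m.fwd k hk ∘ₗ pathMap m k (Nat.lt_of_succ_lt hk)

theorem chainRel_of_forall (k : ℕ) (hk : k < n) (hs : ∀ j ≤ k, s j) (u : Vec w ⟨0, hn⟩)
    (t : Vec v ⟨k, hk⟩) : chainRel hn m s k hk u t ↔ t = pathMap m k hk u := by
  induction k with
  | zero => simp [chainRel, StepRel, hs 0 le_rfl, pathMap]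
  | succ k ih =>
    simp only [chainRel, ih (Nat.lt_of_succ_lt hk) fun j hj => hs j (by omega), exists_eq_left,
      StepRel, hs (k + 1) le_rfl, true_implies, not_true_eq_false, false_implies, and_true]
    rfl

theorem chainRel_of_forall_not (k : ℕ) (hk : k < n) (hs : ∀ j ≤ k, ¬s j) (u : Vec w ⟨0, hn⟩)
    (t : Vec v ⟨k, hk⟩) : chainRel hn m s k hk u t ↔ u = frameMap hn m k hk t := by
  induction k with
  | zero => simp [chainRel, StepRel, hs 0 le_rfl, frameMap_zero]
  | succ k ih =>
    simp only [chainRel, ih (Nat.lt_of_succ_lt hk) fun j hj => hs j (by omega),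
      StepRel, hs (k + 1) le_rfl, true_implies, false_implies, true_and, not_false_eq_true,
      exists_eq_right]
    rfl

/-- The backward links after position `k` start from 0 at the far end and can only transport 0, so
the forward path must end in 0. -/
theorem chainSet_lt (m : Rep (typeA n) v w) (k : ℕ) (hk : k < n) :
    chainSet hn m (fun j => j < k + 1) = LinearMap.ker (pathMap (hn := hn) m k hk) := by
  have key : ∀ (j : ℕ) (hj : j < n), k ≤ j → ∀ u,
      chainRel hn m (fun j => j < k + 1) j hj u 0 ↔ pathMap (hn := hn) m k hk u = 0 := by
    intro j hj hkj u
    induction j, hkj using Nat.le_induction with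
    | base =>
      rw [chainRel_of_forall k hk fun j hj => Nat.lt_succ_of_le hj]
      exact eq_comm
    | succ j hkj ih =>
      have hs : ¬j + 1 < k + 1 := by omega
      simp only [chainRel, StepRel, hs, false_implies, true_and, not_false_eq_true, true_implies,
        map_zero, exists_eq_right]
      exact ih (Nat.lt_of_succ_lt hj)
  ext u
  rw [SetLike.mem_coe, LinearMap.mem_ker]
  have hs : ¬n < k + 1 := by omega
  constructor
  · rintro ⟨j, hj, t, hjn, h, ht⟩
    rw [ht hs] at h
    exact (key j hj (by omega) u).1 h
  · intro h
    exact ⟨n - 1, by omega, 0, by omega, (key (n - 1) (by omega) (by omega) u).2 h, fun _ => rfl⟩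

/-- The backward links up to position `k` say that the vector is the image of a frame map; the
forward links after it impose nothing. -/
theorem chainSet_gt (m : Rep (typeA n) v w) (k : ℕ) (hk : k < n) :
    chainSet hn m (fun j => k < j) = LinearMap.range (frameMap hn m k hk) := by
  have key : ∀ (j : ℕ) (hj : j < n), k ≤ j → ∀ u,
      (∃ t, chainRel hn m (fun j => k < j) j hj u t) ↔ u ∈ LinearMap.range (frameMap hn m k hk) := by
    intro j hj hkj u
    induction j, hkj using Nat.le_induction with
    | base =>
      simp only [chainRel_of_forall_not k hk fun j hj => Nat.not_lt_of_le hj]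
      exact exists_congr fun t => eq_comm
    | succ j hkj ih =>
      have hs : k < j + 1 := by omega
      rw [← ih (Nat.lt_of_succ_lt hj)]
      simp only [chainRel, StepRel, hs, not_true_eq_false, false_implies, and_true, true_implies]
      constructor
      · rintro ⟨_, t, h, -⟩
        exact ⟨t, h⟩
      · rintro ⟨t, h⟩
        exact ⟨_, t, h, rfl⟩
  ext u
  rw [SetLike.mem_coe]
  constructor
  · rintro ⟨j, hj, t, hjn, h, -⟩
    exact (key j hj (by omega) u).1 ⟨t, h⟩
  · intro h
    obtain ⟨t, ht⟩ := (key (n - 1) (by omega) (by omega) u).2 h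
    exact ⟨n - 1, by omega, t, by omega, ht, fun h => absurd hk h⟩

end Chain

/-! ## Reflections and chains -/

theorem epsA_antisymm {n : ℕ} (i j : Fin n) : epsA n j i = -epsA n i j := by
  simp [epsA]

theorem epsA_mul_self {n : ℕ} (i j : Fin n) (h : (typeA n).Adj i j) :
    epsA n i j * epsA n i j = 1 := by
  rcases h with h | h
  · have : epsA n i j = -1 := by simp only [epsA]; omega
    rw [this]; rfl
  · have : epsA n i j = 1 := by simp only [epsA]; omega
    rw [this]; rfl

section ReflectChain

variable {n : ℕ} {v v' w : Fin n → ℕ} {hn : 0 < n} {m : Rep (typeA n) v w}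
  {m' : Rep (typeA n) v' w} {i : Fin n} {e : ∀ j, j ≠ i → (Vec v j ≃ₗ[ℂ] Vec v' j)}

/-- The conditions on a reflection pair with parameter `0` that do not concern the moment map. -/
structure IsPairVia (i : Fin n) (m : Rep (typeA n) v w) (m' : Rep (typeA n) v' w)
    (e : ∀ j, j ≠ i → (Vec v j ≃ₗ[ℂ] Vec v' j)) : Prop where
  ker_iff : ∀ u, m.bMap (epsA n) i u = 0 ↔ ∃ t, m'.aMap i t = Rep.uEquiv i e u
  comp_eq : ∀ u, Rep.uEquiv i e (m.aMap i (m.bMap (epsA n) i u)) =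
    m'.aMap i (m'.bMap (epsA n) i (Rep.uEquiv i e u))
  agree : Rep.AgreeOff i m m' e

theorem isPairVia_of_isReflectionPair (h : Rep.IsReflectionPair (epsA n) i 0 m m') :
    ∃ e, IsPairVia i m m' e := by
  obtain ⟨e, h1, h2, h3, -⟩ := h
  refine ⟨e, h1.2.2, fun u => ?_, h3⟩
  have := h2 u
  rwa [simpleRefl_zero, Pi.zero_apply, zero_smul, sub_eq_zero] at this

namespace IsPairVia

theorem bMap_eq_zero_iff (h : IsPairVia i m m' e) (u : Rep.USpace (typeA n) v w i) :
    m.bMap (epsA n) i u = 0 ↔ ∃ t, m'.q i t = u.1 ∧ ∀ j (hj : (typeA n).Adj i j),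
      m'.x hj t = e j ((typeA n).ne_of_adj hj).symm (u.2 ⟨j, hj⟩) := by
  rw [h.ker_iff]
  refine exists_congr fun t => ?_
  exact ⟨fun h => ⟨congrArg Prod.fst h, fun j hj => congrFun (congrArg Prod.snd h) ⟨j, hj⟩⟩,
    fun ⟨h1, h2⟩ => Prod.ext h1 (funext fun j => h2 j j.2)⟩

/-- At the first vertex this is the W_1-component of a b = a' b'; elsewhere the maps concerned are
unchanged. -/
theorem endo_eq (h : IsPairVia i m m' e) :
    m.q ⟨0, hn⟩ ∘ₗ m.p ⟨0, hn⟩ = m'.q ⟨0, hn⟩ ∘ₗ m'.p ⟨0, hn⟩ := by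
  by_cases hi : ⟨0, hn⟩ = i
  · subst hi
    refine LinearMap.ext fun u => ?_
    have := congrArg Prod.fst (h.comp_eq (u, 0))
    rw [Rep.uEquiv_inl, Rep.bMap_inl, Rep.bMap_inl] at this
    exact this
  · rw [← h.agree.2.1 _ hi, h.agree.2.2 _ hi]
    rfl

/-- At an inner vertex W_i = 0 and b_i(l, r) is the difference of the images of l and r, so ker b_i
is the fibre product required by `stepRel_exchange`. -/
theorem exchange_mid (hw : ∀ i, i ≠ ⟨0, hn⟩ → w i = 0) {k : ℕ} {hk : k + 1 < n}
    {e : ∀ j, j ≠ ⟨k + 1, hk⟩ → (Vec v j ≃ₗ[ℂ] Vec v' j)} (h : IsPairVia ⟨k + 1, hk⟩ m m' e)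
    (hk' : k + 1 + 1 < n) {s₁ s₂ : Prop} (hs : s₂ → s₁) (l : Vec v ⟨k, Nat.lt_of_succ_lt hk⟩)
    (r : Vec v ⟨k + 1 + 1, hk'⟩) :
    (∃ t, StepRel s₁ (m.fwd k hk) (m.bwd k hk) l t ∧
      StepRel s₂ (m.fwd (k + 1) hk') (m.bwd (k + 1) hk') t r) ↔
    ∃ t, StepRel s₂ (m'.fwd k hk) (m'.bwd k hk) (e _ ((typeA n).ne_of_adj (adj_succ hk)) l) t ∧
      StepRel s₁ (m'.fwd (k + 1) hk') (m'.bwd (k + 1) hk') t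
        (e _ ((typeA n).ne_of_adj (adj_pred hk')) r) := by
  have hε := epsA_mul_self (n := n)
  refine stepRel_exchange (e _ ((typeA n).ne_of_adj (adj_succ hk))).toEquiv
    (e _ ((typeA n).ne_of_adj (adj_pred hk'))).toEquiv (fun l r => ?_) (fun l => ?_) (fun r => ?_)
    hs l r
  · have hne : (⟨⟨k, Nat.lt_of_succ_lt hk⟩, adj_pred hk⟩ : (typeA n).neighborSet ⟨k + 1, hk⟩) ≠
        ⟨⟨k + 1 + 1, hk'⟩, adj_succ hk'⟩ := fun h0 => by
      have := congrArg (fun x => (x.1 : ℕ)) h0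
      simp only at this
      omega
    have hl : (Pi.single ⟨⟨k, Nat.lt_of_succ_lt hk⟩, adj_pred hk⟩ l +
        Pi.single ⟨⟨k + 1 + 1, hk'⟩, adj_succ hk'⟩ r :
        ∀ j : (typeA n).neighborSet ⟨k + 1, hk⟩, Vec v j)
        ⟨⟨k, Nat.lt_of_succ_lt hk⟩, adj_pred hk⟩ = l := by
      rw [Pi.add_apply, Pi.single_eq_same, Pi.single_eq_of_ne hne, add_zero]
    have hr : (Pi.single ⟨⟨k, Nat.lt_of_succ_lt hk⟩, adj_pred hk⟩ l +
        Pi.single ⟨⟨k + 1 + 1, hk'⟩, adj_succ hk'⟩ r :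
        ∀ j : (typeA n).neighborSet ⟨k + 1, hk⟩, Vec v j)
        ⟨⟨k + 1 + 1, hk'⟩, adj_succ hk'⟩ = r := by
      rw [Pi.add_apply, Pi.single_eq_same, Pi.single_eq_of_ne hne.symm, zero_add]
    have h1 := h.bMap_eq_zero_iff ((0, Pi.single ⟨⟨k, Nat.lt_of_succ_lt hk⟩, adj_pred hk⟩ l) +
      (0, Pi.single ⟨⟨k + 1 + 1, hk'⟩, adj_succ hk'⟩ r))
    have e1 : epsA n ⟨k + 1, hk⟩ ⟨k, Nat.lt_of_succ_lt hk⟩ = 1 := by simp [epsA]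
    have e2 : epsA n ⟨k + 1, hk⟩ ⟨k + 1 + 1, hk'⟩ = -1 := by simp [epsA]
    rw [map_add, Rep.bMap_single, Rep.bMap_single, e1, e2, Int.cast_neg, Int.cast_one, one_smul,
      neg_one_smul, ← sub_eq_add_neg, sub_eq_zero] at h1
    refine h1.trans (exists_congr fun t => ?_)
    have hsub := subsingleton_vec hn hw (i := ⟨k + 1, hk⟩) (by simp)
    constructor
    · rintro ⟨-, h2⟩
      exact ⟨(h2 _ (adj_pred hk)).trans (congrArg (e _ _) hl),
        (h2 _ (adj_succ hk')).trans (congrArg (e _ _) hr)⟩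
    · rintro ⟨h2, h3⟩
      refine ⟨Subsingleton.elim _ _, ?_⟩
      rintro ⟨j, hj⟩ (hjk | hjk)
      · obtain rfl : k + 1 + 1 = j := hjk
        exact h3.trans (congrArg (e _ _) hr.symm)
      · obtain rfl : j = k := Nat.succ_injective hjk
        exact h2.trans (congrArg (e _ _) hl.symm)
  · exact Rep.forward_eq_of_sub_eq_zero hε h.comp_eq (adj_pred hk) (adj_succ hk') l
  · exact Rep.forward_eq_of_sub_eq_zero hε h.comp_eq (adj_succ hk') (adj_pred hk) r

/-- The missing right neighbour is a zero space, modelled by `Unit`: its backward step says t = 0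
and its forward step says nothing. -/
theorem exchange_last (hw : ∀ i, i ≠ ⟨0, hn⟩ → w i = 0) {k : ℕ} {hk : k + 1 < n}
    {e : ∀ j, j ≠ ⟨k + 1, hk⟩ → (Vec v j ≃ₗ[ℂ] Vec v' j)} (h : IsPairVia ⟨k + 1, hk⟩ m m' e)
    (hk' : k + 1 + 1 = n) {s₁ s₂ : Prop} (hs : s₂ → s₁) (l : Vec v ⟨k, Nat.lt_of_succ_lt hk⟩) :
    (∃ t, StepRel s₁ (m.fwd k hk) (m.bwd k hk) l t ∧ (¬s₂ → t = 0)) ↔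
    ∃ t, StepRel s₂ (m'.fwd k hk) (m'.bwd k hk) (e _ ((typeA n).ne_of_adj (adj_succ hk)) l) t ∧
      (¬s₁ → t = 0) := by
  have key := stepRel_exchange (A := m.fwd k hk) (C := m.bwd k hk) (A' := m'.fwd k hk)
    (C' := m'.bwd k hk) (B := fun _ : Unit => 0) (D := fun _ => ()) (B' := fun _ : Unit => 0)
    (D' := fun _ => ()) (e _ ((typeA n).ne_of_adj (adj_succ hk))).toEquiv (Equiv.refl Unit)
    (fun l r => ?_) (fun l => rfl) (fun r => ?_) hs l ()
  · simpa [StepRel] using key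
  · have hl : (Pi.single ⟨⟨k, Nat.lt_of_succ_lt hk⟩, adj_pred hk⟩ l :
        ∀ j : (typeA n).neighborSet ⟨k + 1, hk⟩, Vec v j)
        ⟨⟨k, Nat.lt_of_succ_lt hk⟩, adj_pred hk⟩ = l := Pi.single_eq_same _ _
    have h1 := h.bMap_eq_zero_iff (0, Pi.single ⟨⟨k, Nat.lt_of_succ_lt hk⟩, adj_pred hk⟩ l)
    have e1 : epsA n ⟨k + 1, hk⟩ ⟨k, Nat.lt_of_succ_lt hk⟩ = 1 := by simp [epsA]
    rw [Rep.bMap_single, e1, Int.cast_one, one_smul] at h1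
    refine h1.trans (exists_congr fun t => ?_)
    have hsub := subsingleton_vec hn hw (i := ⟨k + 1, hk⟩) (by simp)
    constructor
    · rintro ⟨-, h2⟩
      exact ⟨(h2 _ (adj_pred hk)).trans (congrArg (e _ _) hl), rfl⟩
    · rintro ⟨h2, -⟩
      refine ⟨Subsingleton.elim _ _, ?_⟩
      rintro ⟨j, hj⟩ (hjk | hjk)
      · simp only at hjk
        omega
      · obtain rfl : j = k := Nat.succ_injective hjk
        exact h2.trans (congrArg (e _ _) hl.symm)
  · change e _ _ (m.bwd k hk 0) = m'.bwd k hk 0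
    rw [map_zero, map_zero, map_zero]

/-- W_1 plays the part of the left neighbour, with p and q as the maps of the link. -/
theorem exchange_first {e : ∀ j, j ≠ ⟨0, hn⟩ → (Vec v j ≃ₗ[ℂ] Vec v' j)}
    (h : IsPairVia ⟨0, hn⟩ m m' e)
    (hk' : 0 + 1 < n) {s₁ s₂ : Prop} (hs : s₂ → s₁) (l : Vec w ⟨0, hn⟩)
    (r : Vec v ⟨0 + 1, hk'⟩) :
    (∃ t, StepRel s₁ (m.p ⟨0, hn⟩) (m.q ⟨0, hn⟩) l t ∧
      StepRel s₂ (m.fwd 0 hk') (m.bwd 0 hk') t r) ↔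
    ∃ t, StepRel s₂ (m'.p ⟨0, hn⟩) (m'.q ⟨0, hn⟩) l t ∧
      StepRel s₁ (m'.fwd 0 hk') (m'.bwd 0 hk') t
        (e _ ((typeA n).ne_of_adj (adj_pred hk')) r) := by
  have e2 : epsA n ⟨0, hn⟩ ⟨0 + 1, hk'⟩ = -1 := by simp [epsA]
  refine stepRel_exchange (Equiv.refl _)
    (e _ ((typeA n).ne_of_adj (adj_pred hk'))).toEquiv (fun l r => ?_) (fun l => ?_) (fun r => ?_)
    hs l r
  · have hr : (0 + Pi.single ⟨⟨0 + 1, hk'⟩, adj_succ hk'⟩ r :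
        ∀ j : (typeA n).neighborSet ⟨0, hn⟩, Vec v j) ⟨⟨0 + 1, hk'⟩, adj_succ hk'⟩ = r := by
      rw [Pi.add_apply, Pi.single_eq_same, Pi.zero_apply, zero_add (M := Vec v _)]
    have h1 := h.bMap_eq_zero_iff ((l, 0) + (0, Pi.single ⟨⟨0 + 1, hk'⟩, adj_succ hk'⟩ r))
    rw [map_add, Rep.bMap_inl, Rep.bMap_single, e2, Int.cast_neg, Int.cast_one,
      neg_one_smul, ← sub_eq_add_neg, sub_eq_zero] at h1
    refine h1.trans (exists_congr fun t => and_congr ?_ ?_)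
    · exact iff_of_eq (congrArg (fun z => m'.q _ t = z) (add_zero l))
    · constructor
      · intro h2
        exact (h2 _ (adj_succ hk')).trans (congrArg (e _ _) hr)
      · intro h2
        rintro ⟨j, hj⟩ (hjk | hjk)
        · obtain rfl : 0 + 1 = j := hjk
          exact h2.trans (congrArg (e _ _) hr.symm)
        · exact absurd hjk (Nat.succ_ne_zero j)
  · have h1 := congrFun (congrArg Prod.snd (h.comp_eq (l, 0))) ⟨⟨0 + 1, hk'⟩, adj_succ hk'⟩
    rw [Rep.uEquiv_inl, Rep.bMap_inl, Rep.bMap_inl] at h1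
    exact h1
  · have h1 := congrArg Prod.fst
      (h.comp_eq (0, Pi.single ⟨⟨0 + 1, hk'⟩, adj_succ hk'⟩ r))
    rw [Rep.uEquiv_single, Rep.bMap_single, Rep.bMap_single, e2, Int.cast_neg, Int.cast_one,
      neg_one_smul, neg_one_smul, map_neg, map_neg, map_neg] at h1
    exact neg_injective h1

theorem exchange_only {e : ∀ j, j ≠ ⟨0, hn⟩ → (Vec v j ≃ₗ[ℂ] Vec v' j)}
    (h : IsPairVia ⟨0, hn⟩ m m' e)
    (hk' : 0 + 1 = n) {s₁ s₂ : Prop} (hs : s₂ → s₁) (l : Vec w ⟨0, hn⟩) :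
    (∃ t, StepRel s₁ (m.p ⟨0, hn⟩) (m.q ⟨0, hn⟩) l t ∧ (¬s₂ → t = 0)) ↔
    ∃ t, StepRel s₂ (m'.p ⟨0, hn⟩) (m'.q ⟨0, hn⟩) l t ∧ (¬s₁ → t = 0) := by
  have key := stepRel_exchange (A := m.p ⟨0, hn⟩) (C := m.q ⟨0, hn⟩) (A' := m'.p ⟨0, hn⟩)
    (C' := m'.q ⟨0, hn⟩) (B := fun _ : Unit => 0) (D := fun _ => ()) (B' := fun _ : Unit => 0)
    (D' := fun _ => ()) (Equiv.refl _) (Equiv.refl Unit)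
    (fun l r => ?_) (fun l => rfl) (fun r => ?_) hs l ()
  · simpa [StepRel] using key
  · have h1 := h.bMap_eq_zero_iff (l, 0)
    rw [Rep.bMap_inl] at h1
    refine h1.trans (exists_congr fun t => and_congr Iff.rfl ?_)
    refine iff_of_true ?_ rfl
    rintro ⟨j, hj⟩ (hjk | hjk)
    · simp only at hjk
      omega
    · exact absurd hjk (Nat.succ_ne_zero j)
  · change m.q _ 0 = m'.q _ 0
    rw [map_zero, map_zero]

variable {s : ℕ → Prop}

theorem chainRel_of_lt (h : IsPairVia i m m' e) : ∀ (k : ℕ) (hk : k < n) (hki : k < i)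
    (u : Vec w ⟨0, hn⟩) (t : Vec v ⟨k, hk⟩), chainRel hn m s k hk u t ↔
      chainRel hn m' (s ∘ Equiv.swap (i : ℕ) (i + 1)) k hk u
        (e ⟨k, hk⟩ (Fin.ne_of_lt hki) t)
  | 0, _, hki, u, t => by
    rw [chainRel, chainRel, Function.comp_apply, Equiv.swap_apply_of_ne_of_ne (by omega) (by omega)]
    refine stepRel_iff _ (Equiv.refl _) (e ⟨0, hn⟩ (Fin.ne_of_lt hki)).toEquiv
      (fun u => ?_) (fun t => ?_) u t
    · exact (LinearMap.congr_fun (h.agree.2.1 _ (Fin.ne_of_lt hki)) u).symm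
    · exact (LinearMap.congr_fun (h.agree.2.2 _ (Fin.ne_of_lt hki)) t).symm
  | k + 1, hk, hki, u, t => by
    have hki' : k < i := by omega
    rw [chainRel, chainRel, Function.comp_apply, Equiv.swap_apply_of_ne_of_ne (by omega) (by omega)]
    refine (e ⟨k, Nat.lt_of_succ_lt hk⟩ (Fin.ne_of_lt hki')).toEquiv.exists_congr fun t' =>
      and_congr (chainRel_of_lt h k _ hki' u t') ?_
    exact stepRel_iff _ (e ⟨k, Nat.lt_of_succ_lt hk⟩ (Fin.ne_of_lt hki')).toEquiv
      (e ⟨k + 1, hk⟩ (Fin.ne_of_lt hki)).toEquiv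
      (fun x => (LinearMap.congr_fun (h.agree.1 _ _ _ _ (adj_succ hk)) x).symm)
      (fun x => (LinearMap.congr_fun (h.agree.1 _ _ _ _ (adj_pred hk)) x).symm) _ _

/-- The links before `i` are untouched, so the two links at V_i can be exchanged behind a common
initial part of the chain. -/
theorem chainRel_succ (hw : ∀ i, i ≠ ⟨0, hn⟩ → w i = 0) (h : IsPairVia i m m' e)
    (hs : s (i + 1) → s i) (hk : (i : ℕ) + 1 < n) (u : Vec w ⟨0, hn⟩)
    (t : Vec v ⟨i + 1, hk⟩) : chainRel hn m s (i + 1) hk u t ↔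
      chainRel hn m' (s ∘ Equiv.swap (i : ℕ) (i + 1)) (i + 1) hk u
        (e ⟨i + 1, hk⟩ (Fin.ne_of_gt (Nat.lt_succ_self i)) t) := by
  obtain ⟨i, hi⟩ := i
  rcases i with _ | k
  · have h1 := h.exchange_first hk hs u t
    simp only [chainRel, Function.comp_apply, Equiv.swap_apply_left, Equiv.swap_apply_right,
      zero_add] at h1 ⊢
    exact h1
  · simp only [chainRel, Function.comp_apply, Equiv.swap_apply_left, Equiv.swap_apply_right]
    have hk0 : k < (⟨k + 1, hi⟩ : Fin n) := Nat.lt_succ_self k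
    constructor
    · rintro ⟨t₁, ⟨t₀, h0, h1⟩, h2⟩
      obtain ⟨t₁', h1', h2'⟩ := (h.exchange_mid hw hk hs t₀ t).1 ⟨t₁, h1, h2⟩
      exact ⟨t₁', ⟨_, (h.chainRel_of_lt k _ hk0 u t₀).1 h0, h1'⟩, h2'⟩
    · rintro ⟨t₁', ⟨t₀', h0, h1'⟩, h2'⟩
      obtain ⟨t₀, rfl⟩ := (e ⟨k, Nat.lt_of_succ_lt hi⟩ (Fin.ne_of_lt hk0)).surjective t₀'
      obtain ⟨t₁, h1, h2⟩ := (h.exchange_mid hw hk hs t₀ t).2 ⟨t₁', h1', h2'⟩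
      exact ⟨t₁, ⟨t₀, (h.chainRel_of_lt k _ hk0 u t₀).2 h0, h1⟩, h2⟩

theorem chainRel_of_gt (hw : ∀ i, i ≠ ⟨0, hn⟩ → w i = 0) (h : IsPairVia i m m' e)
    (hs : s (i + 1) → s i) (k : ℕ) (hik : (i : ℕ) + 1 ≤ k) (hk : k < n) (u : Vec w ⟨0, hn⟩)
    (t : Vec v ⟨k, hk⟩) : chainRel hn m s k hk u t ↔
      chainRel hn m' (s ∘ Equiv.swap (i : ℕ) (i + 1)) k hk u
        (e ⟨k, hk⟩ (Fin.ne_of_gt hik) t) := by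
  induction k, hik using Nat.le_induction with
  | base => exact h.chainRel_succ hw hs hk u t
  | succ k hik ih =>
    rw [chainRel, chainRel, Function.comp_apply, Equiv.swap_apply_of_ne_of_ne (by omega) (by omega)]
    refine (e ⟨k, Nat.lt_of_succ_lt hk⟩ (Fin.ne_of_gt hik)).toEquiv.exists_congr fun t' =>
      and_congr (ih _ t') ?_
    exact stepRel_iff _ (e ⟨k, Nat.lt_of_succ_lt hk⟩ (Fin.ne_of_gt hik)).toEquiv
      (e ⟨k + 1, hk⟩ (Fin.ne_of_gt (hik.trans (Nat.le_succ k)))).toEquiv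
      (fun x => (LinearMap.congr_fun (h.agree.1 _ _ _ _ (adj_succ hk)) x).symm)
      (fun x => (LinearMap.congr_fun (h.agree.1 _ _ _ _ (adj_pred hk)) x).symm) _ _

/-- Away from the end of the chain this is `chainRel_of_gt`. If `i` is the last vertex, the second
link at V_i is the terminal one, so the exchange involves the condition at 0. -/
theorem chainSet_eq (hw : ∀ i, i ≠ ⟨0, hn⟩ → w i = 0) (h : IsPairVia i m m' e)
    (hs : s (i + 1) → s i) :
    chainSet hn m s = chainSet hn m' (s ∘ Equiv.swap (i : ℕ) (i + 1)) := by
  ext u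
  refine exists_congr fun k => exists_congr fun hk => ?_
  by_cases hkn : k + 1 = n
  swap
  · exact ⟨fun ⟨_, h, _⟩ => absurd h hkn, fun ⟨_, h, _⟩ => absurd h hkn⟩
  simp only [hkn, true_and]
  rcases (Nat.le_of_lt_succ (i.2.trans_eq hkn.symm)).lt_or_eq with hik | hik
  · refine (e ⟨k, hk⟩ (Fin.ne_of_gt hik)).toEquiv.exists_congr fun t => ?_
    rw [h.chainRel_of_gt hw hs k hik hk u t, LinearEquiv.coe_toEquiv, LinearEquiv.map_eq_zero_iff, Function.comp_apply,
      Equiv.swap_apply_of_ne_of_ne (by omega) (by omega)]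
  · obtain ⟨i, hi⟩ := i
    obtain rfl : i = k := hik
    have hn1 : (s ∘ Equiv.swap i (i + 1)) n = s i := by
      rw [Function.comp_apply, ← hkn, Equiv.swap_apply_right]
    have hn2 : s n = s (i + 1) := by rw [hkn]
    simp only [hn1, hn2]
    rcases i with _ | k
    · have h1 := h.exchange_only hkn hs u
      simp only [chainRel, Function.comp_apply, Equiv.swap_apply_left, zero_add] at h1 ⊢
      exact h1
    · simp only [chainRel, Function.comp_apply, Equiv.swap_apply_left]
      have hk0 : k < (⟨k + 1, hi⟩ : Fin n) := Nat.lt_succ_self k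
      constructor
      · rintro ⟨t₁, ⟨t₀, h0, h1⟩, h2⟩
        obtain ⟨t₁', h1', h2'⟩ := (h.exchange_last hw hkn hs t₀).1 ⟨t₁, h1, h2⟩
        exact ⟨t₁', ⟨_, (h.chainRel_of_lt k _ hk0 u t₀).1 h0, h1'⟩, h2'⟩
      · rintro ⟨t₁', ⟨t₀', h0, h1'⟩, h2'⟩
        obtain ⟨t₀, rfl⟩ := (e ⟨k, Nat.lt_of_succ_lt hi⟩ (Fin.ne_of_lt hk0)).surjective t₀'
        obtain ⟨t₁, h1, h2⟩ := (h.exchange_last hw hkn hs t₀).2 ⟨t₁', h1', h2'⟩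
        exact ⟨t₁, ⟨t₀, (h.chainRel_of_lt k _ hk0 u t₀).2 h0, h1⟩, h2⟩

end IsPairVia

end ReflectChain

/-! ## The Weyl group of type `A_n` as a group of permutations -/

section Words

variable {n : ℕ}

/-- The permutation of the positions `0, …, n` attached to a word in the simple reflections. -/
def wordPerm : List (Fin n) → Equiv.Perm ℕ
  | [] => 1
  | i :: l => wordPerm l * Equiv.swap (i : ℕ) (i + 1)

theorem wordPerm_cons (i : Fin n) (l : List (Fin n)) (j : ℕ) :
    wordPerm (i :: l) j = wordPerm l (Equiv.swap (i : ℕ) (i + 1) j) := rfl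

theorem wordPerm_of_gt (l : List (Fin n)) {j : ℕ} (hj : n < j) : wordPerm l j = j := by
  induction l with
  | nil => rfl
  | cons i l ih => rw [wordPerm_cons, Equiv.swap_apply_of_ne_of_ne (by omega) (by omega), ih]

theorem wordPerm_le (l : List (Fin n)) {j : ℕ} (hj : j ≤ n) : wordPerm l j ≤ n := by
  by_contra! h
  have := (wordPerm l).injective (wordPerm_of_gt l h)
  omega

/-- The standard coordinates of type A: writing the parameter as differences makes a reflection a
transposition. -/
theorem simpleRefl_typeA {η : Fin n → ℤ} {a : ℕ → ℤ} (h : ∀ i : Fin n, η i = a i - a (i + 1))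
    (i j : Fin n) : simpleRefl (typeA n) i η j =
      a (Equiv.swap (i : ℕ) (i + 1) j) - a (Equiv.swap (i : ℕ) (i + 1) (j + 1)) := by
  have hadj : (typeA n).Adj j i ↔ (j : ℕ) + 1 = i ∨ (i : ℕ) + 1 = j := Iff.rfl
  simp only [simpleRefl, cartan, h, hadj, Fin.ext_iff, Equiv.swap_apply_def]
  obtain ⟨i, hi⟩ := i
  obtain ⟨j, hj⟩ := j
  simp only
  by_cases h1 : j = i
  · subst h1
    simp
    ring
  by_cases h2 : j + 1 = i
  · subst h2
    simp [show j ≠ j + 1 + 1 by omega]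
  by_cases h3 : i + 1 = j
  · subst h3
    simp [show i + 1 + 1 ≠ i by omega]
  · simp [h1, h2, h3, Ne.symm h3]

theorem wordAct_typeA {η : Fin n → ℤ} {a : ℕ → ℤ} (h : ∀ i : Fin n, η i = a i - a (i + 1))
    (l : List (Fin n)) (i : Fin n) :
    wordAct (typeA n) l η i = a (wordPerm l i) - a (wordPerm l (i + 1)) := by
  induction l generalizing i with
  | nil => exact h i
  | cons i' l ih =>
    exact simpleRefl_typeA (a := a ∘ wordPerm l) ih i' i

/-- The permutation is strictly decreasing on 0, …, n and preserves this interval; counting down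
from either end leaves only one possibility. -/
theorem wordPerm_of_isLongestWord {l : List (Fin n)} (hl : IsLongestWord (typeA n) l) {j : ℕ}
    (hj : j ≤ n) : wordPerm l j = n - j := by
  have hlt : ∀ j < n, wordPerm l (j + 1) < wordPerm l j := by
    intro j hj
    -- The constant parameter 1 has lift a_j = -j, so negativity after the action says that the
    -- permutation decreases at `j`.
    have h := hl (fun _ => 1) (fun _ => one_pos) ⟨j, hj⟩
    rw [wordAct_typeA (a := fun j => -(j : ℤ)) (fun i => by push_cast; ring)] at h
    simp only at h
    omega
  have h1 : ∀ j ≤ n, wordPerm l j + j ≤ n := by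
    intro j hj
    induction j with
    | zero => exact wordPerm_le l hj
    | succ j ih =>
      have := ih (by omega)
      have := hlt j hj
      omega
  have h2 : ∀ k ≤ n, k ≤ wordPerm l (n - k) := by
    intro k hk
    induction k with
    | zero => exact Nat.zero_le _
    | succ k ih =>
      have h3 := ih (by omega)
      have h4 := hlt (n - (k + 1)) (by omega)
      rw [show n - (k + 1) + 1 = n - k by omega] at h4
      omega
  have h3 := h1 j hj
  have h4 := h2 (n - j) (by omega)
  rw [show n - (n - j) = j by omega] at h4
  omega

theorem starRefl_typeA (hn : 0 < n) {w : Fin n → ℕ} (hw : ∀ i, i ≠ ⟨0, hn⟩ → w i = 0)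
    {d : Fin n → ℤ} {c : ℕ → ℤ} (h0 : c 0 = w ⟨0, hn⟩) (hc : ∀ i : Fin n, c (i + 1) = d i)
    (hlast : c (n + 1) = 0) (i : Fin n) :
    starRefl (typeA n) w i d i = c i + c (i + 2) - c (i + 1) := by
  have hnext : ∀ k (hk : k < n), (if h : k + 1 < n then d ⟨k + 1, h⟩ else 0) = c (k + 2) := by
    intro k hk
    split_ifs with h
    · exact (hc ⟨k + 1, h⟩).symm
    · rw [show k + 2 = n + 1 by omega, hlast]
  rw [starRefl, Function.update_self, sum_cartan_mul, hc]
  obtain ⟨i, hi⟩ := i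
  rcases i with _ | k
  · rw [sum_neighborSet_zero hn fun j _ => d j, hnext 0 hn, h0]
    ring
  · rw [sum_neighborSet_succ hi fun j _ => d j, hnext (k + 1) hi, hw _ (by simp),
      ← hc ⟨k, Nat.lt_of_succ_lt hi⟩]
    push_cast
    ring

/-- Extending the dimension vector by w_1 on the left and 0 on the right, an affine reflection
exchanges two consecutive differences. -/
theorem exists_heights_wordStar (hn : 0 < n) {w : Fin n → ℕ} (hw : ∀ i, i ≠ ⟨0, hn⟩ → w i = 0)
    {d : Fin n → ℤ} {c : ℕ → ℤ} (h0 : c 0 = w ⟨0, hn⟩) (hc : ∀ i : Fin n, c (i + 1) = d i)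
    (hlast : c (n + 1) = 0) (l : List (Fin n)) :
    ∃ c' : ℕ → ℤ, c' 0 = w ⟨0, hn⟩ ∧ (∀ i : Fin n, c' (i + 1) = wordStar (typeA n) w l d i) ∧
      c' (n + 1) = 0 ∧ ∀ j, c' j - c' (j + 1) = c (wordPerm l j) - c (wordPerm l j + 1) := by
  induction l with
  | nil => exact ⟨c, h0, hc, hlast, fun j => rfl⟩
  | cons i l ih =>
    obtain ⟨c', h0', hc', hlast', hdiff⟩ := ih
    have hi := i.2
    refine ⟨Function.update c' (i + 1) (c' i + c' (i + 2) - c' (i + 1)), ?_, fun j => ?_, ?_,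
      fun j => ?_⟩
    · rw [Function.update_of_ne (by omega), h0']
    · rw [wordStar, List.foldr_cons, ← wordStar]
      by_cases hj : j = i
      · subst hj
        rw [Function.update_self, starRefl_typeA hn hw h0' hc' hlast']
      · rw [Function.update_of_ne (by simpa [Fin.ext_iff] using hj), starRefl,
          Function.update_of_ne hj, hc']
    · rw [Function.update_of_ne (by omega), hlast']
    · rw [wordPerm_cons, ← hdiff]
      by_cases h1 : j = i
      · subst h1
        rw [Equiv.swap_apply_left, Function.update_of_ne (by omega), Function.update_self]
        ring
      by_cases h2 : j = i + 1
      · subst h2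
        rw [Equiv.swap_apply_right, Function.update_self, Function.update_of_ne (by omega)]
        ring
      · rw [Equiv.swap_apply_of_ne_of_ne h1 h2, Function.update_of_ne h2,
          Function.update_of_ne (by omega)]

/-- The longest element reverses the list of differences, and partial sums from opposite ends add up
to the total w_1. -/
theorem wordStar_add_rev (hn : 0 < n) {v v' w : Fin n → ℕ} (hw : ∀ i, i ≠ ⟨0, hn⟩ → w i = 0)
    {l : List (Fin n)} (hl : IsLongestWord (typeA n) l)
    (hv' : ∀ i, (v' i : ℤ) = wordStar (typeA n) w l (fun j => (v j : ℤ)) i) (i : Fin n) :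
    v' i + v i.rev = w ⟨0, hn⟩ := by
  let c : ℕ → ℤ
    | 0 => w ⟨0, hn⟩
    | j + 1 => if h : j < n then v ⟨j, h⟩ else 0
  have hc : ∀ i : Fin n, c (i + 1) = v i := fun i => dif_pos i.2
  have hlast : c (n + 1) = 0 := dif_neg (lt_irrefl n)
  obtain ⟨c', h0', hc', -, hdiff⟩ := exists_heights_wordStar hn hw rfl hc hlast l
  have key : ∀ j ≤ n + 1, c' j + c (n + 1 - j) = w ⟨0, hn⟩ := by
    intro j hj
    induction j with
    | zero => rw [h0', Nat.sub_zero, hlast, add_zero]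
    | succ j ih =>
      have h1 := ih (by omega)
      have h2 := hdiff j
      rw [wordPerm_of_isLongestWord hl (by omega)] at h2
      rw [show n + 1 - (j + 1) = n - j by omega]
      rw [show n + 1 - j = n - j + 1 by omega] at h1
      linarith
  have h := key (i + 1) (by omega)
  rw [hc', ← hv', show n + 1 - ((i : ℕ) + 1) = (i.rev : ℕ) + 1 by rw [Fin.val_rev]; omega, hc] at h
  exact_mod_cast h

theorem exists_strictMono_lift {ξ : Fin n → ℤ} (hξ : ∀ i, 0 < ξ i) :
    ∃ a : ℕ → ℤ, StrictMono a ∧ ∀ i : Fin n, (-ξ) i = a i - a (i + 1) := by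
  -- Partial sums of `ξ`; the value 1 beyond the last vertex keeps the sequence strictly increasing
  -- on all of ℕ.
  refine ⟨fun j => ∑ k ∈ Finset.range j, if h : k < n then ξ ⟨k, h⟩ else 1,
    strictMono_nat_of_lt_succ fun j => ?_, fun i => ?_⟩
  · rw [Finset.sum_range_succ]
    split_ifs with h
    · linarith [hξ ⟨j, h⟩]
    · linarith
  · beta_reduce
    rw [Finset.sum_range_succ, dif_pos i.2, Pi.neg_apply]
    ring

/-- Genericity: a permutation of the strictly increasing lift never takes equal values at
consecutive positions. -/
theorem wordAct_neg_ne_zero {ξ : Fin n → ℤ} (hξ : ∀ i, 0 < ξ i) (l : List (Fin n)) (i : Fin n) :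
    wordAct (typeA n) l (-ξ) i ≠ 0 := by
  obtain ⟨a, ha, hξa⟩ := exists_strictMono_lift hξ
  rw [wordAct_typeA hξa, sub_ne_zero]
  intro h
  have := (wordPerm l).injective (ha.injective h)
  omega

/-- Reversing the positions sends -ξ to the reversal of ξ, which is ξ by the symmetry `hθ`. -/
theorem wordAct_neg_eq {ξ : Fin n → ℤ} (hξ : ∀ i, 0 < ξ i) (hθ : ∀ i, ξ i.rev = ξ i)
    {l : List (Fin n)} (hl : IsLongestWord (typeA n) l) : wordAct (typeA n) l (-ξ) = ξ := by
  obtain ⟨a, -, hξa⟩ := exists_strictMono_lift hξ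
  funext i
  have h := hξa i.rev
  rw [Pi.neg_apply, hθ, Fin.val_rev, show n - ((i : ℕ) + 1) + 1 = n - i by omega] at h
  rw [wordAct_typeA hξa, wordPerm_of_isLongestWord hl (by omega),
    wordPerm_of_isLongestWord hl (by omega)]
  linarith

end Words

/-! ## Invariance under reflection functors -/

section Invariance

variable {n : ℕ} {w : Fin n → ℕ} {hn : 0 < n}

/-- The threshold c makes the choice of links compatible with every sign of the parameter: if the
current η_i is negative, then a forward link at i + 1 forces one at i, which is the hypothesis of
`IsPairVia.chainSet_eq`. -/
theorem isReflection_invariants (hw : ∀ i, i ≠ ⟨0, hn⟩ → w i = 0) {η : Fin n → ℤ} {a : ℕ → ℤ}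
    (ha : ∀ i : Fin n, η i = a i - a (i + 1)) :
    ∀ (l : List (Fin n)) {v v' : Fin n → ℕ} {m : Rep (typeA n) v w} {m' : Rep (typeA n) v' w},
      Rep.IsReflection (epsA n) η 0 l m m' →
      m.q ⟨0, hn⟩ ∘ₗ m.p ⟨0, hn⟩ = m'.q ⟨0, hn⟩ ∘ₗ m'.p ⟨0, hn⟩ ∧
      ∀ c : ℤ, chainSet hn m (fun j => a j < c) = chainSet hn m' (fun j => a (wordPerm l j) < c)
  | [], _, _, m, m', h =>
    ⟨congrArg Prod.fst (Rep.Equivalent.nakajimaPair_eq hn h.2), fun _ => chainSet_equivalent h.2⟩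
  | i :: l, _, _, m, m', h => by
    obtain ⟨u, m₁, h1, -, -, -, h2⟩ := h
    obtain ⟨hx, hs⟩ := isReflection_invariants hw ha l h1
    rw [hx]
    simp only [hs]
    rw [wordAct_zero, simpleRefl_zero, wordAct_typeA ha] at h2
    rcases h2 with ⟨hη | hη, h2⟩ | ⟨hη, h2⟩
    · obtain ⟨e, he⟩ := isPairVia_of_isReflectionPair h2
      exact ⟨he.endo_eq, fun c => he.chainSet_eq hw fun hc => by linarith⟩
    · exact absurd rfl hη
    · obtain ⟨e, he⟩ := isPairVia_of_isReflectionPair h2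
      refine ⟨he.endo_eq.symm, fun c => ?_⟩
      -- For positive η_i the reflection pair runs from `m'` back to `m₁`, so the exchange is
      -- applied to the already permuted choices and undone by the involutive swap.
      rw [he.chainSet_eq hw (s := fun j => a (wordPerm (i :: l) j) < c)]
      · congr 1
        funext j
        simp only [Function.comp_apply, wordPerm_cons, Equiv.swap_apply_self]
      · simp only [wordPerm_cons, Equiv.swap_apply_left, Equiv.swap_apply_right]
        intro hc
        linarith

variable {v : Fin n → ℕ} {BV : ∀ i, LinearMap.BilinForm ℂ (Vec v i)}
  (hV : ∀ i, (BV i).Nondegenerate) {BW : ∀ i, LinearMap.BilinForm ℂ (Vec w i)}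
  (hW : ∀ i, (BW i).Nondegenerate)

/-- One sign comes from p and one from each forward arrow, for which ε = -1. -/
theorem pathMap_tau (m : Rep (typeA n) v w) (k : ℕ) (hk : k < n) :
    pathMap (hn := hn) (Rep.tau (epsA n) BV hV BW hW m) k hk = (-1 : ℂ) ^ (k + 1) •
      rightAdjoint (BV ⟨k, hk⟩) (hV ⟨k, hk⟩) (BW ⟨0, hn⟩) (frameMap hn m k hk) := by
  induction k with
  | zero =>
    rw [zero_add, pow_one]
    exact (neg_one_smul ℂ _).symm
  | succ k ih =>
    have hε : (epsA n ⟨k, Nat.lt_of_succ_lt hk⟩ ⟨k + 1, hk⟩ : ℂ) = -1 := by simp [epsA]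
    rw [pathMap, ih, frameMap_succ, rightAdjoint_comp _ (hV ⟨k, Nat.lt_of_succ_lt hk⟩), Rep.fwd,
      Rep.tau_x, hε, LinearMap.comp_smul, LinearMap.smul_comp, smul_smul, ← pow_succ]
    rfl

theorem ker_pathMap_tau (m : Rep (typeA n) v w) (k : ℕ) (hk : k < n) :
    LinearMap.ker (pathMap (hn := hn) (Rep.tau (epsA n) BV hV BW hW m) k hk) =
      (BW ⟨0, hn⟩).orthogonal (LinearMap.range (frameMap hn m k hk)) := by
  ext u
  rw [LinearMap.mem_ker, pathMap_tau, LinearMap.smul_apply, smul_eq_zero_iff_right (by simp),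
    LinearMap.BilinForm.mem_orthogonal_iff]
  constructor
  · rintro h _ ⟨t, rfl⟩
    exact (rightAdjoint_spec _ (hV ⟨k, hk⟩) _ _ _ _).trans (by rw [h, map_zero])
  · intro h
    refine eq_of_forall_bilin_eq (hV ⟨k, hk⟩) fun t => ?_
    rw [← rightAdjoint_spec, map_zero]
    exact h _ ⟨t, rfl⟩

theorem endo_tau (m : Rep (typeA n) v w) (i : Fin n) :
    (Rep.tau (epsA n) BV hV BW hW m).q i ∘ₗ (Rep.tau (epsA n) BV hV BW hW m).p i =
      -rightAdjoint (BW i) (hW i) (BW i) (m.q i ∘ₗ m.p i) := by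
  rw [Rep.tau_p, Rep.tau_q, LinearMap.comp_neg, rightAdjoint_comp _ (hV i)]

theorem nakajimaPair_of_isReflection_tau (hw : ∀ i, i ≠ ⟨0, hn⟩ → w i = 0) {ξ : Fin n → ℤ}
    (hξ : ∀ i, 0 < ξ i) {l : List (Fin n)} (hl : IsLongestWord (typeA n) l) {v' : Fin n → ℕ}
    {m : Rep (typeA n) v w} {m' : Rep (typeA n) v' w}
    (h : Rep.IsReflection (epsA n) (-ξ) 0 l (Rep.tau (epsA n) BV hV BW hW m) m') :
    nakajimaPair hn m' =
      (-rightAdjoint (BW ⟨0, hn⟩) (hW ⟨0, hn⟩) (BW ⟨0, hn⟩) (nakajimaPair hn m).1,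
        perpFlag (BW ⟨0, hn⟩) (nakajimaPair hn m).2) := by
  obtain ⟨a, ha, hξa⟩ := exists_strictMono_lift hξ
  obtain ⟨hx, hs⟩ := isReflection_invariants (hn := hn) hw hξa l h
  refine Prod.ext (hx.symm.trans (endo_tau hV hW m _)) ?_
  refine flagOfFrames_eq_perpFlag (hW ⟨0, hn⟩) fun i => SetLike.coe_injective ?_
  rw [← ker_pathMap_tau hV hW, ← chainSet_lt, ← chainSet_gt]
  -- This threshold selects the positions j < i.rev + 1 before the reflections; reversal turns them
  -- into the positions j > i.
  have h1 := hs (a (i.rev + 1))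
  simp only [ha.lt_iff_lt] at h1
  rw [h1]
  refine chainSet_congr fun j hj => ?_
  rw [wordPerm_of_isLongestWord hl hj, Fin.val_rev]
  omega

end Invariance

end SigmaQuiver

end

theorem theorem6p2p1 (n : ℕ) (hn : 0 < n)
    -- dimension vectors: `w` is supported at the first vertex, `w_1 ≥ v_1 ≥ ⋯ ≥ v_n`
    (v w : Fin n → ℕ) (hw : ∀ i, i ≠ ⟨0, hn⟩ → w i = 0)
    (hv : Antitone v) (hvw : v ⟨0, hn⟩ ≤ w ⟨0, hn⟩)
    -- the parameter `ζ = (ξ, 0)`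
    (ξ : Fin n → ℤ) (hξ : ∀ i, 0 < ξ i) (hθ : ∀ i, ξ i.rev = ξ i)
    -- the forms on `V` and `W`
    (BV : ∀ i, LinearMap.BilinForm ℂ (Vec v i)) (hV : ∀ i, (BV i).Nondegenerate)
    (BW : ∀ i, LinearMap.BilinForm ℂ (Vec w i)) (hW : ∀ i, (BW i).Nondegenerate)
    -- an expression of the longest element `w_0`, and `v' = w_0 * v`
    (l : List (Fin n)) (hl : IsLongestWord (typeA n) l)
    (v' : Fin n → ℕ) (hv' : ∀ i, (v' i : ℤ) = wordStar (typeA n) w l (fun j => (v j : ℤ)) i) :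
    ∃ (φ : VarietyIso (quiverVariety (typeA n) (epsA n) ξ 0 v w)
          (cotangentVariety v (w ⟨0, hn⟩)))
      (φ' : VarietyIso (quiverVariety (typeA n) (epsA n) ξ 0 v' w)
          (cotangentVariety v' (w ⟨0, hn⟩)))
      (σ : VarietyIso (quiverVariety (typeA n) (epsA n) ξ 0 v w)
          (quiverVariety (typeA n) (epsA n) ξ 0 v' w))
      (σ₁ : VarietyIso (cotangentVariety v (w ⟨0, hn⟩)) (cotangentVariety v' (w ⟨0, hn⟩))),
      -- `φ` and `φ'` are Nakajima's isomorphisms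
      (∀ m, (φ.toEquiv (orbit (typeA n) (epsA n) ξ 0 v w m)).1 = nakajimaPair hn m.1) ∧
      (∀ m, (φ'.toEquiv (orbit (typeA n) (epsA n) ξ 0 v' w m)).1 = nakajimaPair hn m.1) ∧
      -- `σ = S_{w_0} τ`
      (∀ y y', σ.toEquiv y = y' ↔ IsSigma (epsA n) ξ 0 l BV hV BW hW y y') ∧
      -- `σ₁ (x, F) = (-x^*, F^⊥)`
      (∀ z, (σ₁.toEquiv z).1 =
        (-rightAdjoint (BW ⟨0, hn⟩) (hW ⟨0, hn⟩) (BW ⟨0, hn⟩) z.1.1,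
          perpFlag (BW ⟨0, hn⟩) z.1.2)) ∧
      -- `σ` is identified with `σ₁`
      (∀ y, φ'.toEquiv (σ.toEquiv y) = σ₁.toEquiv (φ.toEquiv y)) ∧
      -- if `w_0 * v = v`, then `φ` identifies the `σ`-quiver variety with the cotangent bundle of
      -- the variety of isotropic flags
      (v' = v →
        ∃ ψ : VarietyIso
            ((quiverVariety (typeA n) (epsA n) ξ 0 v w).induced
              (sigmaFixed (epsA n) ξ 0 l BV hV BW hW))
            ((cotangentVariety v (w ⟨0, hn⟩)).induced
              (isotropicCotangent v (BW ⟨0, hn⟩) (hW ⟨0, hn⟩))),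
          ∀ y, (ψ.toEquiv y).1 = φ.toEquiv y.1) := by
  have hd := wordStar_add_rev hn hw hl hv'
  let φ := nakajimaIso (v := v) hn hw hξ
  let φ' := nakajimaIso (v := v') hn hw hξ
  let σ₁ := perpIso (v := v) (hW ⟨0, hn⟩) hd
  -- Defining σ by transport makes it an isomorphism with the required commutation; the work lies in
  -- identifying it with S_{w_0} τ.
  let σ := φ.trans (σ₁.trans φ'.symm)
  have hcomm : ∀ y, φ'.toEquiv (σ.toEquiv y) = σ₁.toEquiv (φ.toEquiv y) := fun y =>
    φ'.toEquiv.apply_symm_apply _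
  have hσ₁ : ∀ z, (σ₁.toEquiv z).1 =
      (-rightAdjoint (BW ⟨0, hn⟩) (hW ⟨0, hn⟩) (BW ⟨0, hn⟩) z.1.1,
        perpFlag (BW ⟨0, hn⟩) z.1.2) := fun z => rfl
  have hσ : ∀ y y', σ.toEquiv y = y' ↔ IsSigma (epsA n) ξ 0 l BV hV BW hW y y' := by
    intro y y'
    rw [← φ'.toEquiv.apply_eq_iff_eq, hcomm]
    constructor
    · intro h
      obtain ⟨m, rfl⟩ := Quotient.exists_rep y
      obtain ⟨u, m', h1, h2, h3⟩ := Rep.exists_isReflection epsA_antisymm epsA_mul_self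
        (Rep.tau_mem hV hW epsA_antisymm epsA_mul_self m.2) l fun l' _ => wordAct_neg_ne_zero hξ l'
      -- The reflected point has the dimension vector w_0 * v, so it is a candidate for a
      -- representative of `y'`; injectivity of φ' then reduces equality of orbits to equality of
      -- flags and endomorphisms.
      obtain rfl : u = v' := funext fun i => Nat.cast_injective (R := ℤ) ((h3 i).trans (hv' i).symm)
      rw [wordAct_neg_eq hξ hθ hl] at h2
      refine ⟨m, ⟨m', h2⟩, rfl, φ'.toEquiv.injective ?_, by rwa [neg_zero]⟩
      rw [← h]
      exact Subtype.ext (nakajimaPair_of_isReflection_tau hV hW hw hξ hl h1)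
    · rintro ⟨m, m', rfl, rfl, h⟩
      rw [neg_zero] at h
      exact Subtype.ext (nakajimaPair_of_isReflection_tau hV hW hw hξ hl h).symm
  refine ⟨φ, φ', σ, σ₁, fun _ => rfl, fun _ => rfl, hσ, hσ₁, hcomm, ?_⟩
  rintro rfl
  refine ⟨φ.restrict _ _ fun y => ?_, fun _ => rfl⟩
  -- Being fixed by σ means φ(y) = σ₁(φ(y)), whose two components are x = -x^* and F = F^⊥.
  rw [sigmaFixed, Set.mem_ofPred_eq, ← hσ, ← φ'.toEquiv.apply_eq_iff_eq, hcomm, eq_comm,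
    Subtype.ext_iff, hσ₁, Prod.ext_iff]
  rfl
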